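/- An instance of non-preemptive mixed-criticality match-up scheduling consists of a finite nonempty set $\mathcal B$ of jobs; each job $B$ has a height $h(B)\in\mathbb N$, $h(B)\ge 1$, and real processing times $0\le p(B,1)\le p(B,2)\le\dots\le p(B,h(B))$. A schedule is a map $\sigma:\mathcal B\to\mathbb R_{\ge 0}$ (start times). It is feasible if for every layer $i\ge 1$ and any two distinct jobs $B,B'$ with $\min\{h(B),h(B')\}\ge i$, we have $\sigma(B')+p(B',i)\le\sigma(B)$ or $\sigma(B)+p(B,i)\le\sigma(B')$. Its makespan is $T(\sigma)=\max_{B\in\mathcal B}\bigl(\sigma(B)+p(B,h(B))\bigr)$. Put $L:=\max_{B\in\mathcal B}h(B)$. Theorem. There are an algorithm (a single program for the real random access machine with unit-cost real operations $+,-,\cdot,/,\le$, natural-number operations $+$, truncated $-$, $\le$, and arrays) and absolute constants $c$ and $C$ such that, on every input consisting of an instance $(\mathcal B,h,p)$ and a real number $0<\epsilon\le 1/2$, the algorithm halts after at most $$C\cdot L\cdot|\mathcal B|^{\,C\cdot\frac1\epsilon\log_{1+\epsilon}\frac1\epsilon}$$ steps and outputs a feasible schedule $\sigma$ with $T(\sigma)\le\lceil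 L/2\rceil\,(1+c\,\epsilon)\,T(\tau)$ for every feasible schedule $\tau$. That is, a $\lceil L/2\rceil(1+O(\epsilon))$-approximation of the optimal makespan can be computed in time $L\,|\mathcal B|^{O(\frac1\epsilon\log_{1+\epsilon}\frac1\epsilon)}$. -/

import Mathlib

/-! A real random access machine, given by structured programs with a step count.

The memory consists of natural-number variables and arrays (for counting and addressing) and of
real variables and arrays (for the data). Natural numbers may be added, subtracted (truncated at 0)
and compared; reals may be added, subtracted, multiplied, divided and compared. There is no
rounding operation, no passage from real to natural values except through comparisons, and the
only real constants in a program are rational. Every operation, memory access and test has unit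
cost. -/

namespace RealRAM

/-- The memory. Variables are named by numbers; an array is named by its first argument and has one
cell for each natural number. -/
structure State where
  nvar : ℕ → ℕ
  narr : ℕ → ℕ → ℕ
  rvar : ℕ → ℝ
  rarr : ℕ → ℕ → ℝ

/-- Natural-number expressions. -/
inductive NExp where
  | const (k : ℕ)
  | var (x : ℕ)
  | cell (a : ℕ) (i : NExp)
  | add (e f : NExp)
  | sub (e f : NExp)

/-- The value of a natural-number expression; subtraction is truncated at 0. -/
def NExp.eval (s : State) : NExp → ℕ
  | .const k => k
  | .var x => s.nvar x
  | .cell a i => s.narr a (i.eval s)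
  | .add e f => e.eval s + f.eval s
  | .sub e f => e.eval s - f.eval s

/-- The number of unit-cost operations in the evaluation of a natural-number expression. -/
def NExp.cost : NExp → ℕ
  | .const _ => 1
  | .var _ => 1
  | .cell _ i => i.cost + 1
  | .add e f => e.cost + f.cost + 1
  | .sub e f => e.cost + f.cost + 1

/-- Real expressions. -/
inductive RExp where
  | const (q : ℚ)
  | var (x : ℕ)
  | cell (a : ℕ) (i : NExp)
  | add (e f : RExp)
  | sub (e f : RExp)
  | mul (e f : RExp)
  | div (e f : RExp)

/-- The value of a real expression; division by 0 returns 0. -/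
noncomputable def RExp.eval (s : State) : RExp → ℝ
  | .const q => (q : ℝ)
  | .var x => s.rvar x
  | .cell a i => s.rarr a (i.eval s)
  | .add e f => e.eval s + f.eval s
  | .sub e f => e.eval s - f.eval s
  | .mul e f => e.eval s * f.eval s
  | .div e f => e.eval s / f.eval s

/-- The number of unit-cost operations in the evaluation of a real expression. -/
def RExp.cost : RExp → ℕ
  | .const _ => 1
  | .var _ => 1
  | .cell _ i => i.cost + 1
  | .add e f => e.cost + f.cost + 1
  | .sub e f => e.cost + f.cost + 1
  | .mul e f => e.cost + f.cost + 1
  | .div e f => e.cost + f.cost + 1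

/-- Tests. -/
inductive BExp where
  | leN (e f : NExp)
  | leR (e f : RExp)
  | not (b : BExp)
  | and (b c : BExp)

/-- The truth of a test in a given state. -/
def BExp.eval (s : State) : BExp → Prop
  | .leN e f => e.eval s ≤ f.eval s
  | .leR e f => e.eval s ≤ f.eval s
  | .not b => ¬ b.eval s
  | .and b c => b.eval s ∧ c.eval s

/-- The number of unit-cost operations in a test. -/
def BExp.cost : BExp → ℕ
  | .leN e f => e.cost + f.cost + 1
  | .leR e f => e.cost + f.cost + 1
  | .not b => b.cost + 1
  | .and b c => b.cost + c.cost + 1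

/-- Programs: assignments to variables and to array cells, sequencing, branching, while loops. -/
inductive Prog where
  | skip
  | setN (x : ℕ) (e : NExp)
  | setR (x : ℕ) (e : RExp)
  | storeN (a : ℕ) (i : NExp) (e : NExp)
  | storeR (a : ℕ) (i : NExp) (e : RExp)
  | seq (c d : Prog)
  | cond (b : BExp) (c d : Prog)
  | loop (b : BExp) (c : Prog)

/-- `Exec c s t s'`: started in state `s`, the program `c` halts in state `s'` after exactly
`t` unit-cost steps. -/
inductive Exec : Prog → State → ℕ → State → Prop where
  | skip (s : State) : Exec .skip s 1 s
  | setN (s : State) (x : ℕ) (e : NExp) :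
      Exec (.setN x e) s (e.cost + 1)
        { s with nvar := Function.update s.nvar x (e.eval s) }
  | setR (s : State) (x : ℕ) (e : RExp) :
      Exec (.setR x e) s (e.cost + 1)
        { s with rvar := Function.update s.rvar x (e.eval s) }
  | storeN (s : State) (a : ℕ) (i : NExp) (e : NExp) :
      Exec (.storeN a i e) s (i.cost + e.cost + 1)
        { s with narr := Function.update s.narr a
                    (Function.update (s.narr a) (i.eval s) (e.eval s)) }
  | storeR (s : State) (a : ℕ) (i : NExp) (e : RExp) :
      Exec (.storeR a i e) s (i.cost + e.cost + 1)
        { s with rarr := Function.update s.rarr a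
                    (Function.update (s.rarr a) (i.eval s) (e.eval s)) }
  | seq {c d : Prog} {s s₁ s₂ : State} {t₁ t₂ : ℕ} :
      Exec c s t₁ s₁ → Exec d s₁ t₂ s₂ → Exec (.seq c d) s (t₁ + t₂) s₂
  | cond_true {b : BExp} {c d : Prog} {s s₁ : State} {t : ℕ} :
      b.eval s → Exec c s t s₁ → Exec (.cond b c d) s (b.cost + 1 + t) s₁
  | cond_false {b : BExp} {c d : Prog} {s s₁ : State} {t : ℕ} :
      ¬ b.eval s → Exec d s t s₁ → Exec (.cond b c d) s (b.cost + 1 + t) s₁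
  | loop_true {b : BExp} {c : Prog} {s s₁ s₂ : State} {t₁ t₂ : ℕ} :
      b.eval s → Exec c s t₁ s₁ → Exec (.loop b c) s₁ t₂ s₂ →
      Exec (.loop b c) s (b.cost + 1 + t₁ + t₂) s₂
  | loop_false {b : BExp} {c : Prog} {s : State} :
      ¬ b.eval s → Exec (.loop b c) s (b.cost + 1) s

end RealRAM

/-! Non-preemptive mixed-criticality match-up scheduling on one processor. -/

namespace MatchUp

/-- An instance: a nonempty set of `n` F-shaped jobs. Job `B` has height `h B ≥ 1` and processing
times `0 ≤ p B 1 ≤ p B 2 ≤ ⋯ ≤ p B (h B)`. The values of `p B` outside the layers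
`1, …, h B` play no role. -/
structure Instance where
  n : ℕ
  h : Fin n → ℕ
  p : Fin n → ℕ → ℝ
  n_pos : 0 < n
  one_le_h : ∀ B, 1 ≤ h B
  p_nonneg : ∀ B i, 1 ≤ i → i ≤ h B → 0 ≤ p B i
  p_mono : ∀ B i j, 1 ≤ i → i ≤ j → j ≤ h B → p B i ≤ p B j

/-- The maximum criticality level, that is, the maximum height of a job. -/
def Instance.L (Ψ : Instance) : ℕ := Finset.univ.sup Ψ.h

/-- A schedule assigns nonnegative start times to the jobs. It is feasible if any two distinct jobs
are disjoint in every layer that both of them have. -/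
def Instance.Feasible (Ψ : Instance) (σ : Fin Ψ.n → ℝ) : Prop :=
  (∀ B, 0 ≤ σ B) ∧
  ∀ i, 1 ≤ i → i ≤ Ψ.L → ∀ B B', B ≠ B' → i ≤ min (Ψ.h B) (Ψ.h B') →
    σ B' + Ψ.p B' i ≤ σ B ∨ σ B + Ψ.p B i ≤ σ B'

/-- The makespan: the maximum over all jobs `B` of the completion time `σ B + p B (h B)`. -/
noncomputable def Instance.makespan (Ψ : Instance) (σ : Fin Ψ.n → ℝ) : ℝ :=
  Finset.univ.sup' ⟨⟨0, Ψ.n_pos⟩, Finset.mem_univ _⟩ fun B => σ B + Ψ.p B (Ψ.h B)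

/-- `σ` is an `α`-approximation: a feasible schedule whose makespan is at most `α` times that of
every feasible schedule. -/
def Instance.IsApprox (Ψ : Instance) (α : ℝ) (σ : Fin Ψ.n → ℝ) : Prop :=
  Ψ.Feasible σ ∧ ∀ τ, Ψ.Feasible τ → Ψ.makespan σ ≤ α * Ψ.makespan τ

/-- The processing times, listed job by job and for each job from layer 1 up to its height. -/
def Instance.layerList (Ψ : Instance) : List ℝ :=
  (List.ofFn fun B => (List.range (Ψ.h B)).map fun i => Ψ.p B (i + 1)).flatten

/-- The memory that holds the input `(Ψ, ε)`: the number of jobs in natural variable 0, the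
heights in natural array 0, the error parameter in real variable 0 and the list of processing
times in real array 0. Everything else is 0. -/
noncomputable def Instance.input (Ψ : Instance) (ε : ℝ) : RealRAM.State where
  nvar x := if x = 0 then Ψ.n else 0
  narr a k := if a = 0 then (if hk : k < Ψ.n then Ψ.h ⟨k, hk⟩ else 0) else 0
  rvar x := if x = 0 then ε else 0
  rarr a k := if a = 0 then Ψ.layerList.getD k 0 else 0

/-- The schedule written by a program: start times in real array 1. -/
def Instance.output (Ψ : Instance) (s : RealRAM.State) : Fin Ψ.n → ℝ :=
  fun B => s.rarr 1 B

end MatchUp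

/-! Group the jobs into classes: heights `q` and `q + 1` for each odd `q`. There are ⌈L/2⌉ classes.
Each is scheduled with length at most `1 + 12ε` times a lower bound for every makespan, and the
class schedules are put one behind the other. This gives the factor.

Inside a class, call the jobs of height `q` items and those of height `q + 1` bins. A bin of full
length `s i` and lower length `q i` leaves a gap `s i - q i` in layer `q` that items may use. Up to
shortening, a schedule is an assignment of items to bins, of length `classCost`
(`exists_classCost_le`). By `classCost_eq`, minimising this length means maximising the total of
min(load, gap), or equivalently minimising the unused gap. The total length `A` of the class is at
most twice the cost, so losses of order `εA` are affordable.

Item sizes (`rep`) and gaps scaled by `ε` (`lev`, the level of the bin) are rounded down to the grid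
`A / (1 + ε) ^ k`; values up to about `δ = ε²A/n` become 0. Relative to a bin of level `a`, items
fall into three kinds. If the size exceeds `a / ε²`, the whole gap is a fraction O(ε) of the item
and can be charged to it. If the size is below `a`, the item is fluid: put into any bin with room,
it overfills that bin by at most `ε` times the gap. In between lies a window of `K`, about `2
log_{1+ε}(1/ε)`, sizes. The losses are added up in `min_load_le` and `classCost_le_of_unused_le`.

A dynamic program lets `a` descend through the grid. On level `a` it opens each bin of that level,
fills it with items from the window, closes it and adds what is left to a single number `F`; then it
pours items of size exactly `a` into any opened bins with room, lowering `F`. For the future, a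
partial solution (`Row`) matters only through its key, that is, the capacity left in the current bin
and the number of free items of each rounded size up to `a / ε²`, and through `F`; so one row per
key, with least `F`, is enough within a stage. Since sizes below `a` are still untouched, a stage
adds at most `(n + 1) ^ (2K)` rows (`card_le_of_distinct`). Two invariants meet at the end: for
every assignment `X` some row has `F` at most the unused gap of the relevant part of `X`
(`LevelInv.covered`), and the true unused gap of a row is at most `F` plus `ε` times all gaps
(`Valid.unused_le`).

Memory. Natural variables: 0 number of jobs, 1 maximum height, 3 class, 4 number of rows, 5 current
bin, 6 current item, 7 parent row, 8 target, 18 best row. Real variables: 0 `ε`, 1 number of jobs, 2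
end of the schedule, 3 `A`, 4 `δ`, 5 `a`, 6 `a / ε²`, 10 upper end of the window. Natural arrays: 0
heights, 1 assignments, 2 offsets of the rows. Real arrays: 0 input, 1 output, 2 full lengths, 3
lengths one layer below the top, 4 `rep`, 5 `lev`, 6 remaining capacities, 7 `F`. -/

namespace RealRAM

/-! ### Total correctness with step bounds and frames for the real RAM. -/

/-- Assignment to a natural variable. -/
def State.setn (s : State) (x v : ℕ) : State := { s with nvar := Function.update s.nvar x v }

/-- Assignment to a real variable. -/
def State.setr (s : State) (x : ℕ) (v : ℝ) : State := { s with rvar := Function.update s.rvar x v }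

/-- Assignment to a cell of an array of natural numbers. -/
def State.putn (s : State) (a i v : ℕ) : State :=
  { s with narr := Function.update s.narr a (Function.update (s.narr a) i v) }

/-- Assignment to a cell of an array of real numbers. -/
def State.putr (s : State) (a i : ℕ) (v : ℝ) : State :=
  { s with rarr := Function.update s.rarr a (Function.update (s.rarr a) i v) }

namespace State

variable (s : State) (x y a i v : ℕ) (w : ℝ)

@[simp] theorem setn_nvar : (s.setn x v).nvar y = if y = x then v else s.nvar y := by
  simp [setn, Function.update_apply]
@[simp] theorem setn_narr : (s.setn x v).narr = s.narr := rfl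
@[simp] theorem setn_rvar : (s.setn x v).rvar = s.rvar := rfl
@[simp] theorem setn_rarr : (s.setn x v).rarr = s.rarr := rfl
@[simp] theorem setr_nvar : (s.setr x w).nvar = s.nvar := rfl
@[simp] theorem setr_narr : (s.setr x w).narr = s.narr := rfl
@[simp] theorem setr_rvar : (s.setr x w).rvar y = if y = x then w else s.rvar y := by
  simp [setr, Function.update_apply]
@[simp] theorem setr_rarr : (s.setr x w).rarr = s.rarr := rfl
@[simp] theorem putn_nvar : (s.putn a i v).nvar = s.nvar := rfl
@[simp] theorem putn_narr : (s.putn a i v).narr y x =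
    if y = a ∧ x = i then v else s.narr y x := by
  by_cases h : y = a
  · subst h; simp [putn, Function.update_apply]
  · simp [putn, h]
@[simp] theorem putn_rvar : (s.putn a i v).rvar = s.rvar := rfl
@[simp] theorem putn_rarr : (s.putn a i v).rarr = s.rarr := rfl
@[simp] theorem putr_nvar : (s.putr a i w).nvar = s.nvar := rfl
@[simp] theorem putr_narr : (s.putr a i w).narr = s.narr := rfl
@[simp] theorem putr_rvar : (s.putr a i w).rvar = s.rvar := rfl
@[simp] theorem putr_rarr : (s.putr a i w).rarr y x =
    if y = a ∧ x = i then w else s.rarr y x := by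
  by_cases h : y = a
  · subst h; simp [putr, Function.update_apply]
  · simp [putr, h]

end State

/-- Whether a program assigns to a natural variable. -/
def Prog.wn (y : ℕ) : Prog → Bool
  | .setN x _ => y == x
  | .seq c d => c.wn y || d.wn y
  | .cond _ c d => c.wn y || d.wn y
  | .loop _ c => c.wn y
  | _ => false

/-- Whether a program assigns to a real variable. -/
def Prog.wr (y : ℕ) : Prog → Bool
  | .setR x _ => y == x
  | .seq c d => c.wr y || d.wr y
  | .cond _ c d => c.wr y || d.wr y
  | .loop _ c => c.wr y
  | _ => false

/-- Whether a program stores to an array of natural numbers. -/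
def Prog.wna (y : ℕ) : Prog → Bool
  | .storeN x _ _ => y == x
  | .seq c d => c.wna y || d.wna y
  | .cond _ c d => c.wna y || d.wna y
  | .loop _ c => c.wna y
  | _ => false

/-- Whether a program stores to an array of real numbers. -/
def Prog.wra (y : ℕ) : Prog → Bool
  | .storeR x _ _ => y == x
  | .seq c d => c.wra y || d.wra y
  | .cond _ c d => c.wra y || d.wra y
  | .loop _ c => c.wra y
  | _ => false

/-- `s'` differs from `s` only in the variables and arrays to which `c` assigns. -/
structure Frame (c : Prog) (s s' : State) : Prop where
  n : ∀ y, c.wn y = false → s'.nvar y = s.nvar y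
  r : ∀ y, c.wr y = false → s'.rvar y = s.rvar y
  na : ∀ y, c.wna y = false → s'.narr y = s.narr y
  ra : ∀ y, c.wra y = false → s'.rarr y = s.rarr y

theorem Frame.refl (c : Prog) (s : State) : Frame c s s :=
  ⟨fun _ _ => rfl, fun _ _ => rfl, fun _ _ => rfl, fun _ _ => rfl⟩

theorem Frame.trans {c : Prog} {s s₁ s₂ : State} (h : Frame c s s₁) (k : Frame c s₁ s₂) :
    Frame c s s₂ :=
  ⟨fun y e => (k.n y e).trans (h.n y e), fun y e => (k.r y e).trans (h.r y e),
   fun y e => (k.na y e).trans (h.na y e), fun y e => (k.ra y e).trans (h.ra y e)⟩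

theorem Frame.weaken {c d : Prog} {s s' : State} (h : Frame c s s')
    (hn : ∀ y, d.wn y = false → c.wn y = false) (hr : ∀ y, d.wr y = false → c.wr y = false)
    (hna : ∀ y, d.wna y = false → c.wna y = false)
    (hra : ∀ y, d.wra y = false → c.wra y = false) : Frame d s s' :=
  ⟨fun y e => h.n y (hn y e), fun y e => h.r y (hr y e),
   fun y e => h.na y (hna y e), fun y e => h.ra y (hra y e)⟩

theorem Frame.seq_left {c d : Prog} {s s' : State} (h : Frame c s s') :
    Frame (.seq c d) s s' := by
  apply h.weaken <;> intro y <;> simp [Prog.wn, Prog.wr, Prog.wna, Prog.wra] <;> tauto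

theorem Frame.seq_right {c d : Prog} {s s' : State} (h : Frame d s s') :
    Frame (.seq c d) s s' := by
  apply h.weaken <;> intro y <;> simp [Prog.wn, Prog.wr, Prog.wna, Prog.wra]

theorem Frame.loop {b : BExp} {c : Prog} {s s' : State} (h : Frame c s s') :
    Frame (.loop b c) s s' := ⟨h.n, h.r, h.na, h.ra⟩

/-- The write sets are computable Booleans, so for a concrete program every claim that a variable or
array survives is proved by `rfl`. This replaces explicit non-interference invariants below. -/
theorem Exec.frame {c : Prog} {s s' : State} {t : ℕ} (h : Exec c s t s') : Frame c s s' := by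
  induction h with
  | skip => exact Frame.refl _ _
  | setN s x e =>
    refine ⟨fun y h => ?_, fun _ _ => rfl, fun _ _ => rfl, fun _ _ => rfl⟩
    have : y ≠ x := by simpa [Prog.wn] using h
    simp [this]
  | setR s x e =>
    refine ⟨fun _ _ => rfl, fun y h => ?_, fun _ _ => rfl, fun _ _ => rfl⟩
    have : y ≠ x := by simpa [Prog.wr] using h
    simp [this]
  | storeN s a i e =>
    refine ⟨fun _ _ => rfl, fun _ _ => rfl, fun y h => ?_, fun _ _ => rfl⟩
    have : y ≠ a := by simpa [Prog.wna] using h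
    simp [this]
  | storeR s a i e =>
    refine ⟨fun _ _ => rfl, fun _ _ => rfl, fun _ _ => rfl, fun y h => ?_⟩
    have : y ≠ a := by simpa [Prog.wra] using h
    simp [this]
  | seq _ _ ih₁ ih₂ => exact ih₁.seq_left.trans ih₂.seq_right
  | cond_true _ _ ih =>
    apply ih.weaken <;> intro y <;> simp [Prog.wn, Prog.wr, Prog.wna, Prog.wra] <;> tauto
  | cond_false _ _ ih =>
    apply ih.weaken <;> intro y <;> simp [Prog.wn, Prog.wr, Prog.wna, Prog.wra]
  | loop_true _ _ _ ih₁ ih₂ => exact ih₁.loop.trans ih₂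
  | loop_false => exact Frame.refl _ _

/-- Started in `s`, the program `c` halts after at most `B` steps in a state that satisfies `Q`. -/
def Runs (c : Prog) (s : State) (B : ℕ) (Q : State → Prop) : Prop :=
  ∃ t s', Exec c s t s' ∧ t ≤ B ∧ Q s'

namespace Runs

variable {c d : Prog} {s : State} {B B' : ℕ} {Q Q' : State → Prop}

theorem mono (h : Runs c s B Q) (hB : B ≤ B') (hQ : ∀ s', Frame c s s' → Q s' → Q' s') :
    Runs c s B' Q' := by
  obtain ⟨t, s', h₁, h₂, h₃⟩ := h
  exact ⟨t, s', h₁, h₂.trans hB, hQ _ h₁.frame h₃⟩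

theorem le (h : Runs c s B Q) (hB : B ≤ B') : Runs c s B' Q := h.mono hB fun _ _ => id

theorem seq {B₁ B₂ : ℕ} {Q₁ : State → Prop} (h : Runs c s B₁ Q₁)
    (k : ∀ s', Frame c s s' → Q₁ s' → Runs d s' B₂ Q) : Runs (.seq c d) s (B₁ + B₂) Q := by
  obtain ⟨t, s', h₁, h₂, h₃⟩ := h
  obtain ⟨t', s'', k₁, k₂, k₃⟩ := k _ h₁.frame h₃
  exact ⟨_, _, h₁.seq k₁, by omega, k₃⟩

theorem cond {b : BExp} (h : b.eval s → Runs c s B Q) (k : ¬ b.eval s → Runs d s B Q) :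
    Runs (.cond b c d) s (b.cost + 1 + B) Q := by
  by_cases hb : b.eval s
  · obtain ⟨t, s', h₁, h₂, h₃⟩ := h hb
    exact ⟨_, _, h₁.cond_true hb, by omega, h₃⟩
  · obtain ⟨t, s', h₁, h₂, h₃⟩ := k hb
    exact ⟨_, _, h₁.cond_false hb, by omega, h₃⟩

/-- `M` only bounds the number of iterations: the invariant at `M` refutes the test, but the loop
may stop earlier, hence the `∃ k ≤ M` in the postcondition. -/
theorem loop {b : BExp} {M : ℕ} (P : ℕ → State → Prop) (h0 : P 0 s)
    (hs : ∀ k s', k < M → b.eval s' → Frame c s s' → P k s' → Runs c s' B (P (k + 1)))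
    (hM : ∀ s', Frame c s s' → P M s' → ¬ b.eval s') :
    Runs (.loop b c) s (M * (B + b.cost + 1) + b.cost + 1)
      (fun s' => ¬ b.eval s' ∧ ∃ k ≤ M, P k s') := by
  have key : ∀ m k s', k + m = M → Frame c s s' → P k s' →
      Runs (.loop b c) s' (m * (B + b.cost + 1) + b.cost + 1)
        (fun s' => ¬ b.eval s' ∧ ∃ k ≤ M, P k s') := by
    intro m
    induction m with
    | zero =>
      intro k s' hk hf hP
      obtain rfl : k = M := by omega
      exact ⟨_, _, .loop_false (hM _ hf hP), by omega, hM _ hf hP, k, le_rfl, hP⟩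
    | succ m ih =>
      intro k s' hk hf hP
      by_cases hb : b.eval s'
      · obtain ⟨t, s₁, h₁, h₂, h₃⟩ := hs k s' (by omega) hb hf hP
        obtain ⟨t', s₂, k₁, k₂, k₃⟩ := ih (k + 1) s₁ (by omega) (hf.trans h₁.frame) h₃
        refine ⟨_, _, .loop_true hb h₁ k₁, ?_, k₃⟩
        have : (m + 1) * (B + b.cost + 1) = m * (B + b.cost + 1) + (B + b.cost + 1) := by ring
        omega
      · exact ⟨_, _, .loop_false hb, by omega, hb, k, by omega, hP⟩
  exact key M 0 s (by omega) (Frame.refl _ _) h0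

end Runs

/-- The loop `for x = 0, …, e - 1 do c`. -/
def forP (x : ℕ) (e : NExp) (c : Prog) : Prog :=
  .seq (.setN x (.const 0)) (.loop (.not (.leN e (.var x)))
    (.seq c (.setN x (.add (.var x) (.const 1)))))

/-- The bound is evaluated again before each iteration, so `he` demands a value that nothing written
by the loop can change. The body must establish the invariant for the state after the counter has
been advanced. -/
theorem Runs.forP {x : ℕ} {e : NExp} {c : Prog} {s : State} {N B : ℕ} (P : ℕ → State → Prop)
    (hx : c.wn x = false) (he : ∀ s', Frame (forP x e c) s s' → e.eval s' = N)
    (h0 : P 0 (s.setn x 0))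
    (hs : ∀ k s', k < N → Frame (forP x e c) s s' → s'.nvar x = k → P k s' →
      Runs c s' B (fun s'' => P (k + 1) (s''.setn x (k + 1)))) :
    Runs (forP x e c) s (N * (B + e.cost + 8) + e.cost + 6) (P N) := by
  have h1 : Runs (.setN x (.const 0)) s 2 (fun s' => s' = s.setn x 0) :=
    ⟨_, _, Exec.setN s x (.const 0), le_rfl, rfl⟩
  refine (h1.seq (B₂ := N * (B + 4 + (e.cost + 3) + 1) + (e.cost + 3) + 1)
    fun s' hf hs' => ?_).le ?_
  · refine (Runs.loop (b := .not (.leN e (.var x))) (M := N) (B := B + 4)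
      (fun k s' => s'.nvar x = k ∧ P k s') (by subst hs'; exact ⟨by simp, h0⟩) ?_ ?_).mono
      le_rfl ?_
    · intro k s₁ hk hb hf₁ ⟨hx₁, hP⟩
      have hF : Frame (RealRAM.forP x e c) s s₁ := hf.seq_left.trans hf₁.loop.seq_right
      refine (hs k s₁ hk hF hx₁ hP).seq fun s₂ hf₂ hP₂ => ?_
      have : s₂.nvar x = k := (hf₂.n x hx).trans hx₁
      refine ⟨_, _, Exec.setN _ _ _, le_rfl, ?_⟩
      simp only [NExp.eval, this]
      exact ⟨by simp, hP₂⟩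
    · intro s₁ hf₁ ⟨hx₁, hP⟩
      have hF : Frame (RealRAM.forP x e c) s s₁ := hf.seq_left.trans hf₁.loop.seq_right
      simp [BExp.eval, NExp.eval, he _ hF, hx₁]
    · intro s₁ hf₁ ⟨hb, k, hk, hx₁, hP⟩
      have hF : Frame (RealRAM.forP x e c) s s₁ := hf.seq_left.trans hf₁.seq_right
      have hb' : N ≤ k := by simpa [BExp.eval, NExp.eval, he _ hF, hx₁] using hb
      obtain rfl : k = N := by omega
      exact hP
  · have : B + 4 + (e.cost + 3) + 1 = B + e.cost + 8 := by ring
    rw [this]; omega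

open Classical in
/-- The effect of a program without loops. -/
noncomputable def Prog.run : Prog → State → State
  | .skip, s => s
  | .setN x e, s => s.setn x (e.eval s)
  | .setR x e, s => s.setr x (e.eval s)
  | .storeN a i e, s => s.putn a (i.eval s) (e.eval s)
  | .storeR a i e, s => s.putr a (i.eval s) (e.eval s)
  | .seq c d, s => d.run (c.run s)
  | .cond b c d, s => if b.eval s then c.run s else d.run s
  | .loop _ _, s => s

/-- The program has no loops. -/
def Prog.loopFree : Prog → Bool
  | .seq c d => c.loopFree && d.loopFree
  | .cond _ c d => c.loopFree && d.loopFree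
  | .loop _ _ => false
  | _ => true

/-- An upper bound for the number of steps of a program without loops. -/
def Prog.time : Prog → ℕ
  | .skip => 1
  | .setN _ e => e.cost + 1
  | .setR _ e => e.cost + 1
  | .storeN _ i e => i.cost + e.cost + 1
  | .storeR _ i e => i.cost + e.cost + 1
  | .seq c d => c.time + d.time
  | .cond b c d => b.cost + 1 + (c.time + d.time)
  | .loop _ _ => 0

theorem Prog.runs_run (c : Prog) (h : c.loopFree = true) (s : State) :
    Runs c s c.time (fun s' => s' = c.run s) := by
  induction c generalizing s with
  | skip => exact ⟨_, _, .skip s, le_rfl, rfl⟩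
  | setN x e => exact ⟨_, _, .setN s x e, le_rfl, rfl⟩
  | setR x e => exact ⟨_, _, .setR s x e, le_rfl, rfl⟩
  | storeN a i e => exact ⟨_, _, .storeN s a i e, le_rfl, rfl⟩
  | storeR a i e => exact ⟨_, _, .storeR s a i e, le_rfl, rfl⟩
  | seq c d ihc ihd =>
    simp only [loopFree, Bool.and_eq_true] at h
    refine (ihc h.1 s).seq fun s' _ hs' => ?_
    subst hs'
    exact ihd h.2 _
  | cond b c d ihc ihd =>
    simp only [loopFree, Bool.and_eq_true] at h
    refine Runs.cond (fun hb => ?_) (fun hb => ?_)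
    · exact (ihc h.1 s).mono (by omega) fun s' _ e => by simp [e, run, hb]
    · exact (ihd h.2 s).mono (by omega) fun s' _ e => by simp [e, run, hb]
  | loop => simp [loopFree] at h

/-- Loop-free code is handled by symbolic execution: the step bound becomes a closed numerical
inequality, and the postcondition a goal for `simp`. -/
theorem Runs.of_run {c : Prog} {s : State} {B : ℕ} {Q : State → Prop} (h : c.loopFree = true)
    (hB : c.time ≤ B) (hQ : Q (c.run s)) : Runs c s B Q :=
  (c.runs_run h s).mono hB fun _ _ e => e ▸ hQ

end RealRAM


/-! ### Derived syntax. -/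

namespace RealRAM

infixr:60 " ;; " => Prog.seq

/-- The test `e < f`. -/
def BExp.ltN (e f : NExp) : BExp := .leN (.add e (.const 1)) f
/-- The test `e = f`. -/
def BExp.eqN (e f : NExp) : BExp := .and (.leN e f) (.leN f e)
/-- The test `e < f`. -/
def BExp.ltR (e f : RExp) : BExp := .not (.leR f e)
/-- The test `e = f`. -/
def BExp.eqR (e f : RExp) : BExp := .and (.leR e f) (.leR f e)

@[simp] theorem BExp.eval_ltN (s : State) (e f : NExp) :
    (BExp.ltN e f).eval s ↔ e.eval s < f.eval s := Iff.rfl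
@[simp] theorem BExp.eval_eqN (s : State) (e f : NExp) :
    (BExp.eqN e f).eval s ↔ e.eval s = f.eval s := by simp [eqN, eval, le_antisymm_iff]
@[simp] theorem BExp.eval_ltR (s : State) (e f : RExp) :
    (BExp.ltR e f).eval s ↔ e.eval s < f.eval s := by simp [ltR, eval]
@[simp] theorem BExp.eval_eqR (s : State) (e f : RExp) :
    (BExp.eqR e f).eval s ↔ e.eval s = f.eval s := by simp [eqR, eval, le_antisymm_iff]

end RealRAM

/-! ### The algorithm as a program. -/

namespace MatchUp

open RealRAM

/-- The entry of column `k` of the row with number `r` in the table of assignments. -/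
def cellA (r k : ℕ) : NExp := .cell 1 (.add (.cell 2 (.var r)) (.var k))
/-- The entry of column `k` of the row with number `r` in the table of remaining capacities. -/
def cellR (r k : ℕ) : RExp := .cell 6 (.add (.cell 2 (.var r)) (.var k))

/-- Copies one row of the tables to another. -/
def copyRow (src dst : ℕ) : Prog :=
  forP 10 (.add (.var 0) (.const 1))
    (.storeN 1 (.add (.cell 2 (.var dst)) (.var 10)) (cellA src 10) ;;
     .storeR 6 (.add (.cell 2 (.var dst)) (.var 10)) (cellR src 10)) ;;
  .storeR 7 (.var dst) (.cell 7 (.var src))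

/-- Counts the free items of the rounded size of item 13 in the rows 4 and 11. -/
def countFree : Prog :=
  .setN 15 (.const 0) ;; .setN 16 (.const 0) ;;
  forP 14 (.var 0)
    (.cond (.eqR (.cell 4 (.var 14)) (.cell 4 (.var 13)))
      (.cond (.eqN (cellA 4 14) (.const 0)) (.setN 15 (.add (.var 15) (.const 1))) .skip ;;
       .cond (.eqN (cellA 11 14) (.const 0)) (.setN 16 (.add (.var 16) (.const 1))) .skip)
      .skip)

/-- Tests whether the rows 4 and 11 have the same key. -/
def testKey : Prog :=
  .setN 12 (.const 1) ;;
  .cond (.eqR (cellR 4 5) (cellR 11 5)) .skip (.setN 12 (.const 0)) ;;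
  forP 13 (.var 0)
    (countFree ;;
     .cond (.and (.leR (.cell 4 (.var 13)) (.var 6)) (.not (.eqN (.var 15) (.var 16))))
       (.setN 12 (.const 0)) .skip)

/-- Inserts the row 4, which stands behind the last row of the list, into the list. -/
def insertRow : Prog :=
  .setN 22 (.var 4) ;;
  forP 11 (.var 4)
    (testKey ;; .cond (.eqN (.var 12) (.const 1)) (.setN 22 (.var 11)) .skip) ;;
  .cond (.ltN (.var 22) (.var 4))
    (.cond (.ltR (.cell 7 (.var 4)) (.cell 7 (.var 22))) (copyRow 4 22) .skip)
    (.storeN 2 (.add (.var 4) (.const 1)) (.add (.add (.cell 2 (.var 4)) (.var 0)) (.const 1)) ;;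
     .setN 4 (.add (.var 4) (.const 1)))

/-- Selects the current bin as target. -/
def pickBin : Prog := .setN 8 (.var 5)

/-- Selects a bin that is not full as target. -/
def pickFluid : Prog :=
  .storeR 7 (.var 4) (.sub (.cell 7 (.var 4)) (.cell 4 (.var 6))) ;;
  .cond (.ltR (.cell 7 (.var 4)) (.const 0)) (.storeR 7 (.var 4) (.const 0)) .skip ;;
  .setN 8 (.var 0) ;;
  forP 10 (.var 0) (.cond (.ltR (.const 0) (cellR 4 10)) (.setN 8 (.var 10)) .skip)

/-- Inserts the row that is obtained from row 7 by moving an item of the rounded size of item 6. -/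
def child (pick : Prog) : Prog :=
  copyRow 7 4 ;;
  .setN 9 (.var 0) ;;
  forP 10 (.var 0)
    (.cond (.and (.eqR (.cell 4 (.var 10)) (.cell 4 (.var 6))) (.eqN (cellA 4 10) (.const 0)))
      (.setN 9 (.var 10)) .skip) ;;
  .cond (.ltN (.var 9) (.var 0))
    (pick ;;
     .storeN 1 (.add (.cell 2 (.var 4)) (.var 9)) (.add (.var 8) (.const 1)) ;;
     .cond (.ltN (.var 8) (.var 0))
       (.storeR 6 (.add (.cell 2 (.var 4)) (.var 8)) (.sub (cellR 4 8) (.cell 4 (.var 6)))) .skip ;;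
     insertRow)
    .skip

/-- Inserts the children of all rows. -/
def event (pick : Prog) : Prog :=
  .setN 21 (.var 4) ;; forP 7 (.var 21) (child pick)

/-- The events of all items with rounded size in the window. -/
def stage (pick : Prog) : Prog :=
  forP 6 (.var 0)
    (.cond (.and (.leR (.var 5) (.cell 4 (.var 6))) (.leR (.cell 4 (.var 6)) (.var 10)))
      (event pick) .skip)

/-- Opens the bin 5, fills it and closes it. -/
def binStage : Prog :=
  forP 7 (.var 4) (.storeR 6 (.add (.cell 2 (.var 7)) (.var 5))
    (.sub (.cell 2 (.var 5)) (.cell 3 (.var 5)))) ;;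
  stage pickBin ;;
  forP 7 (.var 4) (.cond (.ltR (.const 0) (cellR 7 5))
    (.storeR 7 (.var 7) (.add (.cell 7 (.var 7)) (cellR 7 5))) .skip)

/-- Treats all bins and all items of one level. -/
def levelBody : Prog :=
  .setR 6 (.div (.var 5) (.mul (.var 0) (.var 0))) ;;
  .setR 10 (.var 6) ;;
  forP 5 (.var 0) (.cond (.eqR (.cell 5 (.var 5)) (.var 5)) binStage .skip) ;;
  .setR 10 (.var 5) ;;
  .setN 5 (.var 0) ;;
  stage pickFluid ;;
  .setR 5 (.div (.var 5) (.add (.const 1) (.var 0)))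

/-- The list that consists of the empty assignment. -/
def initRows : Prog :=
  .setN 4 (.const 1) ;;
  .storeN 2 (.const 0) (.const 0) ;;
  .storeN 2 (.const 1) (.add (.var 0) (.const 1)) ;;
  forP 10 (.add (.var 0) (.const 1))
    (.storeN 1 (.var 10) (.const 0) ;; .storeR 6 (.var 10) (.const 0)) ;;
  .storeR 7 (.const 0) (.const 0)

/-- The dynamic program for one class. -/
def dynamicProg : Prog :=
  initRows ;; .setR 5 (.var 3) ;; .loop (.ltR (.var 4) (.var 5)) levelBody

/-- The total size of the class and the threshold for tiny sizes. -/
def totals : Prog :=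
  .setR 3 (.const 0) ;;
  forP 17 (.var 0) (.cond (.and (.leN (.var 3) (.cell 0 (.var 17)))
      (.leN (.cell 0 (.var 17)) (.add (.var 3) (.const 1))))
    (.setR 3 (.add (.var 3) (.cell 2 (.var 17)))) .skip) ;;
  .setR 4 (.div (.mul (.mul (.var 0) (.var 0)) (.var 3)) (.var 1))

/-- Rounds the value 8 down to the grid. -/
def roundLoop : Prog :=
  .setR 7 (.var 3) ;;
  .loop (.and (.ltR (.var 8) (.var 7)) (.ltR (.var 4) (.var 7)))
    (.setR 7 (.div (.var 7) (.add (.const 1) (.var 0))))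

/-- Rounds the sizes of the items and the scaled capacities of the bins. -/
def rounding : Prog :=
  forP 17 (.var 0)
    (.cond (.eqN (.cell 0 (.var 17)) (.var 3)) (.setR 8 (.cell 2 (.var 17)))
      (.cond (.eqN (.cell 0 (.var 17)) (.add (.var 3) (.const 1)))
        (.setR 8 (.mul (.var 0) (.sub (.cell 2 (.var 17)) (.cell 3 (.var 17)))))
        (.setR 8 (.const 0))) ;;
     roundLoop ;;
     .storeR 4 (.var 17) (.const 0) ;;
     .storeR 5 (.var 17) (.const 0) ;;
     .cond (.ltR (.var 4) (.var 7))
       (.cond (.eqN (.cell 0 (.var 17)) (.var 3)) (.storeR 4 (.var 17) (.var 7))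
         (.storeR 5 (.var 17) (.var 7)))
       .skip)

/-- Finds the row of least value. -/
def bestRow : Prog :=
  .setN 18 (.const 0) ;;
  forP 7 (.var 4) (.cond (.ltR (.cell 7 (.var 7)) (.cell 7 (.var 18))) (.setN 18 (.var 7)) .skip)

/-- Places a bin and the items assigned to it. -/
def placeBin : Prog :=
  .storeR 1 (.var 19) (.var 2) ;;
  .setR 9 (.add (.var 2) (.cell 3 (.var 19))) ;;
  forP 20 (.var 0)
    (.cond (.and (.eqN (.cell 0 (.var 20)) (.var 3))
        (.eqN (cellA 18 20) (.add (.var 19) (.const 1))))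
      (.storeR 1 (.var 20) (.var 9) ;; .setR 9 (.add (.var 9) (.cell 2 (.var 20)))) .skip) ;;
  .setR 2 (.add (.var 2) (.cell 2 (.var 19))) ;;
  .cond (.leR (.var 9) (.var 2)) .skip (.setR 2 (.var 9))

/-- Places the jobs of one class behind all jobs placed before. -/
def placeClass : Prog :=
  forP 19 (.var 0)
    (.cond (.eqN (.cell 0 (.var 19)) (.add (.var 3) (.const 1))) placeBin .skip) ;;
  forP 20 (.var 0)
    (.cond (.and (.eqN (.cell 0 (.var 20)) (.var 3))
        (.not (.and (.leN (.const 1) (cellA 18 20)) (.leN (cellA 18 20) (.var 0)))))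
      (.storeR 1 (.var 20) (.var 2) ;; .setR 2 (.add (.var 2) (.cell 2 (.var 20)))) .skip)

/-- Solves one class. -/
def solveClass : Prog :=
  totals ;; rounding ;; dynamicProg ;; bestRow ;; placeClass

/-- Reads the relevant processing times, the number of jobs and the maximum height. -/
def setup : Prog :=
  forP 17 (.var 0)
    (.storeR 2 (.var 17) (.cell 0 (.sub (.add (.var 2) (.cell 0 (.var 17))) (.const 1))) ;;
     .storeR 3 (.var 17) (.cell 0 (.sub (.add (.var 2) (.cell 0 (.var 17))) (.const 2))) ;;
     .setN 2 (.add (.var 2) (.cell 0 (.var 17))) ;;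
     .cond (.ltN (.var 1) (.cell 0 (.var 17))) (.setN 1 (.cell 0 (.var 17))) .skip ;;
     .setR 1 (.add (.var 1) (.const 1)))

/-- The algorithm. -/
def matchUp : Prog :=
  .cond (.leN (.var 0) (.const 1)) .skip
    (setup ;; .setN 3 (.const 1) ;;
     .loop (.leN (.var 3) (.var 1)) (solveClass ;; .setN 3 (.add (.var 3) (.const 2))))

end MatchUp


/-! ### One class: the length of an assignment and the lower bound. -/

namespace MatchUp

open Finset

/-- Pairwise disjoint intervals in `[0, M]` have total length at most `M`. -/
theorem sum_length_le {ι : Type*} [DecidableEq ι] (S : Finset ι) (st l : ι → ℝ) (M : ℝ) (hM0 : 0 ≤ M)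
    (h0 : ∀ a ∈ S, 0 ≤ st a) (hl : ∀ a ∈ S, 0 ≤ l a) (hM : ∀ a ∈ S, st a + l a ≤ M)
    (hp : ∀ a ∈ S, ∀ b ∈ S, a ≠ b → st a + l a ≤ st b ∨ st b + l b ≤ st a) :
    ∑ a ∈ S, l a ≤ M := by
  induction hc : S.card generalizing S M with
  | zero => simpa [Finset.card_eq_zero.1 hc] using hM0
  | succ m ih =>
    have hne : S.Nonempty := Finset.card_pos.1 (by omega)
    -- Remove the interval that starts last; all others then end before it starts.
    obtain ⟨a, ha, hmax⟩ := S.exists_max_image st hne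
    have hcard : (S.erase a).card = m := by rw [Finset.card_erase_of_mem ha]; omega
    have hsub : ∀ b ∈ S.erase a, b ∈ S := fun b hb => Finset.mem_of_mem_erase hb
    rw [← Finset.add_sum_erase S l ha]
    -- An interval of length 0 may share its start with a longer one and gives no bound on the
    -- others, so it is simply dropped.
    rcases (hl a ha).eq_or_lt with h | h
    · rw [← h, zero_add]
      exact ih _ M hM0 (fun b hb => h0 b (hsub b hb)) (fun b hb => hl b (hsub b hb))
        (fun b hb => hM b (hsub b hb)) (fun b hb c hc => hp b (hsub b hb) c (hsub c hc)) hcard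
    · have := ih (S.erase a) (st a) (h0 a ha) (fun b hb => h0 b (hsub b hb))
        (fun b hb => hl b (hsub b hb)) (fun b hb => by
          rcases hp b (hsub b hb) a ha (Finset.ne_of_mem_erase hb) with h1 | h1
          · exact h1
          · have := hmax b (hsub b hb)
            linarith)
        (fun b hb c hc => hp b (hsub b hb) c (hsub c hc)) hcard
      linarith [hM a ha]

/-- The total length of the items in `I` that `X` assigns to bin `i`. -/
def load (I : Finset ℕ) (X : ℕ → ℕ) (s : ℕ → ℝ) (i : ℕ) : ℝ := ∑ j ∈ I with X j = i + 1, s j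

/-- The items in `I` that `X` assigns to no bin in `D`. -/
def unplaced (I D : Finset ℕ) (X : ℕ → ℕ) : Finset ℕ := {j ∈ I | ∀ i ∈ D, X j ≠ i + 1}

/-- The length of the schedule that treats the bins in `D` one after the other, each followed by
its items, and then the remaining items. -/
def classCost (I D : Finset ℕ) (s q : ℕ → ℝ) (X : ℕ → ℕ) : ℝ :=
  ∑ i ∈ D, max (s i) (q i + load I X s i) + ∑ j ∈ unplaced I D X, s j

theorem load_nonneg {I : Finset ℕ} {X : ℕ → ℕ} {s : ℕ → ℝ} (hs : ∀ j ∈ I, 0 ≤ s j) (i : ℕ) :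
    0 ≤ load I X s i := Finset.sum_nonneg fun j hj => hs j (Finset.mem_filter.1 hj).1

theorem sum_load_add_unplaced (I D : Finset ℕ) (X : ℕ → ℕ) (s : ℕ → ℝ) :
    ∑ i ∈ D, load I X s i + ∑ j ∈ unplaced I D X, s j = ∑ j ∈ I, s j := by
  have h1 : ∑ i ∈ D, load I X s i = ∑ j ∈ I with ¬ ∀ i ∈ D, X j ≠ i + 1, s j := by
    unfold load
    rw [← Finset.sum_biUnion]
    · apply Finset.sum_congr _ fun _ _ => rfl
      ext j; simp; tauto
    · intro i _ i' _ hne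
      simp only [Function.onFun]
      rw [Finset.disjoint_left]
      intro j hj hj'
      simp only [mem_filter] at hj hj'
      omega
  rw [h1, add_comm]
  exact Finset.sum_filter_add_sum_filter_not I _ s

/-- max(s, q + ℓ) = s + ℓ - min(ℓ, s - q). The first two terms do not depend on `X`, so only the
amount of gap that is filled has to be maximised. -/
theorem classCost_eq (I D : Finset ℕ) (s q : ℕ → ℝ) (X : ℕ → ℕ) :
    classCost I D s q X = ∑ i ∈ D, s i + ∑ j ∈ I, s j
      - ∑ i ∈ D, min (load I X s i) (s i - q i) := by
  rw [← sum_load_add_unplaced I D X s, classCost]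
  have : ∑ i ∈ D, max (s i) (q i + load I X s i)
      = ∑ i ∈ D, (s i + load I X s i - min (load I X s i) (s i - q i)) := by
    refine Finset.sum_congr rfl fun i _ => ?_
    rcases le_total (load I X s i) (s i - q i) with h | h
    · rw [min_eq_left h, max_eq_left (by linarith)]; ring
    · rw [min_eq_right h, max_eq_right (by linarith)]; ring
  rw [this, Finset.sum_sub_distrib, Finset.sum_add_distrib]
  ring

/-- The bins alone and the items alone already fit one after the other into the cost. This turns
additive errors in terms of the total length into relative ones. -/
theorem total_le_classCost {I D : Finset ℕ} {s q : ℕ → ℝ} (X : ℕ → ℕ) (hs : ∀ j ∈ I, 0 ≤ s j)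
    (hq : ∀ i ∈ D, 0 ≤ q i) :
    ∑ i ∈ D, s i + ∑ j ∈ I, s j ≤ 2 * classCost I D s q X := by
  have h1 : ∑ i ∈ D, s i ≤ classCost I D s q X := by
    have : 0 ≤ ∑ j ∈ unplaced I D X, s j :=
      Finset.sum_nonneg fun j hj => hs j (Finset.mem_filter.1 hj).1
    have : ∑ i ∈ D, s i ≤ ∑ i ∈ D, max (s i) (q i + load I X s i) :=
      Finset.sum_le_sum fun i _ => le_max_left _ _
    unfold classCost; linarith
  have h2 : ∑ j ∈ I, s j ≤ classCost I D s q X := by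
    rw [← sum_load_add_unplaced I D X s, classCost]
    gcongr with i hi
    exact le_max_of_le_right (by linarith [hq i hi])
  linarith

/-- Every schedule in which the items are disjoint from each other and from the lower parts of the
bins, and the bins are disjoint, is at least as long as some assignment. -/
theorem exists_classCost_le {I D : Finset ℕ} {s q τ : ℕ → ℝ} {M : ℝ} (hdis : Disjoint I D)
    (hM0 : 0 ≤ M) (hs : ∀ j ∈ I, 0 ≤ s j) (hq : ∀ i ∈ D, 0 ≤ q i) (hqs : ∀ i ∈ D, q i ≤ s i)
    (hτ : ∀ j, 0 ≤ τ j) (hMI : ∀ j ∈ I, τ j + s j ≤ M) (hMD : ∀ i ∈ D, τ i + s i ≤ M)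
    (hII : ∀ j ∈ I, ∀ j' ∈ I, j ≠ j' → τ j + s j ≤ τ j' ∨ τ j' + s j' ≤ τ j)
    (hDD : ∀ i ∈ D, ∀ i' ∈ D, i ≠ i' → τ i + s i ≤ τ i' ∨ τ i' + s i' ≤ τ i)
    (hID : ∀ j ∈ I, ∀ i ∈ D, τ j + s j ≤ τ i ∨ τ i + q i ≤ τ j) :
    ∃ X : ℕ → ℕ, classCost I D s q X ≤ M := by
  classical
  -- An item belongs to the bin during whose full length it starts; there is at most one since bins
  -- are disjoint.
  have hX : ∀ j, ∃ x : ℕ, ∀ i ∈ D, (x = i + 1 ↔ τ i ≤ τ j ∧ τ j < τ i + s i) := by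
    intro j
    by_cases h : ∃ i ∈ D, τ i ≤ τ j ∧ τ j < τ i + s i
    · obtain ⟨i, hi, h1, h2⟩ := h
      refine ⟨i + 1, fun i' hi' => ⟨fun e => ?_, fun ⟨h3, h4⟩ => ?_⟩⟩
      · obtain rfl : i = i' := by omega
        exact ⟨h1, h2⟩
      · by_contra hne
        rcases hDD i hi i' hi' (by omega) with h | h <;> linarith
    · push Not at h
      exact ⟨0, fun i hi => ⟨fun e => by omega, fun ⟨h1, h2⟩ => by linarith [h i hi h1]⟩⟩
  choose X hX using hX
  refine ⟨X, ?_⟩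
  -- Select disjoint intervals of total length exactly `classCost`: an overfilled bin contributes
  -- its lower part together with its items, any other bin contributes its full length and its items
  -- are left out, and unplaced items contribute themselves.
  let ov : ℕ → Prop := fun i => s i < q i + load I X s i
  let S : Finset ℕ := D ∪ {j ∈ I | ∀ i ∈ D, X j = i + 1 → ov i}
  let l : ℕ → ℝ := fun a => if a ∈ D ∧ ov a then q a else s a
  have hIl : ∀ j ∈ I, l j = s j := fun j hj => by
    simp [l, Finset.disjoint_left.1 hdis hj]
  have hDl : ∀ i ∈ D, l i ≤ s i := fun i hi => by
    simp only [l]; split_ifs; exacts [hqs i hi, le_rfl]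
  have hDl0 : ∀ i ∈ D, 0 ≤ l i := fun i hi => by
    simp only [l]; split_ifs; exacts [hq i hi, (hq i hi).trans (hqs i hi)]
  have hS : ∀ a ∈ S, a ∈ D ∨ (a ∈ I ∧ ∀ i ∈ D, X a = i + 1 → ov i) := fun a ha => by
    simpa [S] using ha
  have hJD : ∀ j ∈ I, (∀ i ∈ D, X j = i + 1 → ov i) → ∀ i ∈ D,
      τ j + s j ≤ τ i ∨ τ i + l i ≤ τ j := by
    intro j hj hjo i hi
    by_cases ho : ov i
    · simpa [l, hi, ho] using hID j hj i hi
    · have hl : l i = s i := by simp [l, ho]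
      rw [hl]
      -- A selected item cannot start within a bin that is not overfilled. If it starts after the
      -- lower part of such a bin, it therefore starts after the whole bin.
      have hn : X j ≠ i + 1 := fun e => ho (hjo i hi e)
      rw [Ne, hX j i hi] at hn
      rcases hID j hj i hi with h | h
      · exact Or.inl h
      · refine Or.inr ?_
        by_contra hc
        exact hn ⟨by linarith [hq i hi], by linarith⟩
  have key := sum_length_le S τ l M hM0 (fun a _ => hτ a)
    (fun a ha => by
      rcases hS a ha with h | ⟨h, _⟩
      · exact hDl0 a h
      · rw [hIl a h]; exact hs a h)
    (fun a ha => by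
      rcases hS a ha with h | ⟨h, _⟩
      · linarith [hDl a h, hMD a h]
      · rw [hIl a h]; exact hMI a h)
    (fun a ha b hb hab => by
      rcases hS a ha with h | ⟨h, ho⟩ <;> rcases hS b hb with h' | ⟨h', ho'⟩
      · rcases hDD a h b h' hab with h1 | h1
        · left; linarith [hDl a h]
        · right; linarith [hDl b h']
      · rw [hIl b h']; exact (hJD b h' ho' a h).symm
      · rw [hIl a h]; exact hJD a h ho b h'
      · rw [hIl a h, hIl b h']; exact hII a h b h' hab)
  refine le_trans (le_of_eq ?_) key
  have hSd : Disjoint D {j ∈ I | ∀ i ∈ D, X j = i + 1 → ov i} :=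
    (hdis.mono_left (Finset.filter_subset _ _)).symm
  rw [Finset.sum_union hSd]
  have h2 : ∑ j ∈ I with (∀ i ∈ D, X j = i + 1 → ov i), l j
      = ∑ i ∈ D, (if ov i then load I X s i else 0) + ∑ j ∈ unplaced I D X, s j := by
    rw [← sum_load_add_unplaced {j ∈ I | ∀ i ∈ D, X j = i + 1 → ov i} D X l]
    congr 1
    · refine Finset.sum_congr rfl fun i hi => ?_
      by_cases ho : ov i
      · rw [if_pos ho, load, load, Finset.filter_filter]
        refine Finset.sum_congr ?_ fun j hj => hIl j (Finset.mem_filter.1 hj).1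
        ext j
        simp only [mem_filter]
        constructor
        · rintro ⟨h1, h2, h3⟩; exact ⟨h1, h3⟩
        · rintro ⟨h1, h3⟩
          refine ⟨h1, fun i' _ h4 => ?_, h3⟩
          obtain rfl : i = i' := by omega
          exact ho
      · rw [if_neg ho, load]
        apply Finset.sum_eq_zero
        intro j hj
        simp only [mem_filter] at hj
        exact absurd (hj.1.2 i hi hj.2) ho
    · refine Finset.sum_congr ?_ fun j hj => hIl j (Finset.mem_filter.1 hj).1
      ext j
      simp only [unplaced, mem_filter]
      constructor
      · rintro ⟨⟨h1, _⟩, h3⟩; exact ⟨h1, h3⟩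
      · rintro ⟨h1, h3⟩; exact ⟨⟨h1, fun i hi h => absurd h (h3 i hi)⟩, h3⟩
  rw [h2, classCost, ← add_assoc, ← Finset.sum_add_distrib]
  congr 1
  refine Finset.sum_congr rfl fun i hi => ?_
  by_cases ho : ov i
  · simp only [l, hi, ho, and_self, if_true]
    exact max_eq_right (le_of_lt ho)
  · simp only [l, ho, and_false, if_false, add_zero]
    exact max_eq_left (not_lt.1 ho)

end MatchUp


/-! ### The loss caused by rounding and by dropping irrelevant items. -/

namespace MatchUp

open Finset

/-- The items that `X` assigns to a bin of relevant level and that are neither tiny nor much larger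
than the bin. -/
noncomputable def kept (n : ℕ) (rep lev : ℕ → ℝ) (δ ε : ℝ) (X : ℕ → ℕ) : Finset ℕ :=
  open Classical in
  {j ∈ range n | ∃ i < n, X j = i + 1 ∧ δ < rep j ∧ δ < lev i ∧ rep j ≤ lev i / (ε * ε)}

/-- The bins of level above `a`. -/
noncomputable def opened (n : ℕ) (lev : ℕ → ℝ) (a : ℝ) : Finset ℕ :=
  open Classical in {i ∈ range n | a < lev i}

/-- The total capacity that the items in `Z` leave free in the bins in `D`. -/
noncomputable def unused (D Z : Finset ℕ) (rep g : ℕ → ℝ) (X : ℕ → ℕ) : ℝ :=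
  ∑ i ∈ D, max 0 (g i - load Z X rep i)

/-- `x` is `v` rounded down, up to a factor `1 + ε`, or 0 if `v` is about `δ` or less. -/
def Rounds (ε δ v x : ℝ) : Prop := (δ < x ∧ x ≤ v ∧ v ≤ (1 + ε) * x) ∨ (x = 0 ∧ v ≤ (1 + ε) * δ)

/-- Charge the loss in a bin to the items assigned to it. An item of positive rounded size loses at
most `ε * s j`, and one rounded to 0 has size at most `(1 + ε) * δ ≤ 2 * δ`. An item too large for
the bin exceeds the gap by a factor of order `1 / ε`, and then it alone pays for the whole gap. -/
theorem min_load_le {n : ℕ} {I : Finset ℕ} {s rep lev : ℕ → ℝ} {ε δ g : ℝ} {X : ℕ → ℕ} {i : ℕ}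
    (hε : 0 < ε) (hε1 : ε ≤ 1 / 2) (hδ : 0 ≤ δ) (hI : I ⊆ range n) (hs : ∀ j ∈ I, 0 ≤ s j)
    (hrep : ∀ j ∈ I, Rounds ε δ (s j) (rep j)) (hrep0 : ∀ j < n, j ∉ I → rep j = 0)
    (hi : i < n) (hli : δ < lev i) (hlev : Rounds ε δ (ε * g) (lev i)) :
    min (load I X s i) g ≤ min (load (kept n rep lev δ ε X) X rep i) g
      + ∑ j ∈ I with X j = i + 1, (2 * ε * s j + 2 * δ) := by
  have hsum0 : ∀ j ∈ I.filter (fun j => X j = i + 1), 0 ≤ 2 * ε * s j + 2 * δ := fun j hj => by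
    have := hs j (mem_filter.1 hj).1
    positivity
  have hl : 0 < lev i ∧ lev i ≤ ε * g ∧ ε * g ≤ (1 + ε) * lev i := by
    rcases hlev with h | h
    · exact ⟨by linarith, h.2⟩
    · linarith [h.1]
  have hg : 0 < g := by
    by_contra h
    have : ε * g ≤ 0 := mul_nonpos_of_nonneg_of_nonpos hε.le (not_lt.1 h)
    linarith
  have hk0 : 0 ≤ load (kept n rep lev δ ε X) X rep i := by
    refine load_nonneg (fun j hj => ?_) i
    obtain ⟨_, _, _, h, _⟩ := (mem_filter.1 hj).2
    linarith
  -- From `ε * g ≤ (1 + ε) * lev i` and `lev i < ε² * rep j` one gets `g ≤ (1 + ε) * ε * s j ≤ 2 * ε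
  -- * s j`.
  by_cases hbig : ∃ j ∈ I, X j = i + 1 ∧ lev i / (ε * ε) < rep j
  · obtain ⟨j, hj, hX, hb⟩ := hbig
    have h1 : g ≤ 2 * ε * s j + 2 * δ := by
      rw [div_lt_iff₀ (by positivity)] at hb
      have h2 : rep j ≤ s j := by
        rcases hrep j hj with h | h
        · exact h.2.1
        · rw [h.1]; exact hs j hj
      have h3 : ε * g ≤ ε * (2 * ε * s j) := by
        have h4 : rep j * (ε * ε) ≤ s j * (ε * ε) := by gcongr
        nlinarith [hl.1, hl.2.2]
      have := le_of_mul_le_mul_left h3 hε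
      linarith
    have h2 := Finset.single_le_sum hsum0 (mem_filter.2 ⟨hj, hX⟩)
    have h3 : 0 ≤ min (load (kept n rep lev δ ε X) X rep i) g := le_min hk0 hg.le
    have h4 := min_le_right (load I X s i) g
    linarith
  · push Not at hbig
    have h1 : load I X s i ≤ load (kept n rep lev δ ε X) X rep i
        + ∑ j ∈ I with X j = i + 1, (2 * ε * s j + 2 * δ) := by
      have h2 : load (kept n rep lev δ ε X) X rep i = ∑ j ∈ I with X j = i + 1,
          if j ∈ kept n rep lev δ ε X then rep j else 0 := by
        rw [← Finset.sum_filter, load]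
        refine Finset.sum_congr ?_ fun _ _ => rfl
        ext j
        simp only [mem_filter]
        refine ⟨fun h => ⟨⟨?_, h.2⟩, h.1⟩, fun h => ⟨h.2, h.1.2⟩⟩
        by_contra hc
        obtain ⟨_, _, _, h3, _⟩ := (mem_filter.1 h.1).2
        linarith [hrep0 j (mem_range.1 (mem_filter.1 h.1).1) hc]
      rw [h2, load, ← Finset.sum_add_distrib]
      refine Finset.sum_le_sum fun j hj => ?_
      obtain ⟨hj, hX⟩ := mem_filter.1 hj
      have := hs j hj
      rcases hrep j hj with h | h
      · have hk : j ∈ kept n rep lev δ ε X := by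
          simp only [kept, mem_filter]
          exact ⟨hI hj, i, hi, hX, h.1, hli, hbig j hj hX⟩
        rw [if_pos hk]
        nlinarith
      · have : (if j ∈ kept n rep lev δ ε X then rep j else 0) = 0 := by
          split_ifs
          exacts [h.1, rfl]
        rw [this]
        nlinarith
    have hs0 := Finset.sum_nonneg hsum0
    rcases le_total (load (kept n rep lev δ ε X) X rep i) g with h | h
    · rw [min_eq_left h]
      exact (min_le_left _ _).trans h1
    · rw [min_eq_right h]
      linarith [min_le_right (load I X s i) g]

/-- An assignment `Y` whose unused capacity in rounded sizes is about that of the relevant part of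
`X` is about as good as `X`. -/
theorem classCost_le_of_unused_le {n : ℕ} {I D : Finset ℕ} {s q rep lev : ℕ → ℝ}
    {ε δ A F : ℝ} {X Y : ℕ → ℕ} (hn : 0 < n) (hε : 0 < ε) (hε1 : ε ≤ 1 / 2)
    (hI : I ⊆ range n) (hD : D ⊆ range n) (hs : ∀ j ∈ I, 0 ≤ s j) (hq : ∀ i ∈ D, 0 ≤ q i)
    (hqs : ∀ i ∈ D, q i ≤ s i) (hA : A = ∑ i ∈ D, s i + ∑ j ∈ I, s j)
    (hδ : δ = ε * ε * A / n)
    (hrep : ∀ j ∈ I, Rounds ε δ (s j) (rep j)) (hrep0 : ∀ j < n, j ∉ I → rep j = 0)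
    (hlev : ∀ i ∈ D, Rounds ε δ (ε * (s i - q i)) (lev i)) (hlev0 : ∀ i < n, i ∉ D → lev i = 0)
    (hY : unused (opened n lev δ) (range n) rep (fun i => s i - q i) Y
      ≤ F + ε * ∑ i ∈ D, (s i - q i))
    (hX : F ≤ unused (opened n lev δ) (kept n rep lev δ ε X) rep (fun i => s i - q i) X) :
    classCost I D s q Y ≤ (1 + 12 * ε) * classCost I D s q X := by
  have hsD : ∀ i ∈ D, 0 ≤ s i := fun i hi => (hq i hi).trans (hqs i hi)
  have hSD : 0 ≤ ∑ i ∈ D, s i := Finset.sum_nonneg hsD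
  have hSI : 0 ≤ ∑ j ∈ I, s j := Finset.sum_nonneg hs
  have hA0 : 0 ≤ A := by rw [hA]; positivity
  have hn' : (0 : ℝ) < n := by exact_mod_cast hn
  have hδ0 : 0 ≤ δ := by rw [hδ]; positivity
  have hnδ : n * δ = ε * ε * A := by rw [hδ]; field_simp
  set D' := opened n lev δ with hD'
  set g : ℕ → ℝ := fun i => s i - q i with hg
  have hg0 : ∀ i ∈ D, 0 ≤ g i := fun i hi => sub_nonneg.2 (hqs i hi)
  have hD'D : D' ⊆ D := fun i hi => by
    by_contra hc
    have := (mem_filter.1 hi).2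
    linarith [hlev0 i (mem_range.1 (mem_filter.1 hi).1) hc]
  -- A bin whose level is rounded to 0 has gap at most `(1 + ε) * δ / ε ≤ 2 * ε * A / n`, and there
  -- are at most `n` bins.
  have e1 : ∑ i ∈ D, min (load I X s i) (g i) ≤ ∑ i ∈ D', min (load I X s i) (g i)
      + 2 * ε * A := by
    rw [← Finset.sum_sdiff hD'D]
    have : ∑ i ∈ D \ D', min (load I X s i) (g i) ≤ ∑ i ∈ D \ D', 2 * ε * A / n := by
      refine Finset.sum_le_sum fun i hi => (min_le_right _ _).trans ?_
      obtain ⟨hi, hi'⟩ := mem_sdiff.1 hi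
      have h0 : ¬ δ < lev i := fun h => hi' (by simp only [hD', opened, mem_filter]; exact ⟨hD hi, h⟩)
      rcases hlev i hi with h | h
      · exact absurd h.1 h0
      · rw [le_div_iff₀ hn']
        have h2 : ε * (g i * n) ≤ ε * (2 * ε * A) := by
          have h3 : ε * g i * n ≤ (1 + ε) * δ * n := mul_le_mul_of_nonneg_right h.2 hn'.le
          have h5 : 0 ≤ (1 - ε) * (ε * ε * A) := mul_nonneg (by linarith) (by positivity)
          have h6 : (1 + ε) * δ * n = (1 + ε) * (ε * ε * A) := by rw [← hnδ]; ring
          linarith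
        exact le_of_mul_le_mul_left h2 hε
    rw [Finset.sum_const, nsmul_eq_mul] at this
    have hc : ((D \ D').card : ℝ) ≤ n := by
      have := Finset.card_le_card ((Finset.sdiff_subset (s := D) (t := D')).trans hD)
      rw [Finset.card_range] at this
      exact_mod_cast this
    have : ((D \ D').card : ℝ) * (2 * ε * A / n) ≤ n * (2 * ε * A / n) := by gcongr
    have h4 : (n : ℝ) * (2 * ε * A / n) = 2 * ε * A := by field_simp
    linarith
  -- The charges add up to at most `2εA + 2nδ = 2εA + 2ε²A ≤ 3εA`, as each item is charged for one
  -- bin only.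
  have e2 : ∑ i ∈ D', min (load I X s i) (g i)
      ≤ ∑ i ∈ D', min (load (kept n rep lev δ ε X) X rep i) (g i) + 3 * ε * A := by
    have h1 := Finset.sum_le_sum fun i (hi : i ∈ D') =>
      min_load_le (X := X) (g := g i) hε hε1 hδ0 hI hs hrep hrep0 (mem_range.1 (hD (hD'D hi)))
        (mem_filter.1 hi).2 (hlev i (hD'D hi))
    rw [Finset.sum_add_distrib] at h1
    have h2 := sum_load_add_unplaced I D' X (fun j => 2 * ε * s j + 2 * δ)
    have h3 : 0 ≤ ∑ j ∈ unplaced I D' X, (2 * ε * s j + 2 * δ) :=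
      Finset.sum_nonneg fun j hj => by
        have := hs j (mem_filter.1 hj).1
        positivity
    have h4 : ∑ j ∈ I, (2 * ε * s j + 2 * δ) ≤ 3 * ε * A := by
      rw [Finset.sum_add_distrib, ← Finset.mul_sum, Finset.sum_const, nsmul_eq_mul]
      have hc : (I.card : ℝ) ≤ n := by
        have := Finset.card_le_card hI
        rw [Finset.card_range] at this
        exact_mod_cast this
      have h5 : (I.card : ℝ) * (2 * δ) ≤ n * (2 * δ) := by gcongr
      have h6 : ε * ∑ j ∈ I, s j ≤ ε * A := by rw [hA]; gcongr; linarith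
      have h7 : ε * ε * A ≤ 1 / 2 * (ε * A) := by
        have : 0 ≤ ε * A := by positivity
        nlinarith
      nlinarith
    simp only [load] at h2 h1 ⊢
    linarith
  have e3 : ∀ Z W : _, ∑ i ∈ D', min (load Z W rep i) (g i)
      = ∑ i ∈ D', g i - unused D' Z rep g W := by
    intro Z W
    rw [unused, ← Finset.sum_sub_distrib]
    refine Finset.sum_congr rfl fun i _ => ?_
    rcases le_total (load Z W rep i) (g i) with h | h
    · rw [min_eq_left h, max_eq_right (by linarith)]; ring
    · rw [min_eq_right h, max_eq_left (by linarith)]; ring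
  -- For `Y` nothing is lost: true sizes are at least the rounded ones, and bins outside of `D'` can
  -- only save more.
  have e4 : ∑ i ∈ D', min (load (range n) Y rep i) (g i) ≤ ∑ i ∈ D, min (load I Y s i) (g i) := by
    refine le_trans (Finset.sum_le_sum fun i hi => min_le_min_right _ ?_)
      (Finset.sum_le_sum_of_subset_of_nonneg hD'D fun i hi _ =>
        le_min (load_nonneg hs i) (hg0 i hi))
    have : load (range n) Y rep i = load I Y rep i := by
      refine (Finset.sum_subset (Finset.filter_subset_filter _ hI) fun j hj hj' => ?_).symm
      refine hrep0 j (mem_range.1 (mem_filter.1 hj).1) fun hc => hj' (mem_filter.2 ⟨hc, (mem_filter.1 hj).2⟩)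
    rw [this]
    refine Finset.sum_le_sum fun j hj => ?_
    have hj := (mem_filter.1 hj).1
    rcases hrep j hj with h | h
    · exact h.2.1
    · rw [h.1]; exact hs j hj
  have e5 : ∑ i ∈ D, g i ≤ A := by
    rw [hA]
    have : ∑ i ∈ D, g i ≤ ∑ i ∈ D, s i := Finset.sum_le_sum fun i hi => by
      simp only [hg]; linarith [hq i hi]
    linarith
  have e6 : ε * ∑ i ∈ D, g i ≤ ε * A := by gcongr
  -- The losses `2εA`, `3εA` and `εA` add up to `6εA`, which is at most `12ε` times the cost of `X`.
  have h2 := total_le_classCost X hs hq (s := s) (D := D)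
  rw [← hA] at h2
  have h3 : ε * A ≤ ε * (2 * classCost I D s q X) := by gcongr
  rw [e3] at e2 e4
  have h4 := classCost_eq I D s q X
  have h5 := classCost_eq I D s q Y
  change _ = _ - ∑ i ∈ D, min (load I X s i) (g i) at h4
  change _ = _ - ∑ i ∈ D, min (load I Y s i) (g i) at h5
  rw [h5]
  linarith

end MatchUp


/-! ### Lists of partial solutions: keys, dominance, counting. -/

namespace MatchUp

open Finset

/-- A partial solution: the assignment of the items (0 for a free item, `i + 1` for an item in bin
`i`), the remaining capacities of the bins, and the total capacity that is left. -/
@[ext] structure Row where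
  A : ℕ → ℕ
  R : ℕ → ℝ
  F : ℝ

/-- Moves the item `k` of size `z` to the bin `b`; the target `n` stands for no bin. -/
noncomputable def Row.put (y : Row) (n : ℕ) (z : ℝ) (k b : ℕ) (f : ℝ) : Row :=
  ⟨Function.update y.A k (b + 1), if b < n then Function.update y.R b (y.R b - z) else y.R, f⟩

/-- The number of free items of rounded size `z`. -/
noncomputable def freeCount (n : ℕ) (rep : ℕ → ℝ) (y : Row) (z : ℝ) : ℕ :=
  #{j ∈ range n | rep j = z ∧ y.A j = 0}

/-- The number of items of rounded size `z` outside of `S`. -/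
noncomputable def leftCount (n : ℕ) (rep : ℕ → ℝ) (S : Finset ℕ) (z : ℝ) : ℕ :=
  #{j ∈ range n | rep j = z ∧ j ∉ S}

/-- Two partial solutions that have the same continuations. -/
def SameKey (n : ℕ) (rep : ℕ → ℝ) (hi : ℝ) (i : ℕ) (y y' : Row) : Prop :=
  y.R i = y'.R i ∧ ∀ j < n, rep j ≤ hi → freeCount n rep y (rep j) = freeCount n rep y' (rep j)

/-- The row `y` is as good as a partial solution in which the items in `S` have been moved. -/
def Covers (n : ℕ) (rep : ℕ → ℝ) (hi : ℝ) (i : ℕ) (y : Row) (S : Finset ℕ) (ρ f : ℝ) : Prop :=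
  (∀ j < n, rep j ≤ hi → freeCount n rep y (rep j) = leftCount n rep S (rep j)) ∧
    y.R i = ρ ∧ y.F ≤ f

/-- Some row of the list is as good as a partial solution in which the items in `S` have been
moved. -/
def Covered (n : ℕ) (rep : ℕ → ℝ) (hi : ℝ) (i : ℕ) (rows : ℕ → Row) (N : ℕ) (S : Finset ℕ)
    (ρ f : ℝ) : Prop :=
  ∃ r < N, Covers n rep hi i (rows r) S ρ f

/-- `(rows', N')` is the result of the insertion of `c` into the list `(rows, N)`. -/
def Inserted (E : Row → Row → Prop) (rows : ℕ → Row) (N : ℕ) (c : Row) (rows' : ℕ → Row) (N' : ℕ) :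
    Prop :=
  (N' = N ∧ ∃ r₂ < N, E c (rows r₂) ∧
    ((c.F < (rows r₂).F ∧ ∀ r < N, rows' r = if r = r₂ then c else rows r) ∨
      ((rows r₂).F ≤ c.F ∧ ∀ r < N, rows' r = rows r))) ∨
  (N' = N + 1 ∧ (∀ r < N, ¬ E c (rows r)) ∧ ∀ r < N + 1, rows' r = if r = N then c else rows r)

section

variable {n : ℕ} {rep : ℕ → ℝ} {hi : ℝ} {i : ℕ}

theorem SameKey.refl (y : Row) : SameKey n rep hi i y y := ⟨rfl, fun _ _ _ => rfl⟩

theorem SameKey.symm {y y' : Row} (h : SameKey n rep hi i y y') : SameKey n rep hi i y' y :=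
  ⟨h.1.symm, fun j hj hz => (h.2 j hj hz).symm⟩

theorem SameKey.trans {y y' y'' : Row} (h : SameKey n rep hi i y y')
    (k : SameKey n rep hi i y' y'') : SameKey n rep hi i y y'' :=
  ⟨h.1.trans k.1, fun j hj hz => (h.2 j hj hz).trans (k.2 j hj hz)⟩

theorem Covers.of_sameKey {y y' : Row} {S : Finset ℕ} {ρ f : ℝ} (h : Covers n rep hi i y S ρ f)
    (k : SameKey n rep hi i y' y) (hF : y'.F ≤ y.F) : Covers n rep hi i y' S ρ f :=
  ⟨fun j hj hz => (k.2 j hj hz).trans (h.1 j hj hz), k.1.trans h.2.1, hF.trans h.2.2⟩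

theorem freeCount_put {y : Row} {z : ℝ} {k b : ℕ} {f : ℝ} (hk : k < n) (hA : y.A k = 0) (w : ℝ) :
    freeCount n rep y w = freeCount n rep (y.put n z k b f) w + if w = rep k then 1 else 0 := by
  unfold freeCount
  by_cases hw : w = rep k
  · subst hw
    rw [if_pos rfl, ← Finset.card_insert_of_notMem (a := k)]
    · congr 1
      ext j
      by_cases hj : j = k
      · subst hj; simp [hk, hA]
      · rw [mem_insert, mem_filter, mem_filter]; simp [hj, Row.put]
    · rw [mem_filter]; simp [Row.put]
  · rw [if_neg hw, add_zero]
    congr 1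
    ext j
    by_cases hj : j = k
    · subst hj; rw [mem_filter, mem_filter]; simp [Ne.symm hw]
    · rw [mem_filter, mem_filter]; simp [hj, Row.put]

theorem leftCount_insert {S : Finset ℕ} {k : ℕ} (hk : k < n) (hS : k ∉ S) (w : ℝ) :
    leftCount n rep S w = leftCount n rep (insert k S) w + if w = rep k then 1 else 0 := by
  unfold leftCount
  by_cases hw : w = rep k
  · subst hw
    rw [if_pos rfl, ← Finset.card_insert_of_notMem (a := k)]
    · congr 1
      ext j
      by_cases hj : j = k
      · subst hj; simp [hk, hS]
      · simp [hj]
    · simp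
  · rw [if_neg hw, add_zero]
    congr 1
    ext j
    by_cases hj : j = k
    · subst hj; simp [Ne.symm hw]
    · simp [hj]

/-- The item `j` itself may be taken in `y`, but equality of the counts yields another free item of
the same rounded size. Items of equal rounded size are interchangeable throughout. -/
theorem Covers.exists_free {y : Row} {S : Finset ℕ} {ρ f : ℝ} (h : Covers n rep hi i y S ρ f)
    {j : ℕ} (hj : j < n) (hz : rep j ≤ hi) (hS : j ∉ S) :
    ∃ k < n, rep k = rep j ∧ y.A k = 0 := by
  have h1 := h.1 j hj hz
  have h2 : 0 < leftCount n rep S (rep j) :=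
    Finset.card_pos.2 ⟨j, by simp [hj, hS]⟩
  rw [← h1] at h2
  obtain ⟨k, hk⟩ := Finset.card_pos.1 h2
  simp only [mem_filter, mem_range] at hk
  exact ⟨k, hk.1, hk.2⟩

theorem Covers.put {y : Row} {S : Finset ℕ} {ρ ρ' f f' : ℝ} {z : ℝ} {k b j : ℕ} {f₁ : ℝ}
    (h : Covers n rep hi i y S ρ f) (hk : k < n) (hA : y.A k = 0) (hj : j < n) (hS : j ∉ S)
    (hkj : rep k = rep j) (hR : (y.put n z k b f₁).R i = ρ') (hf : f₁ ≤ f') :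
    Covers n rep hi i (y.put n z k b f₁) (insert j S) ρ' f' := by
  refine ⟨fun m hm hz => ?_, hR, hf⟩
  have h1 := freeCount_put (rep := rep) (z := z) (b := b) (f := f₁) hk hA (rep m)
  have h2 := leftCount_insert (rep := rep) hj hS (rep m)
  have h3 := h.1 m hm hz
  rw [hkj] at h1
  omega

/-- What insertion guarantees in all three cases: every old key survives with no larger `F`, so
nothing covered before is lost; the key of `c` is present with a value at least as good; and an
appended row has a key that was not there before. -/
theorem Inserted.spec {rows rows' : ℕ → Row} {N N' : ℕ} {c : Row}
    (h : Inserted (SameKey n rep hi i) rows N c rows' N') :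
    N ≤ N' ∧ (∀ r < N, SameKey n rep hi i (rows' r) (rows r) ∧ (rows' r).F ≤ (rows r).F) ∧
    (∃ r < N', SameKey n rep hi i (rows' r) c ∧ (rows' r).F ≤ c.F) ∧
    (∀ r < N', (r < N ∧ rows' r = rows r) ∨ rows' r = c) ∧
    (∀ r < N', N ≤ r → ∀ r' < N, ¬ SameKey n rep hi i (rows' r) (rows r')) ∧ N' ≤ N + 1 := by
  rcases h with ⟨rfl, r₂, hr₂, hE, ⟨hF, hr⟩ | ⟨hF, hr⟩⟩ | ⟨rfl, hE, hr⟩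
  · refine ⟨le_rfl, fun r h => ?_, ⟨r₂, hr₂, ?_⟩, fun r h => ?_, fun r h h' => by omega, by omega⟩
    · rw [hr r h]
      split_ifs with h1
      · subst h1; exact ⟨hE, hF.le⟩
      · exact ⟨.refl _, le_rfl⟩
    · rw [hr _ hr₂, if_pos rfl]; exact ⟨.refl _, le_rfl⟩
    · rw [hr r h]; split_ifs
      · exact Or.inr rfl
      · exact Or.inl ⟨h, rfl⟩
  · refine ⟨le_rfl, fun r h => ?_, ⟨r₂, hr₂, ?_⟩, fun r h => Or.inl ⟨h, hr r h⟩,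
      fun r h h' => by omega, by omega⟩
    · rw [hr r h]; exact ⟨.refl _, le_rfl⟩
    · rw [hr _ hr₂]; exact ⟨hE.symm, hF⟩
  · refine ⟨by omega, fun r h => ?_, ⟨N, by omega, ?_⟩, fun r h => ?_, fun r h h' r' hr' => ?_, by omega⟩
    · rw [hr r (by omega), if_neg (by omega)]; exact ⟨.refl _, le_rfl⟩
    · rw [hr _ (by omega), if_pos rfl]; exact ⟨.refl _, le_rfl⟩
    · rw [hr r h]; split_ifs
      · exact Or.inr rfl
      · exact Or.inl ⟨by omega, rfl⟩
    · rw [hr r h, if_pos (by omega)]; exact hE r' hr'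

/-- The rows with numbers from `Nst` on have different keys. -/
def Distinct (n : ℕ) (rep : ℕ → ℝ) (hi : ℝ) (i Nst : ℕ) (rows : ℕ → Row) (N : ℕ) : Prop :=
  ∀ r < N, ∀ r' < N, Nst ≤ r → Nst ≤ r' → r ≠ r' → ¬ SameKey n rep hi i (rows r) (rows r')

theorem Inserted.distinct {rows rows' : ℕ → Row} {N N' Nst : ℕ} {c : Row}
    (h : Inserted (SameKey n rep hi i) rows N c rows' N')
    (hd : Distinct n rep hi i Nst rows N) : Distinct n rep hi i Nst rows' N' := by
  obtain ⟨-, h2, -, -, h5, h6⟩ := h.spec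
  intro r hr r' hr' h7 h8 hne hE
  rcases lt_or_ge r N with h9 | h9 <;> rcases lt_or_ge r' N with h10 | h10
  · exact hd r h9 r' h10 h7 h8 hne ((h2 r h9).1.symm.trans (hE.trans (h2 r' h10).1))
  · exact h5 r' hr' h10 r h9 (hE.symm.trans (h2 r h9).1)
  · exact h5 r hr h9 r' h10 (hE.trans (h2 r' h10).1)
  · omega

/-- The result of the insertion of the child of row `r`. -/
def ChildRel (n : ℕ) (rep : ℕ → ℝ) (hi : ℝ) (i : ℕ) (Pick : ℝ → Row → ℕ → ℝ → Prop) (z : ℝ)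
    (rows : ℕ → Row) (N r : ℕ) (rows' : ℕ → Row) (N' : ℕ) : Prop :=
  ((∀ k < n, rep k = z → (rows r).A k ≠ 0) ∧ N' = N ∧ ∀ r < N, rows' r = rows r) ∨
  ∃ k < n, rep k = z ∧ (rows r).A k = 0 ∧ ∃ b f, Pick z (rows r) b f ∧
    Inserted (SameKey n rep hi i) rows N ((rows r).put n z k b f) rows' N'

/-- What holds in an event after the children of the rows up to `r` have been inserted. -/
structure EventInv (n : ℕ) (rep : ℕ → ℝ) (hi : ℝ) (i : ℕ) (V : Row → Prop)
    (nρ nf : ℝ → ℝ → ℝ) (j : ℕ) (Nst : ℕ) (rows₀ : ℕ → Row) (N₀ r : ℕ)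
    (rows : ℕ → Row) (N : ℕ) : Prop where
  le : N₀ ≤ N
  valid : ∀ r < N, V (rows r)
  distinct : Distinct n rep hi i Nst rows N
  improve : ∀ r < N₀, SameKey n rep hi i (rows r) (rows₀ r) ∧ (rows r).F ≤ (rows₀ r).F
  children : ∀ r' < r, ∀ S ρ f, Covers n rep hi i (rows₀ r') S ρ f → j ∉ S →
    Covered n rep hi i rows N (insert j S) (nρ (rep j) ρ) (nf (rep j) f)

/-- The choice of the target of a move preserves validity and is at least as good as prescribed. -/
structure PickOk (n : ℕ) (rep : ℕ → ℝ) (hi : ℝ) (i : ℕ) (V : Row → Prop)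
    (Pick : ℝ → Row → ℕ → ℝ → Prop) (nρ nf : ℝ → ℝ → ℝ) (j : ℕ) : Prop where
  valid : ∀ y k b f, V y → k < n → rep k = rep j → y.A k = 0 → Pick (rep j) y b f →
    V (y.put n (rep j) k b f)
  R : ∀ y k b f, V y → Pick (rep j) y b f → (y.put n (rep j) k b f).R i = nρ (rep j) (y.R i)
  F : ∀ y b f f₁, V y → Pick (rep j) y b f → y.F ≤ f₁ → f ≤ nf (rep j) f₁

/-- The parent may have been replaced since the event began, but only by a row with the same key and
no larger `F`, which covers the same partial solutions. Its child then covers them with one more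
item moved, and so does the row that represents the child after insertion. -/
theorem EventInv.step {V : Row → Prop} {Pick : ℝ → Row → ℕ → ℝ → Prop} {nρ nf : ℝ → ℝ → ℝ}
    {j Nst N₀ N N' r : ℕ} {rows₀ rows rows' : ℕ → Row}
    (h : EventInv n rep hi i V nρ nf j Nst rows₀ N₀ r rows N)
    (hP : PickOk n rep hi i V Pick nρ nf j) (hj : j < n) (hz : rep j ≤ hi) (hr : r < N₀)
    (hc : ChildRel n rep hi i Pick (rep j) rows N r rows' N') :
    EventInv n rep hi i V nρ nf j Nst rows₀ N₀ (r + 1) rows' N' := by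
  have hr' : r < N := hr.trans_le h.le
  rcases hc with ⟨hno, rfl, hrows⟩ | ⟨k, hk, hkz, hA, b, f, hpick, hins⟩
  · refine ⟨h.le, fun r' hr' => ?_, fun r₁ h₁ r₂ h₂ => ?_, fun r' hr'' => ?_, ?_⟩
    · rw [hrows r' hr']; exact h.valid r' hr'
    · rw [hrows _ h₁, hrows _ h₂]; exact h.distinct r₁ h₁ r₂ h₂
    · rw [hrows r' (hr''.trans_le h.le)]; exact h.improve r' hr''
    · intro r' hr'' S ρ f hS hjS
      rcases Nat.lt_succ_iff_lt_or_eq.1 hr'' with h' | rfl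
      · obtain ⟨r₁, h₁, h₂⟩ := h.children r' h' S ρ f hS hjS
        exact ⟨r₁, h₁, by rwa [hrows r₁ h₁]⟩
      -- If row `r` has no free item of this size, it covers no partial solution in which `j` is
      -- still free.
      · have := hS.of_sameKey (h.improve r' hr).1 (h.improve r' hr).2
        obtain ⟨k, hk, hkz, hA⟩ := this.exists_free hj hz hjS
        exact absurd hA (hno k hk hkz)
  · obtain ⟨h1, h2, ⟨r₃, h3, h3'⟩, h4, -⟩ := hins.spec
    refine ⟨h.le.trans h1, fun r' hr' => ?_, hins.distinct h.distinct, fun r' hr'' => ?_, ?_⟩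
    · rcases h4 r' hr' with ⟨h5, h6⟩ | h5
      · rw [h6]; exact h.valid r' h5
      · rw [h5]; exact hP.valid _ _ _ _ (h.valid r (by assumption)) hk hkz hA hpick
    · have h5 := h.improve r' hr''
      have h6 := h2 r' (hr''.trans_le h.le)
      exact ⟨h6.1.trans h5.1, h6.2.trans h5.2⟩
    · intro r' hr'' S ρ f₂ hS hjS
      rcases Nat.lt_succ_iff_lt_or_eq.1 hr'' with h' | rfl
      · obtain ⟨r₁, h₁, h₂⟩ := h.children r' h' S ρ f₂ hS hjS
        exact ⟨r₁, h₁.trans_le h1, h₂.of_sameKey (h2 r₁ h₁).1 (h2 r₁ h₁).2⟩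
      · have h5 := hS.of_sameKey (h.improve r' hr).1 (h.improve r' hr).2
        refine ⟨r₃, h3, Covers.of_sameKey ?_ h3'.1 h3'.2⟩
        refine h5.put hk hA hj hjS hkz ?_ (hP.F _ _ _ _ (h.valid r' hr') hpick h5.2.2)
        rw [hP.R _ _ _ _ (h.valid r' hr') hpick, h5.2.1]

/-- What holds in a stage after the events of the items up to `m`. -/
structure StageInv (n : ℕ) (rep : ℕ → ℝ) (hi : ℝ) (i : ℕ) (V : Row → Prop)
    (nρ nf : ℝ → ℝ → ℝ) (lo shi : ℝ) (rows₀ : ℕ → Row) (N₀ m : ℕ)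
    (rows : ℕ → Row) (N : ℕ) : Prop where
  le : N₀ ≤ N
  valid : ∀ r < N, V (rows r)
  distinct : Distinct n rep hi i N₀ rows N
  -- `ρ` and `Φ` are arbitrary functions of the set of moved items, so that one invariant serves
  -- both kinds of stage: when a bin is filled, `ρ` varies and `Φ` is constant; when fluid items are
  -- poured, it is the other way round.
  covered : ∀ (S T : Finset ℕ) (ρ Φ : Finset ℕ → ℝ), Disjoint S T →
    (∀ j ∈ T, j < n ∧ lo ≤ rep j ∧ rep j ≤ shi ∧ ∀ W, j ∉ W →
      nρ (rep j) (ρ W) = ρ (insert j W) ∧ nf (rep j) (Φ W) ≤ Φ (insert j W)) →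
    Covered n rep hi i rows₀ N₀ S (ρ S) (Φ S) →
    Covered n rep hi i rows N (S ∪ {j ∈ T | j < m}) (ρ (S ∪ {j ∈ T | j < m}))
      (Φ (S ∪ {j ∈ T | j < m}))

theorem StageInv.init {V : Row → Prop} {nρ nf : ℝ → ℝ → ℝ} {lo shi : ℝ} {rows₀ : ℕ → Row} {N₀ : ℕ}
    (hV : ∀ r < N₀, V (rows₀ r)) :
    StageInv n rep hi i V nρ nf lo shi rows₀ N₀ 0 rows₀ N₀ := by
  refine ⟨le_rfl, hV, fun r h r' h' h1 => by omega, fun S T ρ Φ _ _ h => ?_⟩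
  simpa using h

theorem StageInv.skip {V : Row → Prop} {nρ nf : ℝ → ℝ → ℝ} {lo shi : ℝ} {rows₀ rows : ℕ → Row}
    {N₀ N m : ℕ} (h : StageInv n rep hi i V nρ nf lo shi rows₀ N₀ m rows N)
    (hm : ¬ (lo ≤ rep m ∧ rep m ≤ shi)) :
    StageInv n rep hi i V nρ nf lo shi rows₀ N₀ (m + 1) rows N := by
  refine ⟨h.le, h.valid, h.distinct, fun S T ρ Φ h1 h2 h3 => ?_⟩
  have : ({j ∈ T | j < m + 1} : Finset ℕ) = {j ∈ T | j < m} := by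
    apply Finset.filter_congr
    intro j hj
    have : j ≠ m := fun e => hm (e ▸ ⟨(h2 j hj).2.1, (h2 j hj).2.2.1⟩)
    omega
  rw [this]
  exact h.covered S T ρ Φ h1 h2 h3

theorem EventInv.init {V : Row → Prop} {nρ nf : ℝ → ℝ → ℝ} {lo shi : ℝ} {rows₀ rows : ℕ → Row}
    {N₀ N m j : ℕ} (h : StageInv n rep hi i V nρ nf lo shi rows₀ N₀ m rows N) :
    EventInv n rep hi i V nρ nf j N₀ rows N 0 rows N :=
  ⟨le_rfl, h.valid, h.distinct, fun _ _ => ⟨.refl _, le_rfl⟩, fun _ h => by omega⟩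

/-- Parents stay in the list up to improvement, so each event is optional: if `m ∈ T` take the
child, otherwise keep the row. -/
theorem StageInv.step {V : Row → Prop} {nρ nf : ℝ → ℝ → ℝ} {lo shi : ℝ} {rows₀ rows rows' : ℕ → Row}
    {N₀ N N' m : ℕ} (h : StageInv n rep hi i V nρ nf lo shi rows₀ N₀ m rows N)
    (he : EventInv n rep hi i V nρ nf m N₀ rows N N rows' N') :
    StageInv n rep hi i V nρ nf lo shi rows₀ N₀ (m + 1) rows' N' := by
  refine ⟨h.le.trans he.le, he.valid, he.distinct, fun S T ρ Φ h1 h2 h3 => ?_⟩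
  obtain ⟨r, hr, h4⟩ := h.covered S T ρ Φ h1 h2 h3
  by_cases hm : m ∈ T
  · have h5 : ({j ∈ T | j < m + 1} : Finset ℕ) = insert m {j ∈ T | j < m} := by
      ext j
      simp only [mem_filter, mem_insert]
      constructor
      · rintro ⟨h6, h7⟩
        by_cases h8 : j = m
        · exact Or.inl h8
        · exact Or.inr ⟨h6, by omega⟩
      · rintro (rfl | h6)
        · exact ⟨hm, by omega⟩
        · exact ⟨h6.1, by omega⟩
    have h6 : m ∉ S ∪ {j ∈ T | j < m} := by
      simp only [mem_union, mem_filter, not_or]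
      exact ⟨fun h => Finset.disjoint_left.1 h1 h hm, fun h => by omega⟩
    obtain ⟨r', hr', h7⟩ := he.children r hr _ _ _ h4 h6
    obtain ⟨h8, h9⟩ := (h2 m hm).2.2.2 _ h6
    rw [h5, Finset.union_insert]
    refine ⟨r', hr', h7.1, h7.2.1.trans h8, h7.2.2.trans h9⟩
  · have h5 : ({j ∈ T | j < m + 1} : Finset ℕ) = {j ∈ T | j < m} := by
      apply Finset.filter_congr
      intro j hj
      have : j ≠ m := fun e => hm (e ▸ hj)
      omega
    rw [h5]
    exact ⟨r, hr.trans_le he.le, h4.of_sameKey (he.improve r hr).1 (he.improve r hr).2⟩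

/-- There are few rows with different keys. -/
theorem card_le_of_distinct {rows : ℕ → Row} {N Nst : ℕ} {lo : ℝ} {Z : Finset ℝ}
    (hZ : ∀ j < n, lo ≤ rep j → rep j ≤ hi → rep j ∈ Z)
    (hlo : ∀ r < N, ∀ j < n, (rows r).A j ≠ 0 → lo ≤ rep j)
    (hR : ∀ r < N, ∀ r' < N, Nst ≤ r → Nst ≤ r' →
      (∀ z ∈ Z, #{j ∈ range n | rep j = z ∧ (rows r).A j = i + 1}
        = #{j ∈ range n | rep j = z ∧ (rows r').A j = i + 1}) → (rows r).R i = (rows r').R i)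
    (hd : Distinct n rep hi i Nst rows N) : N ≤ Nst + (n + 1) ^ (2 * Z.card) := by
  let cnt : Row → ℕ → ℝ → ℕ := fun y v z => #{j ∈ range n | rep j = z ∧ y.A j = v}
  have hcnt : ∀ y v z, cnt y v z < n + 1 := fun y v z =>
    Nat.lt_succ_of_le ((Finset.card_filter_le _ _).trans (by simp))
  -- For each size in the window, record the number of free items and the number of items in bin
  -- `i`. The second vector determines `R i` by `hR`.
  let key : ℕ → (Z → Fin (n + 1)) × (Z → Fin (n + 1)) := fun r =>
    (fun z => ⟨cnt (rows r) 0 z, hcnt _ _ _⟩, fun z => ⟨cnt (rows r) (i + 1) z, hcnt _ _ _⟩)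
  have h1 : (Finset.Ico Nst N).card ≤
      (Finset.univ : Finset ((Z → Fin (n + 1)) × (Z → Fin (n + 1)))).card := by
    refine Finset.card_le_card_of_injOn key (fun _ _ => Finset.mem_coe.2 (Finset.mem_univ _)) ?_
    intro r hr r' hr' he
    simp only [coe_Ico, Set.mem_Ico] at hr hr'
    by_contra hne
    simp only [key, Prod.mk.injEq, funext_iff, Fin.mk.injEq, Subtype.forall] at he
    refine hd r hr.2 r' hr'.2 hr.1 hr'.1 hne ⟨hR r hr.2 r' hr'.2 hr.1 hr'.1 he.2, fun j hj hz => ?_⟩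
    by_cases hl : lo ≤ rep j
    · exact he.1 _ (hZ j hj hl hz)
    -- Items smaller than `lo` have not been assigned in any row, so their counts cannot distinguish
    -- two rows.
    · have : ∀ r < N, freeCount n rep (rows r) (rep j) = #{j' ∈ range n | rep j' = rep j} := by
        intro r hr
        unfold freeCount
        congr 1
        ext j'
        simp only [mem_filter, mem_range, and_congr_right_iff, and_iff_left_iff_imp]
        intro h1 h2
        by_contra h3
        exact hl (h2 ▸ hlo r hr j' h1 h3)
      rw [this r hr.2, this r' hr'.2]
  simp only [Nat.card_Ico, Finset.card_univ, Fintype.card_prod, Fintype.card_fun,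
    Fintype.card_coe, Fintype.card_fin] at h1
  have : (n + 1) ^ (2 * Z.card) = (n + 1) ^ Z.card * (n + 1) ^ Z.card := by ring
  omega

end

end MatchUp


/-! ### The tables in memory as lists of rows. -/

namespace MatchUp

open Finset RealRAM

/-- The rows of the tables in the memory. -/
def rowOf (n : ℕ) (s : State) (r : ℕ) : Row :=
  ⟨fun k => if k < n + 1 then s.narr 1 (r * (n + 1) + k) else 0,
   fun k => if k < n + 1 then s.rarr 6 (r * (n + 1) + k) else 0, s.rarr 7 r⟩

section

variable {n : ℕ} {s s' : State}

theorem rowOf_congr (h1 : s'.narr 1 = s.narr 1) (h6 : s'.rarr 6 = s.rarr 6)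
    (h7 : s'.rarr 7 = s.rarr 7) : rowOf n s' = rowOf n s := by
  unfold rowOf; rw [h1, h6, h7]

@[simp] theorem rowOf_setn (x v : ℕ) : rowOf n (s.setn x v) = rowOf n s := rfl
@[simp] theorem rowOf_setr (x : ℕ) (v : ℝ) : rowOf n (s.setr x v) = rowOf n s := rfl

theorem row_index {n r r' k k' : ℕ} (hk : k < n + 1) (hk' : k' < n + 1) :
    r' * (n + 1) + k' = r * (n + 1) + k ↔ r' = r ∧ k' = k := by
  constructor
  · intro h
    have h1 : r' = r := by
      have := congrArg (· / (n + 1)) h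
      simpa [Nat.add_comm _ k, Nat.add_comm _ k', Nat.add_mul_div_right, Nat.div_eq_of_lt hk,
        Nat.div_eq_of_lt hk'] using this
    subst h1
    exact ⟨rfl, by omega⟩
  · rintro ⟨rfl, rfl⟩; rfl

theorem rowOf_putA (r k v : ℕ) (hk : k < n + 1) : rowOf n (s.putn 1 (r * (n + 1) + k) v) =
    Function.update (rowOf n s) r
      { rowOf n s r with A := Function.update (rowOf n s r).A k v } := by
  funext r'
  by_cases hr : r' = r
  · subst hr
    rw [Function.update_self]
    ext k' <;> simp only [rowOf, State.putn_narr, State.putn_rarr, Function.update_apply]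
    by_cases hk' : k' < n + 1
    · simp only [hk', row_index hk hk', if_true, true_and]
    · simp [hk', show k' ≠ k by omega]
  · rw [Function.update_of_ne hr]
    ext k' <;> simp only [rowOf, State.putn_narr, State.putn_rarr]
    by_cases hk' : k' < n + 1
    · simp [hk', row_index hk hk', hr]
    · simp [hk']

theorem rowOf_putR (r k : ℕ) (v : ℝ) (hk : k < n + 1) :
    rowOf n (s.putr 6 (r * (n + 1) + k) v) =
    Function.update (rowOf n s) r
      { rowOf n s r with R := Function.update (rowOf n s r).R k v } := by
  funext r'
  by_cases hr : r' = r
  · subst hr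
    rw [Function.update_self]
    ext k' <;> simp only [rowOf, State.putr_narr, State.putr_rarr, Function.update_apply]
    · by_cases hk' : k' < n + 1
      · simp only [hk', row_index hk hk', if_true, true_and]
      · simp [hk', show k' ≠ k by omega]
    · simp
  · rw [Function.update_of_ne hr]
    ext k' <;> simp only [rowOf, State.putr_narr, State.putr_rarr]
    · by_cases hk' : k' < n + 1
      · simp [hk', row_index hk hk', hr]
      · simp [hk']
    · simp

theorem rowOf_putF (r : ℕ) (v : ℝ) : rowOf n (s.putr 7 r v) =
    Function.update (rowOf n s) r { rowOf n s r with F := v } := by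
  funext r'
  by_cases hr : r' = r
  · subst hr
    rw [Function.update_self]
    ext k' <;> simp [rowOf]
  · rw [Function.update_of_ne hr]
    ext k' <;> simp [rowOf, hr]

theorem narr_eq_rowOf {r k : ℕ} (hk : k < n + 1) : s.narr 1 (r * (n + 1) + k) = (rowOf n s r).A k := by
  simp only [rowOf, if_pos hk]

theorem rarr_eq_rowOf {r k : ℕ} (hk : k < n + 1) : s.rarr 6 (r * (n + 1) + k) = (rowOf n s r).R k := by
  simp only [rowOf, if_pos hk]

theorem F_eq_rowOf {r : ℕ} : s.rarr 7 r = (rowOf n s r).F := rfl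

theorem eval_cellA {r k r' k' : ℕ} (hr : s.narr 2 (s.nvar r) = r' * (n + 1)) (hk : s.nvar k = k')
    (hk' : k' < n + 1) : (cellA r k).eval s = (rowOf n s r').A k' := by
  simp [cellA, NExp.eval, hr, hk, narr_eq_rowOf hk']

theorem eval_cellR {r k r' k' : ℕ} (hr : s.narr 2 (s.nvar r) = r' * (n + 1)) (hk : s.nvar k = k')
    (hk' : k' < n + 1) : (cellR r k).eval s = (rowOf n s r').R k' := by
  simp [cellR, NExp.eval, RExp.eval, hr, hk, rarr_eq_rowOf hk']

theorem copyRow_runs {src dst r r' : ℕ} (hs : src ≠ 10) (hd : dst ≠ 10) (hn : s.nvar 0 = n)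
    (hsr : s.nvar src = r) (hdr : s.nvar dst = r') (hbr : s.narr 2 r = r * (n + 1))
    (hbr' : s.narr 2 r' = r' * (n + 1)) :
    Runs (copyRow src dst) s (60 * (n + 1)) fun s' =>
      rowOf n s' = Function.update (rowOf n s) r' (rowOf n s r) := by
  set y := rowOf n s r with hy
  set y' := rowOf n s r' with hy'
  have h1 := Runs.forP (x := 10) (e := .add (.var 0) (.const 1)) (s := s) (N := n + 1) (B := 20)
    (c := .storeN 1 (.add (.cell 2 (.var dst)) (.var 10)) (cellA src 10) ;;
     .storeR 6 (.add (.cell 2 (.var dst)) (.var 10)) (cellR src 10))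
    (fun k s' => rowOf n s' = Function.update (rowOf n s) r'
      ⟨fun m => if m < k then y.A m else y'.A m, fun m => if m < k then y.R m else y'.R m, y'.F⟩)
    rfl (fun s' hf => by simp [NExp.eval, hf.n 0 rfl, hn]) (by
      simp only [rowOf_setn, not_lt_zero, if_false]
      exact (Function.update_eq_self _ _).symm)
    (fun k s' hk hf hx hP => by
      have hns : s'.nvar src = r := by
        rw [hf.n src (by simp [forP, Prog.wn, hs]), hsr]
      have hnd : s'.nvar dst = r' := by
        rw [hf.n dst (by simp [forP, Prog.wn, hd]), hdr]
      have hb : s'.narr 2 = s.narr 2 := hf.na 2 rfl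
      have e1 : (cellA src 10).eval s' = y.A k := by
        rw [eval_cellA (by rw [hns, hb, hbr]) hx hk, hP]
        by_cases h : r = r'
        · subst h; rw [Function.update_self]; simp [hy, hy']
        · rw [Function.update_of_ne h]
      have e2 : ∀ i v, (cellR src 10).eval (s'.putn 1 i v) = y.R k := by
        intro i v
        have : (cellR src 10).eval (s'.putn 1 i v) = (cellR src 10).eval s' := by
          simp [cellR, NExp.eval, RExp.eval]
        rw [this, eval_cellR (by rw [hns, hb, hbr]) hx hk, hP]
        by_cases h : r = r'
        · subst h; rw [Function.update_self]; simp [hy, hy']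
        · rw [Function.update_of_ne h]
      refine Runs.of_run rfl (Nat.le_of_ble_eq_true rfl) ?_
      simp only [Prog.run, e1, e2, NExp.eval, hx, hnd, hb, hbr', State.putn_nvar, State.putn_narr]
      simp only [OfNat.ofNat_ne_one, false_and, if_false, rowOf_setn]
      rw [rowOf_putR _ _ _ hk, rowOf_putA _ _ _ hk, hP]
      simp only [Function.update_self, Function.update_idem]
      congr 1
      ext m
      · simp only [Function.update_apply]
        by_cases h : m = k
        · simp [h]
        · simp [h, show m < k + 1 ↔ m < k by omega]
      · simp only [Function.update_apply]
        by_cases h : m = k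
        · simp [h]
        · simp [h, show m < k + 1 ↔ m < k by omega]
      · rfl)
  refine (h1.seq (B₂ := 5) fun s' hf hP => Runs.of_run rfl (Nat.le_of_ble_eq_true rfl) ?_).le ?_
  · have hns : s'.nvar src = r := by
      rw [hf.n src (by simp [forP, Prog.wn, hs]), hsr]
    have hnd : s'.nvar dst = r' := by
      rw [hf.n dst (by simp [forP, Prog.wn, hd]), hdr]
    simp only [Prog.run, NExp.eval, RExp.eval, hns, hnd]
    rw [rowOf_putF, hP, F_eq_rowOf (n := n), hP]
    simp only [Function.update_self, Function.update_idem]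
    congr 1
    ext m
    · by_cases h : m < n + 1
      · simp [h]
      · simp only [if_neg h, hy, hy', rowOf]
    · by_cases h : m < n + 1
      · simp [h]
      · simp only [if_neg h, hy, hy', rowOf]
    · by_cases h : r = r'
      · subst h; simp [hy, hy']
      · simp [Function.update_of_ne h, hy]
  · simp only [NExp.cost]
    omega

end

end MatchUp


/-! ### Correctness of the key test and of insertion. -/

namespace MatchUp

open Finset RealRAM

theorem card_filter_range_succ (p : ℕ → Prop) [DecidablePred p] (k : ℕ) :
    #{j ∈ range (k + 1) | p j} = #{j ∈ range k | p j} + if p k then 1 else 0 := by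
  rw [Finset.card_filter, Finset.sum_range_succ, ← Finset.card_filter]

section

variable {n N r i : ℕ} {s : State} {rep : ℕ → ℝ} {hi : ℝ}

theorem countFree_runs {j : ℕ} (hn : s.nvar 0 = n) (hrep : s.rarr 4 = rep) (hN : s.nvar 4 = N)
    (hr : s.nvar 11 = r) (hj : s.nvar 13 = j) (hbN : s.narr 2 N = N * (n + 1))
    (hbr : s.narr 2 r = r * (n + 1)) :
    Runs countFree s (80 * (n + 1)) fun s' =>
      s'.nvar 15 = freeCount n rep (rowOf n s N) (rep j) ∧
      s'.nvar 16 = freeCount n rep (rowOf n s r) (rep j) := by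
  unfold countFree
  refine (Runs.seq (B₁ := 2) (Q₁ := fun s' => s' = s.setn 15 0) (B₂ := 2 + (n * 64 + 10))
    (Runs.of_run rfl le_rfl rfl) fun s₁ _ h₁ => Runs.seq (B₁ := 2)
    (Q₁ := fun s' => s' = (s.setn 15 0).setn 16 0) (Runs.of_run rfl le_rfl (by rw [h₁]; rfl))
    fun s₂ _ h₂ => ?_).le (by omega)
  refine ((Runs.forP (N := n) (B := 55)
    (fun k s' => s'.nvar 15 = #{j' ∈ range k | rep j' = rep j ∧ (rowOf n s N).A j' = 0} ∧
      s'.nvar 16 = #{j' ∈ range k | rep j' = rep j ∧ (rowOf n s r).A j' = 0})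
    rfl ?_ ?_ ?_)).le (by simp only [NExp.cost]; omega)
  · intro s' hf
    simp [NExp.eval, hf.n 0 rfl, h₂, hn]
  · simp [h₂]
  · intro k s' hk hf hx ⟨h15, h16⟩
    have f4 : s'.nvar 4 = N := by rw [hf.n 4 rfl, h₂]; simp [hN]
    have f11 : s'.nvar 11 = r := by rw [hf.n 11 rfl, h₂]; simp [hr]
    have f13 : s'.nvar 13 = j := by rw [hf.n 13 rfl, h₂]; simp [hj]
    have g1 : s'.narr 1 = s.narr 1 := by rw [hf.na 1 rfl, h₂]; rfl
    have g2 : s'.narr 2 = s.narr 2 := by rw [hf.na 2 rfl, h₂]; rfl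
    have g4 : s'.rarr 4 = rep := by rw [hf.ra 4 rfl, h₂]; exact hrep
    have eN : s.narr 1 (N * (n + 1) + k) = _ := narr_eq_rowOf (by omega)
    have er : s.narr 1 (r * (n + 1) + k) = _ := narr_eq_rowOf (by omega)
    refine Runs.of_run rfl (Nat.le_of_ble_eq_true rfl) ?_
    by_cases h1 : rep k = rep j <;> by_cases h2 : (rowOf n s N).A k = 0 <;>
      by_cases h3 : (rowOf n s r).A k = 0 <;>
      simp [Prog.run, cellA, NExp.eval, RExp.eval, f4, f11, f13, hx, g1, g2, g4, hbN, hbr, eN, er,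
        h1, h2, h3, card_filter_range_succ, h15, h16]

theorem testKey_runs (hn : s.nvar 0 = n) (hrep : s.rarr 4 = rep) (hN : s.nvar 4 = N)
    (hr : s.nvar 11 = r) (hhi : s.rvar 6 = hi) (hi5 : s.nvar 5 = i) (hin : i ≤ n)
    (hbN : s.narr 2 N = N * (n + 1)) (hbr : s.narr 2 r = r * (n + 1)) :
    Runs testKey s (200 * (n + 1) ^ 2) fun s' =>
      s'.nvar 12 = 1 ↔ SameKey n rep hi i (rowOf n s N) (rowOf n s r) := by
  unfold testKey
  refine (Runs.seq (B₁ := 2) (Q₁ := fun s' => s' = s.setn 12 1)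
    (B₂ := 30 + (n * (80 * (n + 1) + 30 + 1 + 8) + 10))
    (Runs.of_run rfl le_rfl rfl) fun s₁ _ h₁ => Runs.seq (B₁ := 30)
    (Q₁ := fun s' => (∃ v, s' = s.setn 12 v) ∧
      (s'.nvar 12 = 1 ↔ (rowOf n s N).R i = (rowOf n s r).R i))
    (Runs.of_run rfl (Nat.le_of_ble_eq_true rfl) ?_) fun s₂ _ h₂ => ?_).le ?_
  · have eN : s.rarr 6 (N * (n + 1) + i) = _ := rarr_eq_rowOf (by omega)
    have er : s.rarr 6 (r * (n + 1) + i) = _ := rarr_eq_rowOf (by omega)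
    by_cases h : (rowOf n s N).R i = (rowOf n s r).R i
    · simp only [Prog.run, cellR, NExp.eval, RExp.eval, BExp.eval_eqR, h₁, State.setn_nvar,
        State.setn_narr, State.setn_rarr]
      simp [hN, hr, hi5, hbN, hbr, eN, er, h]
      try exact ⟨1, rfl⟩
    · simp only [Prog.run, cellR, NExp.eval, RExp.eval, BExp.eval_eqR, h₁, State.setn_nvar,
        State.setn_narr, State.setn_rarr]
      simp [hN, hr, hi5, hbN, hbr, eN, er, h]
      exact ⟨0, by simp [State.setn]⟩
  · obtain ⟨⟨v, h₂⟩, hv⟩ := h₂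
    refine ((Runs.forP (N := n) (B := 80 * (n + 1) + 30)
      (fun k s' => s'.nvar 12 = 1 ↔ (rowOf n s N).R i = (rowOf n s r).R i ∧
        ∀ j < k, rep j ≤ hi → freeCount n rep (rowOf n s N) (rep j)
          = freeCount n rep (rowOf n s r) (rep j))
      rfl ?_ ?_ ?_)).mono (by simp only [NExp.cost]; omega) fun s' _ h => h
    · intro s' hf
      simp [NExp.eval, hf.n 0 rfl, h₂, hn]
    · simpa using hv
    · intro k s' hk hf hx hP
      have f0 : s'.nvar 0 = n := by rw [hf.n 0 rfl, h₂]; simp [hn]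
      have f4 : s'.nvar 4 = N := by rw [hf.n 4 rfl, h₂]; simp [hN]
      have f11 : s'.nvar 11 = r := by rw [hf.n 11 rfl, h₂]; simp [hr]
      have f6 : s'.rvar 6 = hi := by rw [hf.r 6 rfl, h₂]; exact hhi
      have g1 : s'.narr 1 = s.narr 1 := by rw [hf.na 1 rfl, h₂]; rfl
      have g2 : s'.narr 2 = s.narr 2 := by rw [hf.na 2 rfl, h₂]; rfl
      have g4 : s'.rarr 4 = rep := by rw [hf.ra 4 rfl, h₂]; exact hrep
      have g6 : s'.rarr 6 = s.rarr 6 := by rw [hf.ra 6 rfl, h₂]; rfl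
      have g7 : s'.rarr 7 = s.rarr 7 := by rw [hf.ra 7 rfl, h₂]; rfl
      have hrow : rowOf n s' = rowOf n s := rowOf_congr g1 g6 g7
      refine (countFree_runs f0 g4 f4 f11 hx (by rw [g2, hbN]) (by rw [g2, hbr])).seq
        fun s₃ hf₃ ⟨h15, h16⟩ => Runs.of_run rfl (Nat.le_of_ble_eq_true rfl) ?_
      rw [hrow] at h15 h16
      have e12 : s₃.nvar 12 = s'.nvar 12 := hf₃.n 12 rfl
      have e13 : s₃.nvar 13 = k := (hf₃.n 13 rfl).trans hx
      have e4 : s₃.rarr 4 = rep := (hf₃.ra 4 rfl).trans g4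
      have e6 : s₃.rvar 6 = hi := (hf₃.r 6 rfl).trans f6
      have hstep : (∀ j < k + 1, rep j ≤ hi → freeCount n rep (rowOf n s N) (rep j)
          = freeCount n rep (rowOf n s r) (rep j)) ↔ (∀ j < k, rep j ≤ hi →
          freeCount n rep (rowOf n s N) (rep j) = freeCount n rep (rowOf n s r) (rep j)) ∧
          (rep k ≤ hi → freeCount n rep (rowOf n s N) (rep k)
            = freeCount n rep (rowOf n s r) (rep k)) := by
        constructor
        · exact fun h => ⟨fun j hj => h j (by omega), h k (by omega)⟩
        · rintro ⟨h, h'⟩ j hj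
          rcases Nat.lt_succ_iff_lt_or_eq.1 hj with h1 | rfl
          · exact h j h1
          · exact h'
      rw [hstep, ← and_assoc, ← hP]
      by_cases h1 : rep k ≤ hi <;>
        by_cases h2 : freeCount n rep (rowOf n s N) (rep k) = freeCount n rep (rowOf n s r) (rep k) <;>
        simp [Prog.run, BExp.eval, NExp.eval, RExp.eval, e12, e13, e4, e6, h15, h16, h1, h2]
  · have h1 : n * (80 * (n + 1) + 30 + 1 + 8) ≤ (n + 1) * (119 * (n + 1)) :=
      Nat.mul_le_mul (by omega) (by omega)
    have h2 : (n + 1) * (119 * (n + 1)) = 119 * (n + 1) ^ 2 := by ring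
    have h3 : 1 ≤ (n + 1) ^ 2 := Nat.one_le_pow _ _ (by omega)
    omega

/-- The positions of the rows up to number `N` in the tables. -/
def BaseOk (n : ℕ) (s : State) (N : ℕ) : Prop := ∀ r ≤ N, s.narr 2 r = r * (n + 1)

theorem insertRow_runs (hn : s.nvar 0 = n) (hrep : s.rarr 4 = rep) (hN : s.nvar 4 = N)
    (hhi : s.rvar 6 = hi) (hi5 : s.nvar 5 = i) (hin : i ≤ n) (hb : BaseOk n s N) :
    Runs insertRow s (400 * ((n + 1) ^ 2 * (N + 1))) fun s' =>
      BaseOk n s' (s'.nvar 4) ∧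
      Inserted (SameKey n rep hi i) (rowOf n s) N (rowOf n s N) (rowOf n s') (s'.nvar 4) := by
  unfold insertRow
  refine (Runs.seq (B₁ := 2) (Q₁ := fun s' => s' = s.setn 22 N)
    (B₂ := N * (200 * (n + 1) ^ 2 + 15 + 1 + 8) + 10 + (100 * (n + 1)))
    (Runs.of_run rfl le_rfl (by simp [Prog.run, NExp.eval, hN])) fun s₁ _ h₁ => Runs.seq
    (B₁ := N * (200 * (n + 1) ^ 2 + 15 + 1 + 8) + 10)
    -- The value `N` in variable 22 says that no row with the same key was found.
    (Q₁ := fun s' => (s'.nvar 22 = N ∧ ∀ r < N, ¬ SameKey n rep hi i (rowOf n s N) (rowOf n s r)) ∨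
      (s'.nvar 22 < N ∧ SameKey n rep hi i (rowOf n s N) (rowOf n s (s'.nvar 22)))) ?_
      fun s₂ hf₂ h₂ => ?_).le ?_
  · refine ((Runs.forP (N := N) (B := 200 * (n + 1) ^ 2 + 15)
      (fun k s' =>
        (s'.nvar 22 = N ∧ ∀ r < k, ¬ SameKey n rep hi i (rowOf n s N) (rowOf n s r)) ∨
        (s'.nvar 22 < N ∧ SameKey n rep hi i (rowOf n s N) (rowOf n s (s'.nvar 22))))
      rfl ?_ ?_ ?_)).mono (by simp only [NExp.cost]; omega) fun s' _ h => h
    · intro s' hf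
      simp [NExp.eval, hf.n 4 rfl, h₁, hN]
    · simp [h₁]
    · intro k s' hk hf hx hP
      have f0 : s'.nvar 0 = n := by rw [hf.n 0 rfl, h₁]; simp [hn]
      have f4 : s'.nvar 4 = N := by rw [hf.n 4 rfl, h₁]; simp [hN]
      have f5 : s'.nvar 5 = i := by rw [hf.n 5 rfl, h₁]; simp [hi5]
      have f6 : s'.rvar 6 = hi := by rw [hf.r 6 rfl, h₁]; exact hhi
      have g1 : s'.narr 1 = s.narr 1 := by rw [hf.na 1 rfl, h₁]; rfl
      have g2 : s'.narr 2 = s.narr 2 := by rw [hf.na 2 rfl, h₁]; rfl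
      have g4 : s'.rarr 4 = rep := by rw [hf.ra 4 rfl, h₁]; exact hrep
      have g6 : s'.rarr 6 = s.rarr 6 := by rw [hf.ra 6 rfl, h₁]; rfl
      have g7 : s'.rarr 7 = s.rarr 7 := by rw [hf.ra 7 rfl, h₁]; rfl
      have hrow : rowOf n s' = rowOf n s := rowOf_congr g1 g6 g7
      refine (testKey_runs f0 g4 f4 hx f6 f5 hin (by rw [g2, hb N le_rfl])
        (by rw [g2, hb k hk.le])).seq fun s₃ hf₃ h12 => Runs.of_run rfl (Nat.le_of_ble_eq_true rfl) ?_
      rw [hrow] at h12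
      have e22 : s₃.nvar 22 = s'.nvar 22 := hf₃.n 22 rfl
      have e11 : s₃.nvar 11 = k := (hf₃.n 11 rfl).trans hx
      by_cases h : s₃.nvar 12 = 1
      · simp only [Prog.run, BExp.eval_eqN, NExp.eval, h, if_true]
        right
        simp [e11]
        exact ⟨hk, h12.1 h⟩
      · simp only [Prog.run, BExp.eval_eqN, NExp.eval, h, if_false]
        simp only [State.setn_nvar, e22, show (22 : ℕ) ≠ 11 by decide, if_false]
        refine hP.imp_left fun ⟨h1, h2⟩ => ⟨h1, fun r hr => ?_⟩
        rcases Nat.lt_succ_iff_lt_or_eq.1 hr with h3 | rfl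
        · exact h2 r h3
        · exact fun h4 => h (h12.2 h4)
  · have e0 : s₂.nvar 0 = n := by rw [hf₂.n 0 rfl, h₁]; simp [hn]
    have e4 : s₂.nvar 4 = N := by rw [hf₂.n 4 rfl, h₁]; simp [hN]
    have g1 : s₂.narr 1 = s.narr 1 := by rw [hf₂.na 1 rfl, h₁]; rfl
    have g2 : s₂.narr 2 = s.narr 2 := by rw [hf₂.na 2 rfl, h₁]; rfl
    have g6 : s₂.rarr 6 = s.rarr 6 := by rw [hf₂.ra 6 rfl, h₁]; rfl
    have g7 : s₂.rarr 7 = s.rarr 7 := by rw [hf₂.ra 7 rfl, h₁]; rfl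
    have hrow : rowOf n s₂ = rowOf n s := rowOf_congr g1 g6 g7
    refine (Runs.cond (B := 80 * (n + 1)) (fun hlt => ?_) (fun hge => ?_)).le
      (by simp only [BExp.ltN, BExp.cost, NExp.cost]; omega)
    · simp only [BExp.eval_ltN, NExp.eval, e4] at hlt
      have hE := h₂.resolve_left fun h => by omega
      obtain ⟨r₂, hr₂⟩ : ∃ r₂, r₂ = s₂.nvar 22 := ⟨_, rfl⟩
      rw [← hr₂] at hE hlt
      refine (Runs.cond (B := 60 * (n + 1)) (fun hF => ?_) (fun hF => ?_)).le
        (by simp only [BExp.ltR, BExp.cost, NExp.cost, RExp.cost]; omega)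
      · simp only [BExp.eval_ltR, NExp.eval, RExp.eval, e4, ← hr₂, F_eq_rowOf (n := n), hrow] at hF
        refine (copyRow_runs (by decide) (by decide) e0 e4 hr₂.symm (by rw [g2, hb N le_rfl])
          (by rw [g2, hb r₂ hlt.le])).mono le_rfl fun s₃ hf₃ h₃ => ?_
        have k4 : s₃.nvar 4 = N := (hf₃.n 4 rfl).trans e4
        rw [k4, h₃, hrow]
        refine ⟨fun r hr => by rw [hf₃.na 2 rfl, g2, hb r hr], Or.inl ⟨rfl, r₂, hlt, hE.2,
          Or.inl ⟨hF, fun r _ => ?_⟩⟩⟩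
        simp [Function.update_apply]
      · simp only [BExp.eval_ltR, NExp.eval, RExp.eval, e4, ← hr₂, F_eq_rowOf (n := n), hrow,
          not_lt] at hF
        refine Runs.of_run rfl (by simp only [Prog.time]; omega) ?_
        simp only [Prog.run, e4, hrow]
        exact ⟨fun r hr => by rw [g2, hb r hr], Or.inl ⟨rfl, r₂, hlt, hE.2,
          Or.inr ⟨hF, fun r _ => rfl⟩⟩⟩
    · simp only [BExp.eval_ltN, NExp.eval, e4] at hge
      have hE := h₂.resolve_right fun h => hge h.1
      refine Runs.of_run rfl (by simp only [Prog.time, NExp.cost]; omega) ?_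
      simp only [Prog.run, NExp.eval, e4, e0, g2, hb N le_rfl, State.putn_nvar, State.setn_nvar,
        if_true, rowOf_setn]
      refine ⟨fun r hr => ?_, Or.inr ⟨rfl, hE.2, fun r hr => ?_⟩⟩
      · simp only [State.setn_narr, State.putn_narr, true_and]
        split_ifs with h
        · subst h; ring
        · rw [g2, hb r (by omega)]
      · have : rowOf n (s₂.putn 2 (N + 1) (N * (n + 1) + n + 1)) = rowOf n s := by
          rw [← hrow]
          exact rowOf_congr (by funext k; simp) rfl rfl
        rw [this]
        split_ifs with h
        · rw [h]
        · rfl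
  · have h1 : n + 1 ≤ (n + 1) ^ 2 := Nat.le_self_pow (by omega) _
    have h2 : N * (200 * (n + 1) ^ 2 + 15 + 1 + 8) ≤ N * (224 * (n + 1) ^ 2) :=
      Nat.mul_le_mul le_rfl (by omega)
    have h3 : N * (224 * (n + 1) ^ 2) = 224 * (N * (n + 1) ^ 2) := by ring
    have h4 : (n + 1) ^ 2 * (N + 1) = N * (n + 1) ^ 2 + (n + 1) ^ 2 := by ring
    omega

end

end MatchUp


/-! ### Correctness of children, events and stages. -/

namespace MatchUp

open Finset RealRAM

/-- The choice of the current bin `i`. -/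
def PickBin (i : ℕ) (_ : ℝ) (y : Row) (b : ℕ) (f : ℝ) : Prop := b = i ∧ f = y.F

/-- The choice of a bin that is not full, if there is one. -/
def PickFluid (n : ℕ) (z : ℝ) (y : Row) (b : ℕ) (f : ℝ) : Prop :=
  f = max (y.F - z) 0 ∧ ((b < n ∧ 0 < y.R b) ∨ (b = n ∧ ∀ k < n, y.R k ≤ 0))

/-- The program `pick` finds a target as described by `Pick`. -/
def PickSpec (n : ℕ) (rep : ℕ → ℝ) (i : ℕ) (pick : Prog) (Pick : ℝ → Row → ℕ → ℝ → Prop) : Prop :=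
  -- The first conjunct keeps the write set of `pick` computable, so that frame conditions still
  -- reduce to `rfl` after a case split.
  (pick = pickBin ∨ pick = pickFluid) ∧ (∀ z y b f, Pick z y b f → b ≤ n) ∧
  ∀ (s : State) (N j : ℕ), s.nvar 0 = n → s.rarr 4 = rep → s.nvar 4 = N → s.nvar 5 = i →
    s.nvar 6 = j → s.narr 2 N = N * (n + 1) →
    Runs pick s (100 * (n + 1)) fun s' => ∃ f, Pick (rep j) (rowOf n s N) (s'.nvar 8) f ∧
      rowOf n s' = Function.update (rowOf n s) N { rowOf n s N with F := f }

/-- Row `N` is scratch space and changes while a child is built. Insertion depends only on the rows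
before it. -/
theorem Inserted.congr {E : Row → Row → Prop} {rows₁ rows₂ rows' : ℕ → Row} {N N' : ℕ} {c : Row}
    (h : Inserted E rows₁ N c rows' N') (he : ∀ r < N, rows₁ r = rows₂ r) :
    Inserted E rows₂ N c rows' N' := by
  rcases h with ⟨h1, r₂, hr₂, hE, h2⟩ | ⟨h1, h2, h3⟩
  · refine Or.inl ⟨h1, r₂, hr₂, by rwa [← he r₂ hr₂], ?_⟩
    rw [← he r₂ hr₂]
    exact h2.imp (fun ⟨h3, h4⟩ => ⟨h3, fun r hr => by rw [h4 r hr, he r hr]⟩)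
      (fun ⟨h3, h4⟩ => ⟨h3, fun r hr => by rw [h4 r hr, he r hr]⟩)
  · refine Or.inr ⟨h1, fun r hr => by rw [← he r hr]; exact h2 r hr, fun r hr => ?_⟩
    rw [h3 r hr]
    split_ifs with h
    · rfl
    · exact he r (by omega)

section

variable {n N i j : ℕ} {s : State} {rep : ℕ → ℝ} {hi : ℝ} {pick : Prog}
  {Pick : ℝ → Row → ℕ → ℝ → Prop}

theorem pickBin_spec (hin : i ≤ n) : PickSpec n rep i pickBin (PickBin i) := by
  refine ⟨Or.inl rfl, fun z y b f h => h.1 ▸ hin, fun s N j _ _ _ h5 _ _ => ?_⟩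
  refine Runs.of_run rfl (by simp only [pickBin, Prog.time, NExp.cost]; omega) ?_
  refine ⟨_, ⟨?_, rfl⟩, ?_⟩
  · simp [pickBin, Prog.run, NExp.eval, h5]
  · exact (Function.update_eq_self _ _).symm

theorem pickFluid_spec : PickSpec n rep i pickFluid (PickFluid n) := by
  refine ⟨Or.inr rfl, ?_, fun s N j hn hrep hN _ hj hbN => ?_⟩
  · rintro z y b f ⟨-, ⟨h, -⟩ | ⟨h, -⟩⟩ <;> omega
  unfold pickFluid
  set f := max ((rowOf n s N).F - rep j) 0 with hf
  have hput : ∀ a b : ℝ, (s.putr 7 N a).putr 7 N b = s.putr 7 N b := by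
    intro a b; simp [State.putr]
  refine (Runs.seq (B₁ := 10) (Q₁ := fun s' => s' = s.putr 7 N ((rowOf n s N).F - rep j))
    (Runs.of_run rfl (Nat.le_of_ble_eq_true rfl) ?_) fun s₁ _ h₁ => Runs.seq (B₁ := 20)
    (Q₁ := fun s' => s' = s.putr 7 N f) (Runs.of_run rfl (Nat.le_of_ble_eq_true rfl) ?_)
    fun s₂ _ h₂ => Runs.seq (B₁ := 2) (Q₁ := fun s' => s' = (s.putr 7 N f).setn 8 n)
    (Runs.of_run rfl le_rfl ?_) fun s₃ _ h₃ =>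
    ((Runs.forP (N := n) (B := 30)
      (fun k s' => (s'.nvar 8 < n ∧ 0 < (rowOf n s N).R (s'.nvar 8)) ∨
        (s'.nvar 8 = n ∧ ∀ m < k, (rowOf n s N).R m ≤ 0))
      rfl ?_ ?_ ?_)).mono le_rfl fun s' hf' h => ⟨f, ⟨rfl, h⟩, ?_⟩).le ?_
  · simp [Prog.run, NExp.eval, RExp.eval, hN, hj, hrep, rowOf]
  · rw [h₁]
    simp only [Prog.run, BExp.eval_ltR, NExp.eval, RExp.eval, State.putr_nvar, State.putr_rarr, hN,
      and_self, if_true, Rat.cast_zero, hput]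
    split_ifs with h
    · rw [hf, max_eq_right h.le]
    · rw [hf, max_eq_left (not_lt.1 h)]
  · rw [h₂]; simp [Prog.run, NExp.eval, hn]
  · intro s' hf'
    simp [NExp.eval, hf'.n 0 rfl, h₃, hn]
  · simp [h₃]
  · intro k s' hk hf' hx hP
    have f4 : s'.nvar 4 = N := by rw [hf'.n 4 rfl, h₃]; simp [hN]
    have g2 : s'.narr 2 = s.narr 2 := by rw [hf'.na 2 rfl, h₃]; rfl
    have g6 : s'.rarr 6 = s.rarr 6 := by rw [hf'.ra 6 rfl, h₃]; funext k; simp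
    have eN : s.rarr 6 (N * (n + 1) + k) = _ := rarr_eq_rowOf (by omega)
    refine Runs.of_run rfl (Nat.le_of_ble_eq_true rfl) ?_
    simp only [Prog.run, BExp.eval_ltR, cellR, NExp.eval, RExp.eval, f4, g2, g6, hbN, hx, eN,
      Rat.cast_zero]
    by_cases h : 0 < (rowOf n s N).R k
    · simp only [h, if_true]
      left
      simp [hk, h]
    · simp only [h, if_false]
      simp only [State.setn_nvar, show (8 : ℕ) ≠ 10 by decide, if_false]
      refine hP.imp_right fun ⟨h1, h2⟩ => ⟨h1, fun m hm => ?_⟩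
      rcases Nat.lt_succ_iff_lt_or_eq.1 hm with h3 | rfl
      · exact h2 m h3
      · exact not_lt.1 h
  · simp only [NExp.cost]; omega
  · rw [← rowOf_putF]
    exact (rowOf_congr (hf'.na 1 rfl) (hf'.ra 6 rfl) (hf'.ra 7 rfl)).trans (by rw [h₃]; rfl)

/-- The child is assembled in row `N`, just behind the list. Insertion either copies it over a row
with the same key, or discards it, or makes it permanent by increasing the number of rows. -/
theorem child_runs {r : ℕ} (hp : PickSpec n rep i pick Pick) (hn : s.nvar 0 = n)
    (hrep : s.rarr 4 = rep) (hN : s.nvar 4 = N) (hhi : s.rvar 6 = hi) (hi5 : s.nvar 5 = i)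
    (hin : i ≤ n) (hj : s.nvar 6 = j) (hr : s.nvar 7 = r) (hrN : r < N) (hb : BaseOk n s N) :
    Runs (child pick) s (800 * ((n + 1) ^ 2 * (N + 1))) fun s' =>
      BaseOk n s' (s'.nvar 4) ∧
      ChildRel n rep hi i Pick (rep j) (rowOf n s) N r (rowOf n s') (s'.nvar 4) := by
  unfold child
  obtain ⟨hp1, hp2, hp3⟩ := hp
  set y := rowOf n s r with hy
  refine (Runs.seq (B₂ := 2 + ((n * 60 + 10) + (10 + (100 * (n + 1) + (20 + (50 +
      400 * ((n + 1) ^ 2 * (N + 1)))) + 1))))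
    (copyRow_runs (by decide) (by decide) hn hr hN (hb r hrN.le) (hb N le_rfl))
    fun s₁ hf₁ h₁ => Runs.seq (B₁ := 2) (Q₁ := fun s' => s' = s₁.setn 9 n)
    (Runs.of_run rfl le_rfl (by simp [Prog.run, NExp.eval, hf₁.n 0 rfl, hn])) fun s₂ hf₂ h₂ =>
    Runs.seq (B₁ := n * 60 + 10) (Q₁ := fun s' =>
      (s'.nvar 9 < n ∧ rep (s'.nvar 9) = rep j ∧ y.A (s'.nvar 9) = 0) ∨
        (s'.nvar 9 = n ∧ ∀ m < n, rep m = rep j → y.A m ≠ 0))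
      (((Runs.forP (N := n) (B := 51) (fun k s' =>
        (s'.nvar 9 < n ∧ rep (s'.nvar 9) = rep j ∧ y.A (s'.nvar 9) = 0) ∨
        (s'.nvar 9 = n ∧ ∀ m < k, rep m = rep j → y.A m ≠ 0))
      rfl ?_ ?_ ?_)).mono (by simp only [NExp.cost]; omega) fun s' _ h => h)
      fun s₃ hf₃ h₃ => ?_).le ?_
  · intro s' hf
    simp [NExp.eval, hf.n 0 rfl, h₂, hf₁.n 0 rfl, hn]
  · simp [h₂]
  · intro k s' hk hf hx hP
    have f4 : s'.nvar 4 = N := by rw [hf.n 4 rfl, h₂]; simp [hf₁.n 4 rfl, hN]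
    have f6 : s'.nvar 6 = j := by rw [hf.n 6 rfl, h₂]; simp [hf₁.n 6 rfl, hj]
    have g2 : s'.narr 2 = s.narr 2 := by rw [hf.na 2 rfl, h₂]; simp [hf₁.na 2 rfl]
    have g1 : s'.narr 1 = s₁.narr 1 := by rw [hf.na 1 rfl, h₂]; rfl
    have g4 : s'.rarr 4 = rep := by rw [hf.ra 4 rfl, h₂]; simp [hf₁.ra 4 rfl, hrep]
    have eN : s₁.narr 1 (N * (n + 1) + k) = y.A k := by
      rw [narr_eq_rowOf (by omega), h₁, Function.update_self]
    refine Runs.of_run rfl (Nat.le_of_ble_eq_true rfl) ?_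
    simp only [Prog.run, BExp.eval, BExp.eval_eqR, BExp.eval_eqN, cellA, NExp.eval, RExp.eval, f4,
      f6, g1, g2, g4, hb N le_rfl, hx, eN]
    by_cases h : rep k = rep j ∧ y.A k = 0
    · rw [if_pos h]
      left
      simp [hk, h]
    · rw [if_neg h]
      simp only [State.setn_nvar, show (9 : ℕ) ≠ 10 by decide, if_false]
      refine hP.imp_right fun ⟨h1, h2⟩ => ⟨h1, fun m hm h4 h5 => ?_⟩
      rcases Nat.lt_succ_iff_lt_or_eq.1 hm with h3 | rfl
      · exact h2 m h3 h4 h5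
      · exact h ⟨h4, h5⟩
  · have e0 : s₃.nvar 0 = n := by rw [hf₃.n 0 rfl, h₂]; simp [hf₁.n 0 rfl, hn]
    have e4 : s₃.nvar 4 = N := by rw [hf₃.n 4 rfl, h₂]; simp [hf₁.n 4 rfl, hN]
    have e5 : s₃.nvar 5 = i := by rw [hf₃.n 5 rfl, h₂]; simp [hf₁.n 5 rfl, hi5]
    have e6 : s₃.nvar 6 = j := by rw [hf₃.n 6 rfl, h₂]; simp [hf₁.n 6 rfl, hj]
    have ehi : s₃.rvar 6 = hi := by rw [hf₃.r 6 rfl, h₂]; simp [hf₁.r 6 rfl, hhi]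
    have g2 : s₃.narr 2 = s.narr 2 := by rw [hf₃.na 2 rfl, h₂]; simp [hf₁.na 2 rfl]
    have g4 : s₃.rarr 4 = rep := by rw [hf₃.ra 4 rfl, h₂]; simp [hf₁.ra 4 rfl, hrep]
    have hrow : rowOf n s₃ = Function.update (rowOf n s) N y := by
      rw [← h₁]
      exact (rowOf_congr (hf₃.na 1 rfl) (hf₃.ra 6 rfl) (hf₃.ra 7 rfl)).trans (by rw [h₂]; rfl)
    refine (Runs.cond (B := 100 * (n + 1) + (20 + (50 +
      400 * ((n + 1) ^ 2 * (N + 1)))) + 1) (fun hlt => ?_) (fun hge => ?_)).le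
      (by simp only [BExp.ltN, BExp.cost, NExp.cost]; omega)
    · simp only [BExp.eval_ltN, NExp.eval, e0] at hlt
      obtain ⟨-, hk2, hk3⟩ := h₃.resolve_right fun h => by omega
      obtain ⟨k, hk⟩ : ∃ k, k = s₃.nvar 9 := ⟨_, rfl⟩
      rw [← hk] at hlt hk2 hk3
      refine (Runs.seq (B₂ := 20 + (50 + 400 * ((n + 1) ^ 2 * (N + 1))))
        (hp3 s₃ N j e0 g4 e4 e5 e6 (by rw [g2, hb N le_rfl]))
        fun s₄ hf₄ ⟨f, hf, h₄⟩ => ?_).le (by omega)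
      rw [hrow, Function.update_self, Function.update_idem] at h₄
      rw [hrow, Function.update_self] at hf
      have k0 : s₄.nvar 0 = n :=
        (hf₄.n 0 (by rcases hp1 with rfl | rfl <;> rfl)).trans e0
      have k4 : s₄.nvar 4 = N :=
        (hf₄.n 4 (by rcases hp1 with rfl | rfl <;> rfl)).trans e4
      have k5 : s₄.nvar 5 = i :=
        (hf₄.n 5 (by rcases hp1 with rfl | rfl <;> rfl)).trans e5
      have k6 : s₄.nvar 6 = j :=
        (hf₄.n 6 (by rcases hp1 with rfl | rfl <;> rfl)).trans e6
      have k9 : s₄.nvar 9 = k :=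
        (hf₄.n 9 (by rcases hp1 with rfl | rfl <;> rfl)).trans hk.symm
      have khi : s₄.rvar 6 = hi :=
        (hf₄.r 6 (by rcases hp1 with rfl | rfl <;> rfl)).trans ehi
      have kg2 : s₄.narr 2 = s.narr 2 :=
        (hf₄.na 2 (by rcases hp1 with rfl | rfl <;> rfl)).trans g2
      have kg4 : s₄.rarr 4 = rep :=
        (hf₄.ra 4 (by rcases hp1 with rfl | rfl <;> rfl)).trans g4
      obtain ⟨b, hbb⟩ : ∃ b, b = s₄.nvar 8 := ⟨_, rfl⟩
      rw [← hbb] at hf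
      have hbn := hp2 _ _ _ _ hf
      refine Runs.seq (B₁ := 20) (Q₁ := fun s' => s' = s₄.putn 1 (N * (n + 1) + k) (b + 1))
        (Runs.of_run rfl (Nat.le_of_ble_eq_true rfl) (by
          simp [Prog.run, NExp.eval, k4, kg2, k9, hb N le_rfl, hbb])) fun s₅ hf₅ h₅ => ?_
      have r₅ : rowOf n s₅ = Function.update (rowOf n s) N
          ⟨Function.update y.A k (b + 1), y.R, f⟩ := by
        rw [h₅, rowOf_putA _ _ _ (by omega), h₄]
        simp
      refine Runs.seq (B₁ := 50) (Q₁ := fun s' => rowOf n s' = Function.update (rowOf n s) N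
          (y.put n (rep j) k b f)) (Runs.of_run rfl (Nat.le_of_ble_eq_true rfl) ?_)
          fun s₆ hf₆ h₆ => ?_
      · have l0 : s₅.nvar 0 = n := (hf₅.n 0 rfl).trans k0
        have l4 : s₅.nvar 4 = N := (hf₅.n 4 rfl).trans k4
        have l6 : s₅.nvar 6 = j := (hf₅.n 6 rfl).trans k6
        have l8 : s₅.nvar 8 = b := (hf₅.n 8 rfl).trans hbb.symm
        have lg2 : s₅.narr 2 = s.narr 2 := (hf₅.na 2 rfl).trans kg2
        have lg4 : s₅.rarr 4 = rep := (hf₅.ra 4 rfl).trans kg4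
        simp only [Prog.run, BExp.eval_ltN, NExp.eval, l0, l8]
        split_ifs with hbn'
        · have eN : s₅.rarr 6 (N * (n + 1) + b) = y.R b := by
            rw [rarr_eq_rowOf (by omega), r₅, Function.update_self]
          simp only [cellR, NExp.eval, RExp.eval, l4, l6, l8, lg2, lg4, hb N le_rfl, eN]
          rw [rowOf_putR _ _ _ (by omega), r₅]
          simp [Row.put, hbn']
        · rw [r₅]; simp [Row.put, hbn']
      · have hfr := hf₅.seq_left (d := .cond (.ltN (.var 8) (.var 0))
          (.storeR 6 (.add (.cell 2 (.var 4)) (.var 8)) (.sub (cellR 4 8) (.cell 4 (.var 6))))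
          .skip) |>.trans hf₆.seq_right
        have l4 := (hfr.n 4 rfl).trans k4
        have lg2 := (hfr.na 2 rfl).trans kg2
        refine (insertRow_runs ((hfr.n 0 rfl).trans k0) ((hfr.ra 4 rfl).trans kg4) l4
          ((hfr.r 6 rfl).trans khi) ((hfr.n 5 rfl).trans k5) hin
          (fun r hr => by rw [lg2, hb r hr])).mono le_rfl fun s₇ _ ⟨hb', hins⟩ => ⟨hb', Or.inr
            ⟨k, hlt, hk2, hk3, b, f, hf, ?_⟩⟩
        rw [h₆, Function.update_self] at hins
        exact hins.congr fun r hr => Function.update_of_ne (by omega) _ _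
    · simp only [BExp.eval_ltN, NExp.eval, e0] at hge
      obtain ⟨-, hno⟩ := h₃.resolve_left fun h => hge h.1
      refine Runs.of_run rfl (by simp only [Prog.time]; omega) ?_
      simp only [Prog.run, e4, hrow]
      exact ⟨fun r hr => by rw [g2, hb r hr], Or.inl ⟨hno, rfl, fun r hr =>
        Function.update_of_ne (by omega) _ _⟩⟩
  · have h1 : n + 1 ≤ (n + 1) ^ 2 * (N + 1) :=
      (Nat.le_self_pow (by omega) _).trans (Nat.le_mul_of_pos_right _ (by omega))
    omega

/-- The time bound needs a bound on the number of rows in every intermediate state. `hcard` supplies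
it from validity and distinctness of keys alone, both of which are part of the invariant. -/
theorem event_runs {V : Row → Prop} {nρ nf : ℝ → ℝ → ℝ} {lo shi : ℝ} {rows₀ : ℕ → Row} {N₀ Nm : ℕ}
    (hp : PickSpec n rep i pick Pick)
    (hP : PickOk n rep hi i V Pick nρ nf j) (hjn : j < n) (hz : rep j ≤ hi)
    (hcard : ∀ rows N, (∀ r < N, V (rows r)) → Distinct n rep hi i N₀ rows N → N ≤ Nm)
    (hn : s.nvar 0 = n) (hrep : s.rarr 4 = rep) (hhi : s.rvar 6 = hi)
    (hi5 : s.nvar 5 = i) (hin : i ≤ n) (hj : s.nvar 6 = j) (hb : BaseOk n s (s.nvar 4))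
    (hinv : StageInv n rep hi i V nρ nf lo shi rows₀ N₀ j (rowOf n s) (s.nvar 4)) :
    Runs (event pick) s (900 * ((n + 1) ^ 2 * (Nm + 1) ^ 2)) fun s' => BaseOk n s' (s'.nvar 4) ∧
      StageInv n rep hi i V nρ nf lo shi rows₀ N₀ (j + 1) (rowOf n s') (s'.nvar 4) := by
  unfold event
  obtain ⟨N, hN⟩ : ∃ N, s.nvar 4 = N := ⟨_, rfl⟩
  have hNm : N ≤ Nm := hcard _ _ (hN ▸ hinv.valid) (hN ▸ hinv.distinct)
  have hp1 := hp.1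
  -- Variable 21 freezes the number of rows, so that children inserted during the event do not have
  -- children of their own.
  refine (Runs.seq (B₁ := 2) (Q₁ := fun s' => s' = s.setn 21 N)
    (Runs.of_run rfl le_rfl (by simp [Prog.run, NExp.eval, hN])) fun s₁ _ h₁ =>
    (Runs.forP (N := N) (B := 800 * ((n + 1) ^ 2 * (Nm + 1)))
      (fun k s' => BaseOk n s' (s'.nvar 4) ∧
        EventInv n rep hi i V nρ nf j N₀ (rowOf n s) N k (rowOf n s') (s'.nvar 4))
      (by rcases hp1 with rfl | rfl <;> rfl) ?_ ?_ ?_).mono le_rfl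
      fun s' hf ⟨hb', h'⟩ => ⟨hb', hinv.step (hN.symm ▸ h')⟩).le ?_
  · intro s' hf
    simp [NExp.eval, hf.n 21 (by rcases hp1 with rfl | rfl <;> rfl), h₁]
  · rw [h₁]
    exact ⟨hb, hN ▸ EventInv.init hinv⟩
  · intro k s' hk hf hx ⟨hb', hE⟩
    have hN' : s'.nvar 4 ≤ Nm := hcard _ _ hE.valid hE.distinct
    refine (child_runs (r := k) (N := s'.nvar 4) (hi := hi) (j := j) hp
      ((hf.n 0 (by rcases hp1 with rfl | rfl <;> rfl)).trans (by rw [h₁]; simp [hn]))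
      ((hf.ra 4 (by rcases hp1 with rfl | rfl <;> rfl)).trans (by rw [h₁]; simp [hrep])) rfl
      ((hf.r 6 (by rcases hp1 with rfl | rfl <;> rfl)).trans (by rw [h₁]; simp [hhi]))
      ((hf.n 5 (by rcases hp1 with rfl | rfl <;> rfl)).trans (by rw [h₁]; simp [hi5])) hin
      ((hf.n 6 (by rcases hp1 with rfl | rfl <;> rfl)).trans (by rw [h₁]; simp [hj]))
      hx (hk.trans_le hE.le) hb').mono (by gcongr) fun s'' _ ⟨hb'', hc⟩ => ?_
    exact ⟨hb'', hE.step hP hjn hz hk hc⟩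
  · have h1 : N * (800 * ((n + 1) ^ 2 * (Nm + 1)) + 1 + 8) ≤
        (Nm + 1) * (809 * ((n + 1) ^ 2 * (Nm + 1))) := by
      have : 1 ≤ (n + 1) ^ 2 * (Nm + 1) := Nat.mul_pos (by positivity) (by positivity)
      exact Nat.mul_le_mul (by omega) (by omega)
    have h2 : (Nm + 1) * (809 * ((n + 1) ^ 2 * (Nm + 1))) = 809 * ((n + 1) ^ 2 * (Nm + 1) ^ 2) := by
      ring
    have h3 : 1 ≤ (n + 1) ^ 2 * (Nm + 1) ^ 2 := Nat.mul_pos (by positivity) (by positivity)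
    simp only [NExp.cost]
    omega

theorem stage_runs {V : Row → Prop} {nρ nf : ℝ → ℝ → ℝ} {lo shi : ℝ} {rows₀ : ℕ → Row} {N₀ Nm : ℕ}
    (hp : PickSpec n rep i pick Pick)
    (hP : ∀ j < n, lo ≤ rep j → rep j ≤ shi → PickOk n rep hi i V Pick nρ nf j) (hshi : shi ≤ hi)
    (hcard : ∀ rows N, (∀ r < N, V (rows r)) → Distinct n rep hi i N₀ rows N → N ≤ Nm)
    (hn : s.nvar 0 = n) (hrep : s.rarr 4 = rep) (hhi : s.rvar 6 = hi) (hlo : s.rvar 5 = lo)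
    (hs : s.rvar 10 = shi) (hi5 : s.nvar 5 = i) (hin : i ≤ n) (hb : BaseOk n s (s.nvar 4))
    (hinv : StageInv n rep hi i V nρ nf lo shi rows₀ N₀ 0 (rowOf n s) (s.nvar 4)) :
    Runs (stage pick) s (1000 * ((n + 1) ^ 3 * (Nm + 1) ^ 2)) fun s' => BaseOk n s' (s'.nvar 4) ∧
      StageInv n rep hi i V nρ nf lo shi rows₀ N₀ n (rowOf n s') (s'.nvar 4) := by
  unfold stage
  have hp1 := hp.1
  refine (Runs.forP (N := n) (B := 20 + 900 * ((n + 1) ^ 2 * (Nm + 1) ^ 2))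
      (fun k s' => BaseOk n s' (s'.nvar 4) ∧
        StageInv n rep hi i V nρ nf lo shi rows₀ N₀ k (rowOf n s') (s'.nvar 4))
      (by rcases hp1 with rfl | rfl <;> rfl) ?_ (by exact ⟨hb, hinv⟩) ?_).le ?_
  · intro s' hf
    simp [NExp.eval, hf.n 0 (by rcases hp1 with rfl | rfl <;> rfl), hn]
  · intro k s' hk hf hx ⟨hb', hE⟩
    have g4 := (hf.ra 4 (by rcases hp1 with rfl | rfl <;> rfl)).trans hrep
    have f5 := (hf.r 5 (by rcases hp1 with rfl | rfl <;> rfl)).trans hlo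
    have f10 := (hf.r 10 (by rcases hp1 with rfl | rfl <;> rfl)).trans hs
    have h3 : 1 ≤ (n + 1) ^ 2 * (Nm + 1) ^ 2 := Nat.mul_pos (by positivity) (by positivity)
    refine (Runs.cond (B := 900 * ((n + 1) ^ 2 * (Nm + 1) ^ 2)) (fun h => ?_) (fun h => ?_)).le
      (by simp only [BExp.cost, NExp.cost, RExp.cost]; omega)
    · simp only [BExp.eval, RExp.eval, NExp.eval, hx, g4, f5, f10] at h
      exact event_runs hp (hP k hk h.1 h.2) hk (h.2.trans hshi) hcard
        ((hf.n 0 (by rcases hp1 with rfl | rfl <;> rfl)).trans hn) g4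
        ((hf.r 6 (by rcases hp1 with rfl | rfl <;> rfl)).trans hhi)
        ((hf.n 5 (by rcases hp1 with rfl | rfl <;> rfl)).trans hi5) hin hx hb' hE
    · simp only [BExp.eval, RExp.eval, NExp.eval, hx, g4, f5, f10] at h
      exact Runs.of_run rfl (by simp only [Prog.time]; omega) ⟨hb', hE.skip h⟩
  · have h3 : 1 ≤ (n + 1) ^ 2 * (Nm + 1) ^ 2 := Nat.mul_pos (by positivity) (by positivity)
    have h1 : n * (20 + 900 * ((n + 1) ^ 2 * (Nm + 1) ^ 2) + 1 + 8) ≤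
        (n + 1) * (929 * ((n + 1) ^ 2 * (Nm + 1) ^ 2)) := Nat.mul_le_mul (by omega) (by omega)
    have h2 : (n + 1) * (929 * ((n + 1) ^ 2 * (Nm + 1) ^ 2))
        = 929 * ((n + 1) ^ 3 * (Nm + 1) ^ 2) := by ring
    have h4 : 1 ≤ (n + 1) ^ 3 * (Nm + 1) ^ 2 := Nat.mul_pos (by positivity) (by positivity)
    simp only [NExp.cost]
    omega

end

end MatchUp


/-! ### Validity of rows and the transitions between stages. -/

namespace MatchUp

open Finset

/-- The invariant of partial solutions: `P` is the set of bins that have been opened, and `Q` the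
set of bins whose remaining capacities are counted in the total. -/
structure Valid (n : ℕ) (rep g : ℕ → ℝ) (ε a : ℝ) (P Q : Finset ℕ) (y : Row) : Prop where
  act : ∀ j < n, y.A j ≠ 0 → a ≤ rep j
  cap : ∀ i ∈ P, y.R i = g i - load (range n) y.A rep i
  zero : ∀ i ≤ n, i ∉ P → y.R i = 0
  none : ∀ i < n, i ∉ P → ∀ j < n, y.A j ≠ i + 1
  -- Pouring lowers `F` by the full size of the item even if part of it overfills a bin. The
  -- allowance `ε * g i` for each full bin compensates this.
  sum : ∑ i ∈ Q, (max 0 (y.R i) - if y.R i ≤ 0 then ε * g i else 0) ≤ y.F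

theorem load_update {n k b : ℕ} {A : ℕ → ℕ} {rep : ℕ → ℝ} (hk : k < n) (hA : A k = 0) (i : ℕ) :
    load (range n) (Function.update A k (b + 1)) rep i
      = load (range n) A rep i + if i = b then rep k else 0 := by
  unfold load
  by_cases h : i = b
  · subst h
    have : ({j ∈ range n | Function.update A k (i + 1) j = i + 1} : Finset ℕ)
        = insert k {j ∈ range n | A j = i + 1} := by
      ext j
      by_cases hj : j = k
      · subst hj; simp [hk]
      · simp [hj]
    rw [this, Finset.sum_insert (by simp [hA]), if_pos rfl, add_comm]
  · rw [if_neg h, add_zero]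
    refine Finset.sum_congr ?_ fun _ _ => rfl
    ext j
    by_cases hj : j = k
    · subst hj; simp [hA, Ne.symm h]
    · simp [hj]

theorem load_insert {W : Finset ℕ} {k : ℕ} {X : ℕ → ℕ} {rep : ℕ → ℝ} (hk : k ∉ W) (i : ℕ) :
    load (insert k W) X rep i = load W X rep i + if X k = i + 1 then rep k else 0 := by
  unfold load
  rw [Finset.filter_insert]
  split_ifs with h
  · rw [Finset.sum_insert (by simp [hk]), add_comm]
  · rw [add_zero]

section

variable {n : ℕ} {rep lev g : ℕ → ℝ} {ε a hi shi : ℝ} {P Q : Finset ℕ} {i : ℕ}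

/-- The current bin is not yet counted in `F`, so filling it leaves the inequality for `F`
unchanged. Overfilling is allowed. -/
theorem pickOk_bin (hin : i < n) (hiQ : i ∉ Q) {j : ℕ} (ha : a ≤ rep j) (hz : rep j ≤ hi) :
    PickOk n rep hi i
      (fun y => Valid n rep g ε a (insert i Q) Q y ∧ ∀ j < n, y.A j = i + 1 → rep j ≤ hi)
      (PickBin i) (fun z ρ => ρ - z) (fun _ f => f) j := by
  refine ⟨?_, ?_, ?_⟩
  · rintro y k b f ⟨hV, hw⟩ hk hkj hA ⟨rfl, rfl⟩
    refine ⟨⟨fun m hm h => ?_, fun i' hi' => ?_, fun i' hi' h => ?_, fun i' hi' h m hm => ?_, ?_⟩,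
      fun m hm h => ?_⟩
    · by_cases hmk : m = k
      · rw [hmk, hkj]; exact ha
      · exact hV.act m hm (by simpa [Row.put, hmk] using h)
    · simp only [Row.put, if_pos hin]
      rw [load_update hk hA, Function.update_apply, hkj]
      split_ifs with h
      · rw [h, hV.cap b (mem_insert_self _ _)]; ring
      · rw [hV.cap i' hi', add_zero]
    · have hb : i' ≠ b := fun e => h (e ▸ mem_insert_self _ _)
      simpa [Row.put, hin, hb] using hV.zero i' hi' h
    · have hb : i' ≠ b := fun e => h (e ▸ mem_insert_self _ _)
      by_cases hmk : m = k
      · simp [Row.put, hmk, Ne.symm hb]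
      · simpa [Row.put, hmk] using hV.none i' hi' h m hm
    · refine le_trans (le_of_eq (Finset.sum_congr rfl fun i' hi' => ?_)) hV.sum
      have hb : i' ≠ b := fun e => hiQ (e ▸ hi')
      simp [Row.put, hin, hb]
    · by_cases hmk : m = k
      · rw [hmk, hkj]; exact hz
      · exact hw m hm (by simpa [Row.put, hmk] using h)
  · rintro y k b f - ⟨rfl, rfl⟩
    simp [Row.put, hin]
  · rintro y b f f₁ - ⟨rfl, rfl⟩ h
    exact h

/-- An item of size `a` is at most `ε * g b` for every opened bin. If it goes to a bin with room,
the left side of the inequality for `F` drops by at least `a`, either as ordinary capacity or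
through the allowance that a bin receives once it is full. If all bins are full, the left side is at
most 0 and the item may go nowhere. -/
theorem pickOk_fluid (ha0 : 0 < a) (hQ : Q ⊆ range n) (hg : ∀ b ∈ Q, a ≤ ε * g b)
    {j : ℕ} (ha : rep j = a) :
    PickOk n rep hi n (fun y => Valid n rep g ε a Q Q y)
      (PickFluid n) (fun _ ρ => ρ) (fun z f => max (f - z) 0) j := by
  refine ⟨?_, ?_, ?_⟩
  · rintro y k b f hV hk hkj hA ⟨rfl, hb⟩
    -- Bins that are not open have remaining capacity 0 and are never chosen, so the choice of a bin
    -- with room needs no list of opened bins.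
    have hb' : ∀ i' < n, i' ∉ Q → i' ≠ b := by
      rintro i' hi' h rfl
      rcases hb with ⟨_, h2⟩ | ⟨h1, _⟩
      · rw [hV.zero i' hi'.le h] at h2; exact lt_irrefl _ h2
      · omega
    refine ⟨fun m hm h => ?_, fun i' hi' => ?_, fun i' hi' h => ?_, fun i' hi' h m hm => ?_, ?_⟩
    · by_cases hmk : m = k
      · rw [hmk, hkj]; exact ha.ge
      · exact hV.act m hm (by simpa [Row.put, hmk] using h)
    · simp only [Row.put]
      rw [load_update hk hA, hkj]
      have := mem_range.1 (hQ hi')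
      split_ifs with h1 h2 h2
      · rw [h2, Function.update_self, hV.cap b (h2 ▸ hi')]; ring
      · rw [Function.update_of_ne h2, hV.cap i' hi', add_zero]
      · omega
      · rw [hV.cap i' hi', add_zero]
    · rcases hi'.lt_or_eq with h1 | rfl
      · have := hb' i' h1 h
        have h2 := hV.zero i' hi' h
        simp only [Row.put]
        split_ifs
        · rwa [Function.update_of_ne this]
        · exact h2
      · have h2 := hV.zero i' hi' h
        simp only [Row.put]
        split_ifs with h3
        · rwa [Function.update_of_ne (by omega)]
        · exact h2
    · by_cases hmk : m = k
      · simp [Row.put, hmk, Ne.symm (hb' i' hi' h)]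
      · simpa [Row.put, hmk] using hV.none i' hi' h m hm
    · rcases hb with ⟨hbn, hb⟩ | ⟨rfl, hb⟩
      · have hbQ : b ∈ Q := by
          by_contra hc
          exact hb' b hbn hc rfl
        have h1 := hV.sum
        rw [← Finset.add_sum_erase _ _ hbQ] at h1 ⊢
        have h2 : ∀ i' ∈ Q.erase b, (y.put n (rep j) k b (max (y.F - rep j) 0)).R i' = y.R i' :=
          fun i' hi' => by simp [Row.put, hbn, Finset.ne_of_mem_erase hi']
        rw [Finset.sum_congr rfl fun i' hi' => by rw [h2 i' hi']]
        have h3 : (y.put n (rep j) k b (max (y.F - rep j) 0)).R b = y.R b - rep j := by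
          simp [Row.put, hbn]
        have h4 : (y.put n (rep j) k b (max (y.F - rep j) 0)).F = max (y.F - rep j) 0 := rfl
        rw [h3, h4]
        -- If the bin becomes full, its term changes from `R b` to `-ε * g b`, and `-ε * g b ≤ -a ≤
        -- R b - a`.
        rw [if_neg (not_le.2 hb), max_eq_right hb.le] at h1
        refine le_trans ?_ (le_max_left _ _)
        have := hg b hbQ
        split_ifs with h5
        · rw [max_eq_left h5]; linarith
        · rw [max_eq_right (not_le.1 h5).le]; linarith
      · refine le_trans (Finset.sum_nonpos fun i' hi' => ?_) (le_max_right _ _)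
        have h1 : (y.put b (rep j) k b (max (y.F - rep j) 0)).R i' = y.R i' := by simp [Row.put]
        have h2 := hb i' (mem_range.1 (hQ hi'))
        rw [h1, if_pos h2, max_eq_left h2]
        linarith [hg i' hi']
  · rintro y k b f - ⟨-, hb⟩
    rcases hb with ⟨hbn, -⟩ | ⟨rfl, -⟩
    · simp [Row.put, hbn, Nat.ne_of_gt hbn]
    · simp [Row.put]
  · rintro y b f f₁ - ⟨rfl, -⟩ h
    gcongr

/-- What holds between the stages: all rows are valid, and for every assignment `X` some row is as
good as the partial solution in which the items in `S X` have been moved as in `X`. -/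
structure LevelInv (n : ℕ) (rep g : ℕ → ℝ) (ε hi a : ℝ) (Q : Finset ℕ)
    (S : (ℕ → ℕ) → Finset ℕ) (rows : ℕ → Row) (N : ℕ) : Prop where
  valid : ∀ r < N, Valid n rep g ε a Q Q (rows r)
  covered : ∀ X, ∃ r < N, (∀ j < n, rep j ≤ hi →
    freeCount n rep (rows r) (rep j) = leftCount n rep (S X) (rep j)) ∧
    (rows r).F ≤ unused Q (S X) rep g X

theorem LevelInv.weaken {S : (ℕ → ℕ) → Finset ℕ} {rows : ℕ → Row} {N : ℕ} {hi' a' : ℝ}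
    (h : LevelInv n rep g ε hi a Q S rows N) (ha : a' ≤ a) (hh : hi' ≤ hi) :
    LevelInv n rep g ε hi' a' Q S rows N := by
  refine ⟨fun r hr => ?_, fun X => ?_⟩
  · have := h.valid r hr
    exact ⟨fun j hj hA => ha.trans (this.act j hj hA), this.cap, this.zero, this.none, this.sum⟩
  · obtain ⟨r, hr, h1, h2⟩ := h.covered X
    exact ⟨r, hr, fun j hj hz => h1 j hj (hz.trans hh), h2⟩

/-- No item is in bin `i` yet, neither in the rows nor among the moved items of `X`, so on both
sides the remaining capacity is the whole gap. -/
theorem LevelInv.openBin {S : (ℕ → ℕ) → Finset ℕ} {rows rows' : ℕ → Row} {N : ℕ}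
    (h : LevelInv n rep g ε hi a Q S rows N) (hin : i < n) (hiQ : i ∉ Q)
    (hS : ∀ X, ∀ j ∈ S X, X j ≠ i + 1)
    (hr : ∀ r < N, rows' r = { rows r with R := Function.update (rows r).R i (g i) }) :
    (∀ r < N, Valid n rep g ε a (insert i Q) Q (rows' r) ∧
      ∀ j < n, (rows' r).A j = i + 1 → rep j ≤ hi) ∧
    ∀ X, Covered n rep hi i rows' N (S X) (g i - load (S X) X rep i)
      (unused Q (S X) rep g X) := by
  refine ⟨fun r h1 => ?_, fun X => ?_⟩
  · have hV := h.valid r h1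
    have hi0 := hV.none i hin hiQ
    rw [hr r h1]
    refine ⟨⟨hV.act, fun i' hi' => ?_, fun i' hi' h2 => ?_, fun i' hi' h2 => ?_, ?_⟩,
      fun j hj h2 => absurd h2 (hi0 j hj)⟩
    · by_cases h2 : i' = i
      · subst h2
        simp only [Function.update_self]
        have : load (range n) (rows r).A rep i' = 0 := by
          unfold load
          rw [Finset.filter_false_of_mem fun j hj => hi0 j (mem_range.1 hj), Finset.sum_empty]
        rw [this, sub_zero]
      · simp only [Function.update_of_ne h2]
        exact hV.cap i' (Finset.mem_of_mem_insert_of_ne hi' h2)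
    · have h3 : i' ≠ i := fun e => h2 (e ▸ mem_insert_self _ _)
      simp only [Function.update_of_ne h3]
      exact hV.zero i' hi' fun h4 => h2 (mem_insert_of_mem h4)
    · exact hV.none i' hi' fun h4 => h2 (mem_insert_of_mem h4)
    · refine le_trans (le_of_eq (Finset.sum_congr rfl fun i' hi' => ?_)) hV.sum
      have h3 : i' ≠ i := fun e => hiQ (e ▸ hi')
      simp only [Function.update_of_ne h3]
  · obtain ⟨r, h1, h2, h3⟩ := h.covered X
    refine ⟨r, h1, ?_⟩
    rw [hr r h1]
    refine ⟨h2, ?_, h3⟩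
    have : load (S X) X rep i = 0 := by
      unfold load
      rw [Finset.filter_false_of_mem fun j hj => hS X j hj, Finset.sum_empty]
    simp [this]

/-- Apply the stage invariant to the items that `X` puts into bin `i`. Equality of the remaining
capacities means that closing adds the same amount to `F` as to the unused gap of `X`; the other
bins are unaffected. -/
theorem LevelInv.closeBin {S T : (ℕ → ℕ) → Finset ℕ} {rows₀ rows rows' : ℕ → Row} {N₀ N : ℕ}
    (hiQ : i ∉ Q) (hg : 0 ≤ ε * g i)
    (h : StageInv n rep hi i
      (fun y => Valid n rep g ε a (insert i Q) Q y ∧ ∀ j < n, y.A j = i + 1 → rep j ≤ hi)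
      (fun z ρ => ρ - z) (fun _ f => f) a hi rows₀ N₀ n rows N)
    (hc : ∀ X, Covered n rep hi i rows₀ N₀ (S X) (g i - load (S X) X rep i)
      (unused Q (S X) rep g X))
    (hT : ∀ X, ∀ j ∈ T X, j < n ∧ X j = i + 1 ∧ a ≤ rep j ∧ rep j ≤ hi)
    (hS : ∀ X, ∀ j ∈ S X, X j ≠ i + 1)
    (hr : ∀ r < N, rows' r = { rows r with F := (rows r).F + max 0 ((rows r).R i) }) :
    LevelInv n rep g ε hi a (insert i Q) (fun X => S X ∪ T X) rows' N := by
  refine ⟨fun r h1 => ?_, fun X => ?_⟩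
  · have hV := (h.valid r h1).1
    rw [hr r h1]
    refine ⟨hV.act, hV.cap, hV.zero, hV.none, ?_⟩
    rw [Finset.sum_insert hiQ]
    have h2 : (if (rows r).R i ≤ 0 then ε * g i else 0) ≥ 0 := by split_ifs <;> simp [hg]
    have h3 := hV.sum
    simp only
    linarith
  · have hd : Disjoint (S X) (T X) :=
      Finset.disjoint_left.2 fun j hj hj' => hS X j hj (hT X j hj').2.1
    obtain ⟨r, h1, h2, h3, h4⟩ := h.covered (S X) (T X) (fun W => g i - load W X rep i)
      (fun _ => unused Q (S X) rep g X) hd (fun j hj => by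
        obtain ⟨t1, t2, t3, t4⟩ := hT X j hj
        refine ⟨t1, t3, t4, fun W hW => ⟨?_, le_rfl⟩⟩
        rw [load_insert hW, if_pos t2]; ring) (hc X)
    have hTn : ({j ∈ T X | j < n} : Finset ℕ) = T X :=
      Finset.filter_true_of_mem fun j hj => (hT X j hj).1
    rw [hTn] at h2 h3
    refine ⟨r, h1, ?_⟩
    rw [hr r h1]
    refine ⟨h2, ?_⟩
    simp only
    unfold unused
    rw [Finset.sum_insert hiQ, h3, add_comm]
    gcongr
    refine h4.trans (le_of_eq ?_)
    refine Finset.sum_congr rfl fun i' hi' => ?_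
    have : load (S X ∪ T X) X rep i' = load (S X) X rep i' := by
      unfold load
      refine Finset.sum_congr ?_ fun _ _ => rfl
      ext j
      simp only [mem_filter, mem_union]
      constructor
      · rintro ⟨h5 | h5, h6⟩
        · exact ⟨h5, h6⟩
        · have := (hT X j h5).2.1
          have : i = i' := by omega
          exact absurd (this ▸ hi') hiQ
      · rintro ⟨h5, h6⟩; exact ⟨Or.inl h5, h6⟩
    rw [this]

/-- An item lies in at most one bin, so moving it lowers the unused gap by at most its size. Hence
pouring lowers `F` at least as much as any `X` can lower its unused gap. -/
theorem unused_insert_ge {Q W : Finset ℕ} {X : ℕ → ℕ} {j : ℕ} (hj : j ∉ W) (h0 : 0 ≤ rep j) :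
    max (unused Q W rep g X - rep j) 0 ≤ unused Q (insert j W) rep g X := by
  refine max_le ?_ (Finset.sum_nonneg fun _ _ => le_max_left _ _)
  have h1 : ∑ i ∈ Q, (if X j = i + 1 then rep j else 0) ≤ rep j := by
    by_cases h : ∃ i ∈ Q, X j = i + 1
    · obtain ⟨i, hi, he⟩ := h
      rw [Finset.sum_eq_single i]
      · rw [if_pos he]
      · intro i' _ hne
        exact if_neg (by omega)
      · intro h; exact absurd hi h
    · rw [Finset.sum_eq_zero]
      · exact h0
      · intro i hi
        exact if_neg fun he => h ⟨i, hi, he⟩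
  have h2 : unused Q W rep g X - ∑ i ∈ Q, (if X j = i + 1 then rep j else 0)
      ≤ unused Q (insert j W) rep g X := by
    unfold unused
    rw [← Finset.sum_sub_distrib]
    refine Finset.sum_le_sum fun i _ => ?_
    rw [load_insert hj]
    have : (0 : ℝ) ≤ if X j = i + 1 then rep j else 0 := by split_ifs <;> simp [h0]
    rcases le_total (g i - load W X rep i) 0 with h | h
    · rw [max_eq_left h]
      linarith [le_max_left 0 (g i - (load W X rep i + if X j = i + 1 then rep j else 0))]
    · rw [max_eq_right h]
      linarith [le_max_right 0 (g i - (load W X rep i + if X j = i + 1 then rep j else 0))]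
  linarith

/-- While fluid items are poured, the current bin is the dummy column `n`, whose capacity is always
0. The same notion of key thus serves both kinds of stage. -/
theorem LevelInv.startFluid {S : (ℕ → ℕ) → Finset ℕ} {rows : ℕ → Row} {N : ℕ}
    (h : LevelInv n rep g ε hi a Q S rows N) (hQ : Q ⊆ range n) (X : ℕ → ℕ) :
    Covered n rep hi n rows N (S X) 0 (unused Q (S X) rep g X) := by
  obtain ⟨r, h1, h2, h3⟩ := h.covered X
  exact ⟨r, h1, h2, (h.valid r h1).zero n le_rfl fun hc => by simpa using hQ hc, h3⟩

theorem LevelInv.endFluid {S T : (ℕ → ℕ) → Finset ℕ} {rows₀ rows : ℕ → Row} {N₀ N : ℕ} (ha : 0 ≤ a)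
    (h : StageInv n rep hi n (fun y => Valid n rep g ε a Q Q y)
      (fun _ ρ => ρ) (fun z f => max (f - z) 0) a a rows₀ N₀ n rows N)
    (hc : ∀ X, Covered n rep hi n rows₀ N₀ (S X) 0 (unused Q (S X) rep g X))
    (hT : ∀ X, ∀ j ∈ T X, j < n ∧ rep j = a ∧ j ∉ S X) :
    LevelInv n rep g ε hi a Q (fun X => S X ∪ T X) rows N := by
  refine ⟨h.valid, fun X => ?_⟩
  have hd : Disjoint (S X) (T X) := Finset.disjoint_left.2 fun j hj hj' => (hT X j hj').2.2 hj
  obtain ⟨r, h1, h2, h3, h4⟩ := h.covered (S X) (T X) (fun _ => 0)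
    (fun W => unused Q W rep g X) hd (fun j hj => by
      obtain ⟨t1, t2, t3⟩ := hT X j hj
      exact ⟨t1, t2.ge, t2.le, fun W hW => ⟨rfl, unused_insert_ge hW (t2 ▸ ha)⟩⟩) (hc X)
  have hTn : ({j ∈ T X | j < n} : Finset ℕ) = T X :=
    Finset.filter_true_of_mem fun j hj => (hT X j hj).1
  rw [hTn] at h2 h4
  exact ⟨r, h1, h2, h4⟩

/-- Bin `i` contains only items of window sizes, so its load, and with it `R i`, is determined by
the number of its items of each size. -/
theorem card_bin {rows : ℕ → Row} {N Nst : ℕ} {Z : Finset ℝ}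
    (hZ : ∀ j < n, a ≤ rep j → rep j ≤ hi → rep j ∈ Z)
    (hV : ∀ r < N, Valid n rep g ε a (insert i Q) Q (rows r) ∧
      ∀ j < n, (rows r).A j = i + 1 → rep j ≤ hi)
    (hd : Distinct n rep hi i Nst rows N) : N ≤ Nst + (n + 1) ^ (2 * Z.card) := by
  refine card_le_of_distinct hZ (fun r hr => (hV r hr).1.act) (fun r hr r' hr' _ _ he => ?_) hd
  have key : ∀ r < N, load (range n) (rows r).A rep i
      = ∑ z ∈ Z, (#{j ∈ range n | rep j = z ∧ (rows r).A j = i + 1} : ℝ) * z := by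
    intro r hr
    unfold load
    rw [← Finset.sum_fiberwise_of_maps_to (g := rep) (t := Z)]
    · refine Finset.sum_congr rfl fun z _ => ?_
      rw [Finset.sum_congr rfl (g := fun _ => z) fun j hj => (mem_filter.1 hj).2, Finset.sum_const,
        nsmul_eq_mul, Finset.filter_filter]
      congr 3
      ext j
      simp only [mem_filter]
      tauto
    · intro j hj
      simp only [mem_filter, mem_range] at hj
      refine hZ j hj.1 ((hV r hr).1.act j hj.1 (by omega)) ((hV r hr).2 j hj.1 hj.2)
  rw [(hV r hr).1.cap i (mem_insert_self _ _), (hV r' hr').1.cap i (mem_insert_self _ _),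
    key r hr, key r' hr', Finset.sum_congr rfl fun z hz => by rw [he z hz]]

theorem card_fluid {rows : ℕ → Row} {N Nst : ℕ} {Z : Finset ℝ} (hQ : Q ⊆ range n)
    (hZ : ∀ j < n, a ≤ rep j → rep j ≤ hi → rep j ∈ Z)
    (hV : ∀ r < N, Valid n rep g ε a Q Q (rows r))
    (hd : Distinct n rep hi n Nst rows N) : N ≤ Nst + (n + 1) ^ (2 * Z.card) := by
  have hn : n ∉ Q := fun hc => by simpa using hQ hc
  refine card_le_of_distinct hZ (fun r hr => (hV r hr).act) (fun r hr r' hr' _ _ _ => ?_) hd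
  rw [(hV r hr).zero n le_rfl hn, (hV r' hr').zero n le_rfl hn]

end

end MatchUp


/-! ### One level of the dynamic program. -/

namespace MatchUp

open Finset RealRAM

section

variable {n i : ℕ} {s : State} {rep lev g : ℕ → ℝ} {ε δ a hi : ℝ} {Q : Finset ℕ}

theorem openRows_runs {N : ℕ} (hin : i < n) (hN : s.nvar 4 = N) (hi5 : s.nvar 5 = i)
    (hg : s.rarr 2 i - s.rarr 3 i = g i) (hb : BaseOk n s N) :
    Runs (forP 7 (.var 4) (.storeR 6 (.add (.cell 2 (.var 7)) (.var 5))
      (.sub (.cell 2 (.var 5)) (.cell 3 (.var 5))))) s (40 * (N + 1)) fun s' =>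
      ∀ r, rowOf n s' r = if r < N then
        { rowOf n s r with R := Function.update (rowOf n s r).R i (g i) } else rowOf n s r := by
  refine (Runs.forP (N := N) (B := 20) (fun k s' => ∀ r, rowOf n s' r = if r < k then
        { rowOf n s r with R := Function.update (rowOf n s r).R i (g i) } else rowOf n s r)
    rfl ?_ ?_ ?_).le (by simp only [NExp.cost]; omega)
  · intro s' hf
    simp [NExp.eval, hf.n 4 rfl, hN]
  · intro r; simp
  · intro k s' hk hf hx hP
    have f5 : s'.nvar 5 = i := (hf.n 5 rfl).trans hi5
    have g2 : s'.narr 2 = s.narr 2 := hf.na 2 rfl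
    have h2 : s'.rarr 2 = s.rarr 2 := hf.ra 2 rfl
    have h3 : s'.rarr 3 = s.rarr 3 := hf.ra 3 rfl
    refine Runs.of_run rfl (Nat.le_of_ble_eq_true rfl) fun r => ?_
    simp only [Prog.run, NExp.eval, RExp.eval, hx, f5, g2, h2, h3, hg, hb k hk.le, rowOf_setn]
    rw [rowOf_putR _ _ _ (by omega), Function.update_apply]
    by_cases hr : r = k
    · subst hr
      rw [if_pos rfl, hP, if_neg (lt_irrefl _), if_pos (by omega)]
    · rw [if_neg hr, hP]
      simp only [show r < k + 1 ↔ r < k by omega]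

theorem closeRows_runs {N : ℕ} (hin : i < n) (hN : s.nvar 4 = N) (hi5 : s.nvar 5 = i)
    (hb : BaseOk n s N) :
    Runs (forP 7 (.var 4) (.cond (.ltR (.const 0) (cellR 7 5))
      (.storeR 7 (.var 7) (.add (.cell 7 (.var 7)) (cellR 7 5))) .skip)) s (60 * (N + 1)) fun s' =>
      ∀ r, rowOf n s' r = if r < N then
        { rowOf n s r with F := (rowOf n s r).F + max 0 ((rowOf n s r).R i) } else rowOf n s r := by
  refine (Runs.forP (N := N) (B := 40) (fun k s' => ∀ r, rowOf n s' r = if r < k then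
        { rowOf n s r with F := (rowOf n s r).F + max 0 ((rowOf n s r).R i) } else rowOf n s r)
    rfl ?_ ?_ ?_).le (by simp only [NExp.cost]; omega)
  · intro s' hf
    simp [NExp.eval, hf.n 4 rfl, hN]
  · intro r; simp
  · intro k s' hk hf hx hP
    have f5 : s'.nvar 5 = i := (hf.n 5 rfl).trans hi5
    have g2 : s'.narr 2 = s.narr 2 := hf.na 2 rfl
    have eR : (cellR 7 5).eval s' = (rowOf n s k).R i := by
      rw [eval_cellR (by rw [hx, g2, hb k hk.le]) f5 (by omega), hP, if_neg (lt_irrefl _)]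
    have eF : s'.rarr 7 k = (rowOf n s k).F := by
      rw [F_eq_rowOf (n := n), hP, if_neg (lt_irrefl _)]
    refine Runs.of_run rfl (Nat.le_of_ble_eq_true rfl) fun r => ?_
    simp only [Prog.run, BExp.eval_ltR, eR, NExp.eval, RExp.eval, hx, eF, rowOf_setn, Rat.cast_zero]
    by_cases hR : 0 < (rowOf n s k).R i
    · rw [if_pos hR, rowOf_putF, Function.update_apply]
      by_cases hr : r = k
      · subst hr
        rw [if_pos rfl, hP, if_neg (lt_irrefl _), if_pos (by omega), max_eq_right hR.le]
      · rw [if_neg hr, hP]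
        simp only [show r < k + 1 ↔ r < k by omega]
    · rw [if_neg hR, hP]
      by_cases hr : r = k
      · subst hr
        rw [if_neg (lt_irrefl _), if_pos (by omega), max_eq_left (not_lt.1 hR), add_zero]
      · simp only [show r < k + 1 ↔ r < k by omega]

theorem binStage_runs {S T : (ℕ → ℕ) → Finset ℕ} {Z : Finset ℝ} {Nm : ℕ} (hin : i < n)
    (hiQ : i ∉ Q) (hn : s.nvar 0 = n) (hrep : s.rarr 4 = rep) (hhi : s.rvar 6 = hi)
    (ha : s.rvar 5 = a) (hs : s.rvar 10 = hi) (hi5 : s.nvar 5 = i)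
    (hg : s.rarr 2 i - s.rarr 3 i = g i) (hg0 : 0 ≤ ε * g i) (hb : BaseOk n s (s.nvar 4))
    (hinv : LevelInv n rep g ε hi a Q S (rowOf n s) (s.nvar 4))
    (hT : ∀ X, ∀ j ∈ T X, j < n ∧ X j = i + 1 ∧ a ≤ rep j ∧ rep j ≤ hi)
    (hS : ∀ X, ∀ j ∈ S X, X j ≠ i + 1)
    (hZ : ∀ j < n, a ≤ rep j → rep j ≤ hi → rep j ∈ Z)
    (hNm : s.nvar 4 + (n + 1) ^ (2 * Z.card) ≤ Nm) :
    Runs binStage s (1200 * ((n + 1) ^ 3 * (Nm + 1) ^ 2)) fun s' => BaseOk n s' (s'.nvar 4) ∧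
      s'.nvar 4 ≤ s.nvar 4 + (n + 1) ^ (2 * Z.card) ∧
      LevelInv n rep g ε hi a (insert i Q) (fun X => S X ∪ T X) (rowOf n s') (s'.nvar 4) := by
  unfold binStage
  obtain ⟨N, hN⟩ : ∃ N, s.nvar 4 = N := ⟨_, rfl⟩
  rw [hN] at hNm hb hinv ⊢
  refine (Runs.seq (B₂ := 1000 * ((n + 1) ^ 3 * (Nm + 1) ^ 2) + 60 * (Nm + 1))
    (openRows_runs hin hN hi5 hg hb) fun s₁ hf₁ h₁ => ?_).le ?_
  · have e4 : s₁.nvar 4 = N := (hf₁.n 4 rfl).trans hN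
    have g2 : s₁.narr 2 = s.narr 2 := hf₁.na 2 rfl
    obtain ⟨hV, hC⟩ := hinv.openBin (rows' := rowOf n s₁) hin hiQ hS
      (fun r hr => by rw [h₁ r, if_pos hr])
    have hcard : ∀ rows N', (∀ r < N', Valid n rep g ε a (insert i Q) Q (rows r) ∧
        ∀ j < n, (rows r).A j = i + 1 → rep j ≤ hi) → Distinct n rep hi i N rows N' →
        N' ≤ N + (n + 1) ^ (2 * Z.card) := fun rows N' hV hd => card_bin hZ hV hd
    refine Runs.seq (stage_runs (hi := hi) (lo := a) (shi := hi) (N₀ := N) (rows₀ := rowOf n s₁)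
      (pickBin_spec hin.le)
      (fun j hj h1 h2 => pickOk_bin (ε := ε) (g := g) hin hiQ h1 h2) le_rfl
      (fun rows N' hV hd => (hcard rows N' hV hd).trans hNm)
      ((hf₁.n 0 rfl).trans hn) ((hf₁.ra 4 rfl).trans hrep)
      ((hf₁.r 6 rfl).trans hhi) ((hf₁.r 5 rfl).trans ha) ((hf₁.r 10 rfl).trans hs)
      ((hf₁.n 5 rfl).trans hi5) hin.le (by rw [e4]; exact fun r hr => by rw [g2, hb r hr])
      (by rw [e4]; exact StageInv.init hV)) fun s₂ hf₂ ⟨hb₂, h₂⟩ => ?_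
    have hN₂ := hcard _ _ h₂.valid h₂.distinct
    refine (closeRows_runs hin rfl ((hf₂.n 5 rfl).trans ((hf₁.n 5 rfl).trans hi5)) hb₂).mono
      (by omega) fun s₃ hf₃ h₃ => ?_
    have e4' : s₃.nvar 4 = s₂.nvar 4 := hf₃.n 4 rfl
    have g2' : s₃.narr 2 = s₂.narr 2 := hf₃.na 2 rfl
    rw [e4']
    exact ⟨fun r hr => by rw [g2', hb₂ r hr], hN₂, LevelInv.closeBin hiQ hg0 h₂ hC hT hS
      (fun r hr => by rw [h₃ r, if_pos hr])⟩
  · have h1 : Nm + 1 ≤ (n + 1) ^ 3 * (Nm + 1) ^ 2 :=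
      (Nat.le_self_pow (by omega) _).trans (Nat.le_mul_of_pos_left _ (by positivity))
    omega

/-- The relevant items with both the rounded size and the level of the bin above `a`. -/
noncomputable def moved (n : ℕ) (rep lev : ℕ → ℝ) (δ ε a : ℝ) (X : ℕ → ℕ) : Finset ℕ :=
  open Classical in {j ∈ kept n rep lev δ ε X | a < rep j ∧ a < lev (X j - 1)}

/-- The relevant items that are moved before bin `m` is treated on level `a`. -/
noncomputable def movedBins (n : ℕ) (rep lev : ℕ → ℝ) (δ ε a : ℝ) (m : ℕ) (X : ℕ → ℕ) : Finset ℕ :=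
  open Classical in moved n rep lev δ ε a X ∪
    {j ∈ kept n rep lev δ ε X | X j - 1 < m ∧ lev (X j - 1) = a ∧ a ≤ rep j}

/-- The bins that are opened before bin `m` is treated on level `a`. -/
noncomputable def openedBins (n : ℕ) (lev : ℕ → ℝ) (a : ℝ) (m : ℕ) : Finset ℕ :=
  open Classical in opened n lev a ∪ {i ∈ range m | lev i = a}

-- A relevant item of `X` is moved on the level of its bin if its size is at least that level, and
-- as a fluid item on the level of its own size otherwise. The two equivalences `hgr` and `hgl` say
-- that no grid value lies strictly between `a / (1 + ε)` and `a`, so the sets for the next level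
-- differ from the present ones exactly by what happens on level `a`. At most `n` bin stages and one
-- fluid stage account for the factor `n + 1` in the growth of the list.
set_option maxHeartbeats 1000000 in
theorem levelBody_runs {Z : Finset ℝ} {Nm : ℕ} (hn : s.nvar 0 = n) (hrep : s.rarr 4 = rep)
    (hlev : s.rarr 5 = lev) (hε : s.rvar 0 = ε) (ha : s.rvar 5 = a) (ha0 : 0 < a) (hε0 : 0 < ε)
    (hg : ∀ i < n, s.rarr 2 i - s.rarr 3 i = g i) (hlg : ∀ i < n, a ≤ lev i → a ≤ ε * g i)
    (hb : BaseOk n s (s.nvar 4))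
    (hgr : ∀ j < n, a / (1 + ε) < rep j ↔ a ≤ rep j)
    (hgl : ∀ i < n, a / (1 + ε) < lev i ↔ a ≤ lev i)
    (hinv : LevelInv n rep g ε (a / (ε * ε)) a (opened n lev a) (moved n rep lev δ ε a) (rowOf n s)
      (s.nvar 4))
    (hZ : ∀ j < n, a ≤ rep j → rep j ≤ a / (ε * ε) → rep j ∈ Z) (hε1 : ε ≤ 1)
    (hNm : s.nvar 4 + (n + 1) * (n + 1) ^ (2 * Z.card) ≤ Nm) :
    Runs levelBody s (3000 * ((n + 1) ^ 4 * (Nm + 1) ^ 2)) fun s' => BaseOk n s' (s'.nvar 4) ∧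
      s'.nvar 4 ≤ s.nvar 4 + (n + 1) * (n + 1) ^ (2 * Z.card) ∧ s'.rvar 5 = a / (1 + ε) ∧
      LevelInv n rep g ε (a / (1 + ε) / (ε * ε)) (a / (1 + ε)) (opened n lev (a / (1 + ε)))
        (moved n rep lev δ ε (a / (1 + ε))) (rowOf n s') (s'.nvar 4) := by
  unfold levelBody
  set K := (n + 1) ^ (2 * Z.card) with hK
  obtain ⟨N, hN⟩ : ∃ N, s.nvar 4 = N := ⟨_, rfl⟩
  rw [hN] at hNm hb hinv ⊢
  set hi := a / (ε * ε) with hhi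
  have hahi : a ≤ hi := by
    rw [hhi, le_div_iff₀ (by positivity)]
    exact mul_le_of_le_one_right ha0.le (mul_le_one₀ hε1 hε0.le hε1)
  set U := (n + 1) ^ 3 * (Nm + 1) ^ 2 with hU
  have hU1 : 1 ≤ U := Nat.mul_pos (by positivity) (by positivity)
  refine (Runs.seq (B₁ := 10) (Q₁ := fun s' => s' = s.setr 6 hi)
    (B₂ := 2 + ((n * (20 + 1200 * U + 1 + 8) + 1 + 6) + (2 + (2 + (1000 * U + 10)))))
    (Runs.of_run rfl (Nat.le_of_ble_eq_true rfl)
      (by simp [Prog.run, RExp.eval, ha, hε, hhi])) fun s₁ _ h₁ => Runs.seq (B₁ := 2)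
    (Q₁ := fun s' => s' = (s.setr 6 hi).setr 10 hi)
    (Runs.of_run rfl (Nat.le_of_ble_eq_true rfl)
      (by rw [h₁]; simp [Prog.run, RExp.eval])) fun s₂ _ h₂ => Runs.seq
    (Runs.forP (N := n) (B := 20 + 1200 * U) (fun k s' => BaseOk n s' (s'.nvar 4) ∧
      s'.nvar 4 ≤ N + k * K ∧ LevelInv n rep g ε hi a (openedBins n lev a k)
        (movedBins n rep lev δ ε a k) (rowOf n s') (s'.nvar 4))
      rfl ?_ ?_ ?_) fun s₃ hf₃ ⟨hb₃, hN₃, h₃⟩ => ?_).le ?_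
  · intro s' hf
    simp [NExp.eval, hf.n 0 rfl, h₂, hn]
  · rw [h₂]
    have e1 : openedBins n lev a 0 = opened n lev a := by ext; simp [openedBins]
    have e2 : movedBins n rep lev δ ε a 0 = moved n rep lev δ ε a := by
      funext X; ext; simp [movedBins]
    simp only [State.setn_nvar, State.setr_nvar, e1, e2, show (4 : ℕ) ≠ 5 by decide, if_false, hN]
    exact ⟨hb, by omega, hinv⟩
  · intro k s' hk hf hx ⟨hb', hN', hI⟩
    have f0 : s'.nvar 0 = n := (hf.n 0 rfl).trans (by rw [h₂]; simp [hn])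
    have f5 : s'.rvar 5 = a := (hf.r 5 rfl).trans (by rw [h₂]; simp [ha])
    have f6 : s'.rvar 6 = hi := (hf.r 6 rfl).trans (by rw [h₂]; simp)
    have f10 : s'.rvar 10 = hi := (hf.r 10 rfl).trans (by rw [h₂]; simp)
    have h2 : s'.rarr 2 = s.rarr 2 := (hf.ra 2 rfl).trans (by rw [h₂]; simp)
    have h3 : s'.rarr 3 = s.rarr 3 := (hf.ra 3 rfl).trans (by rw [h₂]; simp)
    have h4 : s'.rarr 4 = rep := (hf.ra 4 rfl).trans (by rw [h₂]; simp [hrep])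
    have h5 : s'.rarr 5 = lev := (hf.ra 5 rfl).trans (by rw [h₂]; simp [hlev])
    have hkK : k * K + K = (k + 1) * K := by ring
    have hkK' : (k + 1) * K ≤ (n + 1) * K := Nat.mul_le_mul (by omega) le_rfl
    refine (Runs.cond (B := 1200 * U) (fun h => ?_) (fun h => ?_)).le
      (by simp only [BExp.eqR, BExp.cost, NExp.cost, RExp.cost]; omega)
    · simp only [BExp.eval_eqR, RExp.eval, NExp.eval, hx, h5, f5] at h
      refine (binStage_runs (Nm := Nm) (ε := ε) (g := g) (Z := Z)
        (T := fun X => open Classical in {j ∈ kept n rep lev δ ε X | X j = k + 1 ∧ a ≤ rep j})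
        hk ?_ f0 h4 f6 f5 f10 hx (by rw [h2, h3, hg k hk]) (ha0.le.trans (hlg k hk h.ge)) hb' hI
        ?_ ?_ hZ (by omega)).mono le_rfl fun s'' _ ⟨hb'', hN'', hI''⟩ => ⟨hb'', ?_, ?_⟩
      · simp [openedBins, opened, h]
      · intro X j hj
        obtain ⟨hj1, hj2, hj3⟩ := mem_filter.1 hj
        obtain ⟨hj4, i', hi', hj5, _, _, hj6⟩ := mem_filter.1 hj1
        obtain rfl : i' = k := by omega
        -- This uses that `kept` excludes items larger than the level of their bin divided by `ε²`;
        -- all items that `X` puts into the bin and that matter lie in the window.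
        rw [h] at hj6
        exact ⟨mem_range.1 hj4, hj2, hj3, hj6⟩
      · intro X j hj hc
        simp only [movedBins, moved, mem_union, mem_filter, hc, Nat.add_sub_cancel] at hj
        rcases hj with hj | hj
        · linarith [hj.2.2]
        · omega
      · simp only [State.setn_nvar, show (4 : ℕ) ≠ 5 by decide, if_false]
        omega
      · simp only [State.setn_nvar, show (4 : ℕ) ≠ 5 by decide, if_false, rowOf_setn]
        convert hI'' using 1
        · ext i'
          simp only [openedBins, mem_union, mem_filter, mem_range, mem_insert]
          constructor
          · rintro (h6 | ⟨h6, h7⟩)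
            · exact Or.inr (Or.inl h6)
            · by_cases h8 : i' = k
              · exact Or.inl h8
              · exact Or.inr (Or.inr ⟨by omega, h7⟩)
          · rintro (rfl | h6 | h6)
            · exact Or.inr ⟨by omega, h⟩
            · exact Or.inl h6
            · exact Or.inr ⟨by omega, h6.2⟩
        · funext X
          ext j
          simp only [movedBins, mem_union, mem_filter, or_assoc]
          apply or_congr_right
          constructor
          · rintro ⟨h6, h7, h8, h9⟩
            by_cases h10 : X j - 1 = k
            · right
              obtain ⟨_, i', _, h11, _⟩ := mem_filter.1 h6
              exact ⟨h6, by omega, h9⟩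
            · left; exact ⟨h6, by omega, h8, h9⟩
          · rintro (⟨h6, h7, h8, h9⟩ | ⟨h6, h7, h8⟩)
            · exact ⟨h6, by omega, h8, h9⟩
            · rw [h7, Nat.add_sub_cancel]
              exact ⟨h6, by omega, h, h8⟩
    · simp only [BExp.eval_eqR, RExp.eval, NExp.eval, hx, h5, f5] at h
      refine Runs.of_run rfl (by simp only [Prog.time]; omega) ⟨hb', ?_, ?_⟩
      · simp only [Prog.run, State.setn_nvar, show (4 : ℕ) ≠ 5 by decide, if_false]
        omega
      · simp only [Prog.run, State.setn_nvar, show (4 : ℕ) ≠ 5 by decide, if_false, rowOf_setn]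
        convert hI using 1
        · ext i'
          simp only [openedBins, mem_union, mem_filter, mem_range]
          apply or_congr_right
          constructor
          · rintro ⟨h6, h7⟩
            have : i' ≠ k := fun e => h (e ▸ h7)
            exact ⟨by omega, h7⟩
          · rintro ⟨h6, h7⟩; exact ⟨by omega, h7⟩
        · funext X
          ext j
          simp only [movedBins, mem_union, mem_filter]
          apply or_congr_right
          constructor
          · rintro ⟨h6, h7, h8, h9⟩
            have : X j - 1 ≠ k := fun e => h (e ▸ h8)
            exact ⟨h6, by omega, h8, h9⟩
          · rintro ⟨h6, h7, h8, h9⟩; exact ⟨h6, by omega, h8, h9⟩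
  · have h1 : n * (20 + 1200 * U + 1 + 8) ≤ (n + 1) * (1229 * U) :=
      Nat.mul_le_mul (by omega) (by omega)
    have h2 : (n + 1) * (1229 * U) = 1229 * ((n + 1) * U) := by ring
    have h3 : (n + 1) ^ 4 * (Nm + 1) ^ 2 = (n + 1) * U := by rw [hU]; ring
    have h4 : U ≤ (n + 1) * U := Nat.le_mul_of_pos_left _ (by omega)
    omega
  · have f0 : s₃.nvar 0 = n := (hf₃.n 0 rfl).trans (by rw [h₂]; simp [hn])
    have fe : s₃.rvar 0 = ε := (hf₃.r 0 rfl).trans (by rw [h₂]; simp [hε])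
    have f5 : s₃.rvar 5 = a := (hf₃.r 5 rfl).trans (by rw [h₂]; simp [ha])
    have f6 : s₃.rvar 6 = hi := (hf₃.r 6 rfl).trans (by rw [h₂]; simp)
    have h4 : s₃.rarr 4 = rep := (hf₃.ra 4 rfl).trans (by rw [h₂]; simp [hrep])
    have hQn : openedBins n lev a n ⊆ range n := by
      intro i' hi'
      simp only [openedBins, opened, mem_union, mem_filter] at hi'
      tauto
    have hnK : n * K + K = (n + 1) * K := by ring
    refine Runs.seq (B₁ := 2) (Q₁ := fun s' => s' = s₃.setr 10 a)
      (Runs.of_run rfl le_rfl (by simp [Prog.run, RExp.eval, f5])) fun s₄ _ h₄ =>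
      Runs.seq (B₁ := 2) (Q₁ := fun s' => s' = (s₃.setr 10 a).setn 5 n)
      (Runs.of_run rfl le_rfl (by rw [h₄]; simp [Prog.run, NExp.eval, f0])) fun s₅ _ h₅ =>
      Runs.seq (stage_runs (hi := hi) (lo := a) (shi := a) (N₀ := s₃.nvar 4) (rows₀ := rowOf n s₃)
        (Nm := Nm) (rep := rep) (V := fun y => Valid n rep g ε a (openedBins n lev a n)
          (openedBins n lev a n) y) pickFluid_spec
        (fun j hj h1 h2 => pickOk_fluid ha0 hQn ?_ (le_antisymm h2 h1)) hahi ?_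
        (by rw [h₅]; simp [f0]) (by rw [h₅]; simp [h4]) (by rw [h₅]; simp [f6])
        (by rw [h₅]; simp [f5]) (by rw [h₅]; simp) (by rw [h₅]; simp) le_rfl
        (by rw [h₅]; exact hb₃) (by rw [h₅]; exact StageInv.init h₃.valid))
      fun s₆ hf₆ ⟨hb₆, h₆⟩ => Runs.of_run rfl (Nat.le_of_ble_eq_true rfl) ?_
    · intro b hbQ
      simp only [openedBins, opened, mem_union, mem_filter, mem_range] at hbQ
      rcases hbQ with h | h
      · exact hlg b h.1 h.2.le
      · exact hlg b h.1 h.2.ge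
    · intro rows N' hV hd
      have := card_fluid hQn hZ hV hd
      omega
    · have hN₆ := card_fluid hQn hZ h₆.valid h₆.distinct
      have e5 : s₆.rvar 5 = a := (hf₆.r 5 rfl).trans (by rw [h₅]; simp [f5])
      have e0 : s₆.rvar 0 = ε := (hf₆.r 0 rfl).trans (by rw [h₅]; simp [fe])
      simp only [Prog.run, RExp.eval, e5, e0, State.setr_nvar, State.setr_rvar, if_true,
        Rat.cast_one, rowOf_setr]
      refine ⟨hb₆, by omega, trivial, ?_⟩
      have hle : a / (1 + ε) ≤ a := div_le_self ha0.le (by linarith)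
      have h7 := LevelInv.endFluid (T := fun X => open Classical in
        {j ∈ kept n rep lev δ ε X | rep j = a ∧ a < lev (X j - 1)}) ha0.le h₆
        (h₃.startFluid hQn) (fun X j hj => by
          obtain ⟨hj1, hj2, hj3⟩ := mem_filter.1 hj
          refine ⟨mem_range.1 (mem_filter.1 hj1).1, hj2, fun hc => ?_⟩
          simp only [movedBins, moved, mem_union, mem_filter] at hc
          rcases hc with hc | hc
          · linarith [hc.2.1]
          · linarith [hc.2.2.1])
      have h8 := h7.weaken (a' := a / (1 + ε)) (hi' := a / (1 + ε) / (ε * ε)) hle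
        (by rw [hhi]; exact div_le_div_of_nonneg_right hle (by positivity))
      convert h8 using 1
      · ext i'
        simp only [openedBins, opened, mem_union, mem_filter, mem_range]
        constructor
        · rintro ⟨h9, h10⟩
          rcases ((hgl i' h9).1 h10).lt_or_eq with h11 | h11
          · exact Or.inl ⟨h9, h11⟩
          · exact Or.inr ⟨h9, h11.symm⟩
        · rintro (⟨h9, h10⟩ | ⟨h9, h10⟩)
          · exact ⟨h9, (hgl i' h9).2 h10.le⟩
          · exact ⟨h9, (hgl i' h9).2 h10.ge⟩
      · funext X
        ext j
        simp only [moved, movedBins, mem_union, mem_filter]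
        -- Split both inequalities into strict ones and equalities: both strict means moved earlier,
        -- level `a` means moved with its bin, size `a` in a bin of higher level means poured.
        by_cases hj : j ∈ kept n rep lev δ ε X
        · obtain ⟨h9, i', hi', h10, _⟩ := mem_filter.1 hj
          have hX : X j - 1 = i' := by omega
          rw [hX, hgr j (mem_range.1 h9), hgl i' hi']
          simp only [hj, true_and]
          constructor
          · rintro ⟨h11, h12⟩
            rcases h11.lt_or_eq with h13 | h13 <;> rcases h12.lt_or_eq with h14 | h14
            · exact Or.inl (Or.inl ⟨h13, h14⟩)
            · exact Or.inl (Or.inr ⟨hi', h14.symm, h11⟩)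
            · exact Or.inr ⟨h13.symm, h14⟩
            · exact Or.inl (Or.inr ⟨hi', h14.symm, h11⟩)
          · rintro ((⟨h11, h12⟩ | ⟨_, h11, h12⟩) | ⟨h11, h12⟩)
            · exact ⟨h11.le, h12.le⟩
            · exact ⟨h12, h11.ge⟩
            · exact ⟨h11.ge, h12.le⟩
        · simp [hj]

end

end MatchUp


/-! ### The geometric grid and the whole dynamic program. -/

namespace MatchUp

open Finset RealRAM

/-- `x` is 0 or a point above `δ` of the geometric grid that descends from `A`. -/
def OnGrid (ε A δ x : ℝ) : Prop := x = 0 ∨ (δ < x ∧ ∃ k : ℕ, x = A / (1 + ε) ^ k)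

section

variable {n : ℕ} {s : State} {rep lev g : ℕ → ℝ} {ε δ A x : ℝ}

theorem OnGrid.le (h : OnGrid ε A δ x) (hε : 0 < ε) (hA : 0 ≤ A) : x ≤ A := by
  rcases h with rfl | ⟨-, k, rfl⟩
  · exact hA
  · exact div_le_self hA (one_le_pow₀ (by linarith))

theorem OnGrid.lt_iff (h : OnGrid ε A δ x) (hε : 0 < ε) (hA : 0 < A) (k : ℕ) :
    A / (1 + ε) ^ k / (1 + ε) < x ↔ A / (1 + ε) ^ k ≤ x := by
  have h1 : 1 < 1 + ε := by linarith
  rcases h with rfl | ⟨-, m, rfl⟩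
  · have h2 : 0 < A / (1 + ε) ^ k := by positivity
    have h3 : 0 < A / (1 + ε) ^ k / (1 + ε) := by positivity
    constructor <;> intro h <;> linarith
  · rw [div_div, ← pow_succ, div_lt_div_iff_of_pos_left hA (by positivity) (by positivity),
      div_le_div_iff_of_pos_left hA (by positivity) (by positivity), pow_lt_pow_iff_right₀ h1,
      pow_le_pow_iff_right₀ h1]
    omega

/-- A grid value in the window is `A / (1 + ε) ^ k` times `(1 + ε) ^ t` with `(1 + ε) ^ t ≤ 1 / ε²`,
which forces `t < K`. -/
theorem OnGrid.mem_window (h : OnGrid ε A δ x) (hε : 0 < ε) (hA : 0 < A) {k K : ℕ}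
    (hK : 1 / (ε * ε) < (1 + ε) ^ K) (h1 : A / (1 + ε) ^ k ≤ x)
    (h2 : x ≤ A / (1 + ε) ^ k / (ε * ε)) :
    x ∈ (range K).image fun t => A / (1 + ε) ^ k * (1 + ε) ^ t := by
  have h1' : 1 < 1 + ε := by linarith
  have ha : 0 < A / (1 + ε) ^ k := by positivity
  rcases h with rfl | ⟨-, m, rfl⟩
  · linarith
  · rw [div_le_div_iff_of_pos_left hA (by positivity) (by positivity),
      pow_le_pow_iff_right₀ h1'] at h1
    have h3 : A / (1 + ε) ^ m = A / (1 + ε) ^ k * (1 + ε) ^ (k - m) := by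
      rw [div_mul_eq_mul_div, eq_div_iff (by positivity), div_mul_eq_mul_div,
        div_eq_iff (by positivity), mul_assoc, ← pow_add, Nat.sub_add_cancel h1]
    rw [h3] at h2 ⊢
    refine mem_image.2 ⟨k - m, mem_range.2 ?_, rfl⟩
    rw [← pow_lt_pow_iff_right₀ h1']
    refine lt_of_le_of_lt ?_ hK
    rw [div_eq_mul_one_div (A / (1 + ε) ^ k) (ε * ε)] at h2
    exact le_of_mul_le_mul_left h2 ha

theorem clearRow_runs (hn : s.nvar 0 = n) :
    Runs (forP 10 (.add (.var 0) (.const 1))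
      (.storeN 1 (.var 10) (.const 0) ;; .storeR 6 (.var 10) (.const 0))) s (50 * (n + 1))
      fun s' => ∀ m < n + 1, s'.narr 1 m = 0 ∧ s'.rarr 6 m = 0 := by
  refine (Runs.forP (N := n + 1) (B := 20)
    (fun k s' => ∀ m < k, s'.narr 1 m = 0 ∧ s'.rarr 6 m = 0) rfl
    (fun s' hf => by simp [NExp.eval, hf.n 0 rfl, hn]) (by simp)
    (fun k s' hk hf hx hP => Runs.of_run rfl (Nat.le_of_ble_eq_true rfl) fun m hm => ?_)).le
    (by simp only [NExp.cost]; omega)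
  by_cases h : m = k
  · simp [Prog.run, NExp.eval, RExp.eval, hx, h]
  · simpa [Prog.run, NExp.eval, RExp.eval, hx, h] using hP m (by omega)

theorem initRows_runs (hn : s.nvar 0 = n) : Runs initRows s (70 * (n + 1)) fun s' =>
    BaseOk n s' 1 ∧ s'.nvar 4 = 1 ∧ rowOf n s' 0 = ⟨fun _ => 0, fun _ => 0, 0⟩ := by
  unfold initRows
  refine (Runs.seq (B₁ := 2) (Q₁ := fun s' => s'.nvar 4 = 1)
    (B₂ := 3 + (7 + (50 * (n + 1) + 5)))
    (Runs.of_run rfl (Nat.le_of_ble_eq_true rfl) (by simp [Prog.run, NExp.eval])) fun s₁ f₁ h₁ =>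
    Runs.seq (B₁ := 3) (Q₁ := fun s' => s' = s₁.putn 2 0 0)
    (Runs.of_run rfl (Nat.le_of_ble_eq_true rfl) (by simp [Prog.run, NExp.eval])) fun s₂ f₂ h₂ =>
    Runs.seq (B₁ := 7) (Q₁ := fun s' => s' = s₂.putn 2 1 (n + 1))
    (Runs.of_run rfl (Nat.le_of_ble_eq_true rfl)
      (by simp [Prog.run, NExp.eval, f₂.n 0 rfl, f₁.n 0 rfl, hn])) fun s₃ f₃ h₃ =>
    Runs.seq (clearRow_runs (by rw [f₃.n 0 rfl, f₂.n 0 rfl, f₁.n 0 rfl, hn]))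
    fun s₄ f₄ h₄ => Runs.of_run rfl (Nat.le_of_ble_eq_true rfl) ?_).le (by omega)
  · refine ⟨fun r hr => ?_, ?_, ?_⟩
    · have : s₄.narr 2 = s₃.narr 2 := f₄.na 2 rfl
      rw [h₃, h₂] at this
      interval_cases r <;> simp [Prog.run, this]
    · simp [Prog.run, f₄.n 4 rfl, f₃.n 4 rfl, f₂.n 4 rfl, h₁]
    · ext k
      · simp only [rowOf, Prog.run, State.putr_narr, zero_mul, zero_add]
        split_ifs with hk
        · exact (h₄ k hk).1
        · rfl
      · simp only [rowOf, Prog.run, State.putr_rarr, zero_mul, zero_add]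
        split_ifs with hk h
        · omega
        · exact (h₄ k hk).2
        · rfl
      · simp [rowOf, Prog.run, NExp.eval, RExp.eval]

theorem levelInv_init {hi a : ℝ} {rows : ℕ → Row} (h : rows 0 = ⟨fun _ => 0, fun _ => 0, 0⟩) :
    LevelInv n rep g ε hi a ∅ (fun _ => ∅) rows 1 := by
  refine ⟨fun r hr => ?_, fun X => ⟨0, Nat.one_pos, fun j _ _ => ?_, ?_⟩⟩
  · obtain rfl : r = 0 := by omega
    rw [h]
    exact ⟨by simp, by simp, by simp, by simp, by simp⟩
  · simp [h, freeCount, leftCount]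
  · simp [h, unused]

/-- Nonzero levels exceed `δ`, so once `a` has dropped to `δ` or below, lowering the threshold
further opens nothing new. -/
theorem opened_congr {a : ℝ} (hlev : ∀ i < n, OnGrid ε A δ (lev i)) (ha : 0 ≤ a) (haδ : a ≤ δ) :
    opened n lev a = opened n lev δ := by
  ext i
  simp only [opened, mem_filter, mem_range]
  refine and_congr_right fun hi => ⟨fun h => ?_, fun h => haδ.trans_lt h⟩
  rcases hlev i hi with h' | h'
  · linarith
  · exact h'.1

theorem moved_eq_kept {a : ℝ} (haδ : a ≤ δ) (X : ℕ → ℕ) :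
    moved n rep lev δ ε a X = kept n rep lev δ ε X := by
  refine filter_true_of_mem fun j hj => ?_
  obtain ⟨-, i, -, hX, h1, h2, -⟩ := mem_filter.1 hj
  rw [hX, Nat.add_sub_cancel]
  exact ⟨haδ.trans_lt h1, haδ.trans_lt h2⟩

theorem opened_eq_empty {a : ℝ} (hlev : ∀ i < n, lev i ≤ a) : opened n lev a = ∅ :=
  filter_false_of_mem fun i hi => not_lt.2 (hlev i (mem_range.1 hi))

theorem moved_eq_empty {a : ℝ} (hrep : ∀ i < n, rep i ≤ a) (X : ℕ → ℕ) :
    moved n rep lev δ ε a X = ∅ :=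
  filter_false_of_mem fun j hj h => absurd h.1 (not_lt.2 (hrep j (mem_range.1 (mem_filter.1 hj).1)))

/-- Rows of earlier stages are never removed, even if their keys coincide after the key has changed.
Each level therefore adds at most `(n + 1) * (n + 1) ^ (2 * K)` rows to the initial one, and the
list grows only linearly with the number of levels. -/
theorem dynamicProg_runs {K M Nm : ℕ} (hn : s.nvar 0 = n) (hrep : s.rarr 4 = rep)
    (hlev : s.rarr 5 = lev) (hε : s.rvar 0 = ε) (hA : s.rvar 3 = A) (hδ : s.rvar 4 = δ)
    (hε0 : 0 < ε) (hε1 : ε ≤ 1) (hA0 : 0 ≤ A) (hδ0 : 0 ≤ δ)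
    (hg : ∀ i < n, s.rarr 2 i - s.rarr 3 i = g i) (hlg : ∀ i < n, lev i ≠ 0 → lev i ≤ ε * g i)
    (hgr : ∀ j < n, OnGrid ε A δ (rep j)) (hgl : ∀ i < n, OnGrid ε A δ (lev i))
    (hK : 1 / (ε * ε) < (1 + ε) ^ K) (hM : A / (1 + ε) ^ M ≤ δ)
    (hNm : 1 + M * ((n + 1) * (n + 1) ^ (2 * K)) ≤ Nm) :
    Runs dynamicProg s (4000 * ((M + 1) * ((n + 1) ^ 4 * (Nm + 1) ^ 2))) fun s' =>
      BaseOk n s' (s'.nvar 4) ∧ s'.nvar 4 ≤ Nm ∧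
      (∀ r < s'.nvar 4, Valid n rep g ε 0 (opened n lev δ) (opened n lev δ) (rowOf n s' r)) ∧
      ∀ X, ∃ r < s'.nvar 4, (rowOf n s' r).F ≤
        unused (opened n lev δ) (kept n rep lev δ ε X) rep g X := by
  unfold dynamicProg
  set T := (n + 1) * (n + 1) ^ (2 * K) with hT
  set U := (n + 1) ^ 4 * (Nm + 1) ^ 2 with hU
  have hnU : n + 1 ≤ U := (Nat.le_self_pow (by omega) _).trans (Nat.le_mul_of_pos_right _ (by positivity))
  refine (Runs.seq (initRows_runs hn) (B₁ := 70 * (n + 1)) (B₂ := 2 + (M * (3000 * U + 4 + 1) + 4 + 1))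
    fun s₁ f₁ ⟨hb₁, hN₁, hr₁⟩ => Runs.seq (B₁ := 2) (Q₁ := fun s' => s' = s₁.setr 5 A)
    (Runs.of_run rfl (Nat.le_of_ble_eq_true rfl)
      (by simp [Prog.run, RExp.eval, f₁.r 3 rfl, hA])) fun s₂ f₂ h₂ =>
    (Runs.loop (M := M) (B := 3000 * U) (fun k s' => s'.rvar 5 = A / (1 + ε) ^ k ∧
      BaseOk n s' (s'.nvar 4) ∧ s'.nvar 4 ≤ 1 + k * T ∧
      LevelInv n rep g ε (A / (1 + ε) ^ k / (ε * ε)) (A / (1 + ε) ^ k)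
        (opened n lev (A / (1 + ε) ^ k)) (moved n rep lev δ ε (A / (1 + ε) ^ k)) (rowOf n s')
        (s'.nvar 4)) ?_ ?_ ?_).mono le_rfl ?_).le ?_
  · rw [h₂]
    refine ⟨by simp, by rw [State.setr_nvar, hN₁]; exact hb₁, by simp [hN₁], ?_⟩
    simp only [pow_zero, div_one, State.setr_nvar, hN₁]
    rw [opened_eq_empty fun i hi => (hgl i hi).le hε0 hA0,
      show moved n rep lev δ ε A = fun _ => ∅ from
        funext fun X => moved_eq_empty (fun i hi => (hgr i hi).le hε0 hA0) X]
    exact levelInv_init hr₁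
  · intro k s' hk hb hf ⟨ha, hbase, hN, hinv⟩
    have e : ∀ y, initRows.wr y = false → y ≠ 5 → levelBody.wr y = false →
        s'.rvar y = s.rvar y := fun y h1 h2 h3 => by
      rw [hf.r y h3, h₂]; simp [h2, f₁.r y h1]
    have e4 : ∀ y, initRows.wra y = false → levelBody.wra y = false →
        s'.rarr y = s.rarr y := fun y h1 h3 => by
      rw [hf.ra y h3, h₂]; simp [f₁.ra y h1]
    have ha0 : 0 < A / (1 + ε) ^ k := by
      have : s'.rvar 4 < s'.rvar 5 := by simpa [RExp.eval] using hb
      rw [ha, e 4 rfl (by decide) rfl, hδ] at this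
      linarith
    have hApos : 0 < A := by
      by_contra h
      rw [le_antisymm (not_lt.1 h) hA0] at ha0
      simp at ha0
    have hZ : #((range K).image fun t => A / (1 + ε) ^ k * (1 + ε) ^ t) ≤ K :=
      card_image_le.trans (card_range K).le
    have hT' : (n + 1) * (n + 1) ^
        (2 * #((range K).image fun t => A / (1 + ε) ^ k * (1 + ε) ^ t)) ≤ T := by
      rw [hT]; gcongr; omega
    have hkM : (k + 1) * T ≤ M * T := Nat.mul_le_mul_right _ hk
    rw [add_mul, one_mul] at hkM
    have hn' : s'.nvar 0 = n := by
      rw [hf.n 0 rfl, h₂, State.setr_nvar, f₁.n 0 rfl, hn]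
    refine (levelBody_runs hn' ((e4 4 rfl rfl).trans hrep) ((e4 5 rfl rfl).trans hlev)
      ((e 0 rfl (by decide) rfl).trans hε) ha ha0 hε0
      (fun i hi => by rw [e4 2 rfl rfl, e4 3 rfl rfl]; exact hg i hi)
      (fun i hi h => h.trans (hlg i hi (by linarith))) hbase (fun j hj => (hgr j hj).lt_iff hε0 hApos k)
      (fun j hj => (hgl j hj).lt_iff hε0 hApos k) hinv
      (fun j hj h1 h2 => (hgr j hj).mem_window hε0 hApos hK h1 h2) hε1 (Nm := Nm)
      (by omega)).mono le_rfl
      fun s'' f'' ⟨h1, h2, h3, h4⟩ => ?_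
    rw [show A / (1 + ε) ^ k / (1 + ε) = A / (1 + ε) ^ (k + 1) by rw [div_div, ← pow_succ]] at h4
    rw [div_div, ← pow_succ] at h3
    refine ⟨h3, h1, ?_, h4⟩
    rw [add_mul, one_mul]
    omega
  · intro s' hf ⟨ha, _⟩ hb
    have : s'.rvar 4 < s'.rvar 5 := by simpa [RExp.eval] using hb
    rw [ha, hf.r 4 rfl, h₂, State.setr_rvar, if_neg (by decide), f₁.r 4 rfl, hδ] at this
    linarith
  · intro s' hf ⟨hb, k, hk, ha, hbase, hN, hinv⟩
    have haδ : A / (1 + ε) ^ k ≤ δ := by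
      have : ¬ s'.rvar 4 < s'.rvar 5 := by simpa [RExp.eval] using hb
      rw [ha, hf.r 4 rfl, h₂, State.setr_rvar, if_neg (by decide), f₁.r 4 rfl, hδ] at this
      linarith
    have ha0 : 0 ≤ A / (1 + ε) ^ k := by positivity
    have hkM : k * T ≤ M * T := Nat.mul_le_mul_right _ hk
    rw [opened_congr hgl ha0 haδ] at hinv
    refine ⟨hbase, by omega, (hinv.weaken ha0 le_rfl).valid, fun X => ?_⟩
    obtain ⟨r, hr, -, h⟩ := hinv.covered X
    rw [moved_eq_kept haδ] at h
    exact ⟨r, hr, h⟩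
  · have : 5 * M ≤ 1000 * (M * U) := by
      have : M ≤ M * U := Nat.le_mul_of_pos_right _ (by omega)
      omega
    have e1 : M * (3000 * U + 4 + 1) = 3000 * (M * U) + 5 * M := by ring
    have e2 : 4000 * ((M + 1) * U) = 4000 * (M * U) + 4000 * U := by ring
    rw [e1, e2]; omega

end

end MatchUp


/-! ### Preparing a class and selecting the best row. -/

namespace RealRAM

theorem forVar_runs {x y : ℕ} {c : Prog} {s : State} {N B : ℕ} (P : ℕ → State → Prop)
    (hx : c.wn x = false) (hy : (forP x (.var y) c).wn y = false) (hN : s.nvar y = N)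
    (h0 : P 0 (s.setn x 0))
    (hs : ∀ k s', k < N → Frame (forP x (.var y) c) s s' → s'.nvar x = k → P k s' →
      Runs c s' B (fun s'' => P (k + 1) (s''.setn x (k + 1)))) :
    Runs (forP x (NExp.var y) c) s (N * (B + 9) + 7) (P N) :=
  (Runs.forP P hx (e := .var y) (fun s' hf => (hf.n y hy).trans hN) h0 hs).le
    (le_of_eq (by simp only [NExp.cost]))

end RealRAM

namespace MatchUp

open Finset RealRAM

/-- The jobs of height `q` among the first `n` jobs. -/
def level (h : ℕ → ℕ) (n q : ℕ) : Finset ℕ := {j ∈ range n | h j = q}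

theorem sum_level_succ (h : ℕ → ℕ) (n q : ℕ) (f : ℕ → ℝ) :
    ∑ j ∈ level h (n + 1) q, f j = ∑ j ∈ level h n q, f j + if h n = q then f n else 0 := by
  simp only [level, Finset.sum_filter, Finset.sum_range_succ]

section

variable {n q : ℕ} {s : State} {h : ℕ → ℕ} {len p₁ : ℕ → ℝ} {ε δ A v : ℝ}

theorem totals_runs (hn : s.nvar 0 = n) (hq : s.nvar 3 = q) (hh : s.narr 0 = h)
    (hlen : s.rarr 2 = len) (hε : s.rvar 0 = ε) (hr : s.rvar 1 = n) :
    Runs totals s (60 * (n + 1)) fun s' =>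
      s'.rvar 3 = ∑ i ∈ level h n (q + 1), len i + ∑ j ∈ level h n q, len j ∧
      s'.rvar 4 = ε * ε *
        (∑ i ∈ level h n (q + 1), len i + ∑ j ∈ level h n q, len j) / n := by
  unfold totals
  refine (Runs.seq (B₁ := 2) (B₂ := (n * (30 + 9) + 7) + 10)
    (Q₁ := fun s' => s' = s.setr 3 0) (Runs.of_run rfl (Nat.le_of_ble_eq_true rfl)
      (by simp [Prog.run, RExp.eval])) fun s₁ f₁ h₁ => Runs.seq
    (forVar_runs (x := 17) (y := 0) (N := n) (B := 30) (fun k s' => s'.rvar 3 =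
      ∑ i ∈ level h k (q + 1), len i + ∑ j ∈ level h k q, len j) rfl rfl
    (by simp [h₁, hn]) (by simp [h₁, level])
    fun k s' hk hf hx hP => ?_) fun s₂ f₂ h₂ => Runs.of_run rfl (Nat.le_of_ble_eq_true rfl) ?_).le
    (by omega)
  · have e0 : s'.narr 0 = h := by rw [hf.na 0 rfl, f₁.na 0 rfl, hh]
    have e2 : s'.rarr 2 = len := by rw [hf.ra 2 rfl, f₁.ra 2 rfl, hlen]
    have e3 : s'.nvar 3 = q := by rw [hf.n 3 rfl, f₁.n 3 rfl, hq]
    refine Runs.of_run rfl (Nat.le_of_ble_eq_true rfl) ?_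
    simp only [Prog.run, BExp.eval, NExp.eval, RExp.eval, hx, e0, e2, e3, sum_level_succ]
    split_ifs with h1 h2 h3 h3 <;> simp only [State.setn_rvar, State.setr_rvar, if_true, hP] <;>
      first | omega | ring
  · have e0 : s₂.rvar 0 = ε := by rw [f₂.r 0 rfl, f₁.r 0 rfl, hε]
    have e1 : s₂.rvar 1 = n := by rw [f₂.r 1 rfl, f₁.r 1 rfl, hr]
    simp [Prog.run, RExp.eval, e0, e1, h₂]

/-- A division takes place only while the grid value exceeds `v`, which keeps `v` within a factor `1
+ ε`. The second test stops the descent at `δ` and so bounds the number of iterations, even for `v =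
0`. -/
theorem roundLoop_runs {M : ℕ} (hε : s.rvar 0 = ε) (hA : s.rvar 3 = A) (hδ : s.rvar 4 = δ)
    (hv : s.rvar 8 = v) (hε0 : 0 < ε) (hA0 : 0 ≤ A) (hvA : v ≤ A) (hM : A / (1 + ε) ^ M ≤ δ) :
    Runs roundLoop s (20 * (M + 1)) fun s' => (∃ k, s'.rvar 7 = A / (1 + ε) ^ k) ∧
      v ≤ (1 + ε) * s'.rvar 7 ∧ (s'.rvar 7 ≤ v ∨ s'.rvar 7 ≤ δ) := by
  unfold roundLoop
  refine (Runs.seq (B₁ := 2) (Q₁ := fun s' => s' = s.setr 7 A)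
    (B₂ := M * (6 + 9 + 1) + 9 + 1) (Runs.of_run rfl (Nat.le_of_ble_eq_true rfl)
      (by simp [Prog.run, RExp.eval, hA])) fun s₁ f₁ h₁ =>
    (Runs.loop (M := M) (B := 6) (fun k s' => s'.rvar 7 = A / (1 + ε) ^ k ∧
      v ≤ (1 + ε) * (A / (1 + ε) ^ k)) ?_ ?_ ?_).mono le_rfl ?_).le (by omega)
  · refine ⟨by simp [h₁], ?_⟩
    rw [pow_zero, div_one]
    nlinarith
  · intro k s' hk hb hf ⟨h2, h3⟩
    have e0 : s'.rvar 0 = ε := by rw [hf.r 0 rfl, f₁.r 0 rfl, hε]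
    have e8 : s'.rvar 8 = v := by rw [hf.r 8 rfl, f₁.r 8 rfl, hv]
    have h4 : v < A / (1 + ε) ^ k := by
      have := hb.1
      simp only [BExp.eval_ltR, RExp.eval, e8, h2] at this
      exact this
    refine Runs.of_run rfl (Nat.le_of_ble_eq_true rfl) ?_
    simp only [Prog.run, RExp.eval, h2, e0, State.setr_rvar, if_true, Rat.cast_one, div_div,
      ← pow_succ, true_and]
    refine h4.le.trans (le_of_eq ?_)
    rw [pow_succ]
    field_simp
  · intro s' hf ⟨h2, _⟩ hb
    have e4 : s'.rvar 4 = δ := by rw [hf.r 4 rfl, f₁.r 4 rfl, hδ]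
    have := hb.2
    simp only [BExp.eval_ltR, RExp.eval, e4, h2] at this
    linarith
  · intro s' hf ⟨hb, k, _, h2, h3⟩
    have e4 : s'.rvar 4 = δ := by rw [hf.r 4 rfl, f₁.r 4 rfl, hδ]
    have e8 : s'.rvar 8 = v := by rw [hf.r 8 rfl, f₁.r 8 rfl, hv]
    refine ⟨⟨k, h2⟩, by rwa [h2], ?_⟩
    by_contra! hc
    exact hb ⟨by simpa [RExp.eval, e8] using hc.1, by simpa [RExp.eval, e4] using hc.2⟩

theorem rounds_of {x : ℝ} (hε0 : 0 < ε) (h : v ≤ (1 + ε) * x) (h' : x ≤ v ∨ x ≤ δ) :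
    Rounds ε δ v (if δ < x then x else 0) := by
  split_ifs with hx
  · exact Or.inl ⟨hx, h'.resolve_right (not_le.2 hx), h⟩
  · refine Or.inr ⟨rfl, h.trans ?_⟩
    gcongr
    exact not_lt.1 hx

/-- The result of the rounding of job `j`. -/
def Rounded (h : ℕ → ℕ) (len p₁ : ℕ → ℝ) (q : ℕ) (ε A δ : ℝ) (s : State) (j : ℕ) : Prop :=
  OnGrid ε A δ (s.rarr 4 j) ∧ OnGrid ε A δ (s.rarr 5 j) ∧
  (h j = q → Rounds ε δ (len j) (s.rarr 4 j)) ∧ (h j ≠ q → s.rarr 4 j = 0) ∧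
  (h j = q + 1 → Rounds ε δ (ε * (len j - p₁ j)) (s.rarr 5 j)) ∧ (h j ≠ q + 1 → s.rarr 5 j = 0)

theorem rounding_runs {M : ℕ} (hn : s.nvar 0 = n) (hq : s.nvar 3 = q) (hh : s.narr 0 = h)
    (hlen : s.rarr 2 = len) (hp₁ : s.rarr 3 = p₁) (hε : s.rvar 0 = ε) (hA : s.rvar 3 = A)
    (hδ : s.rvar 4 = δ) (hε0 : 0 < ε) (hA0 : 0 ≤ A) (hδ0 : 0 ≤ δ) (hM : A / (1 + ε) ^ M ≤ δ)
    (hI : ∀ j < n, h j = q → len j ≤ A)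
    (hD : ∀ j < n, h j = q + 1 → ε * (len j - p₁ j) ≤ A) :
    Runs rounding s (200 * ((n + 1) * (M + 1))) fun s' =>
      ∀ j < n, Rounded h len p₁ q ε A δ s' j := by
  unfold rounding
  set v : ℕ → ℝ := fun j => if h j = q then len j else if h j = q + 1 then ε * (len j - p₁ j) else 0
    with hv
  have hvA : ∀ j < n, v j ≤ A := fun j hj => by
    simp only [hv]; split_ifs with h1 h2
    exacts [hI j hj h1, hD j hj h2, hA0]
  refine (forVar_runs (x := 17) (y := 0) (N := n) (B := 40 + (20 * (M + 1) + 60))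
    (fun k s' => ∀ j < k, Rounded h len p₁ q ε A δ s' j) rfl rfl hn (by simp) fun k s' hk hf hx hP => ?_).le ?_
  · have e0 : s'.narr 0 = h := by rw [hf.na 0 rfl, hh]
    have e2 : s'.rarr 2 = len := by rw [hf.ra 2 rfl, hlen]
    have e3 : s'.rarr 3 = p₁ := by rw [hf.ra 3 rfl, hp₁]
    have e4 : s'.nvar 3 = q := by rw [hf.n 3 rfl, hq]
    have e5 : s'.rvar 0 = ε := by rw [hf.r 0 rfl, hε]
    have e6 : s'.rvar 3 = A := by rw [hf.r 3 rfl, hA]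
    have e7 : s'.rvar 4 = δ := by rw [hf.r 4 rfl, hδ]
    refine Runs.seq (B₁ := 40) (B₂ := 20 * (M + 1) + 60) (Q₁ := fun s'' => s'' = s'.setr 8 (v k))
      (Runs.of_run rfl (Nat.le_of_ble_eq_true rfl) ?_) fun s₁ f₁ h₁ => Runs.seq
      (roundLoop_runs (M := M) (v := v k) ((f₁.r 0 rfl).trans e5) ((f₁.r 3 rfl).trans e6)
        ((f₁.r 4 rfl).trans e7) (by simp [h₁]) hε0 hA0 (hvA k hk) hM)
      fun s₂ f₂ ⟨h2, h3, h4⟩ => Runs.of_run rfl (Nat.le_of_ble_eq_true rfl) fun j hj => ?_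
    · simp only [Prog.run, BExp.eval_eqN, NExp.eval, RExp.eval, hx, e0, e2, e3, e4, e5, hv]
      split_ifs <;> simp
    · have g0 : s₂.narr 0 = h := by rw [f₂.na 0 rfl, f₁.na 0 rfl, e0]
      have g3 : s₂.nvar 3 = q := by rw [f₂.n 3 rfl, f₁.n 3 rfl, e4]
      have gx : s₂.nvar 17 = k := by rw [f₂.n 17 rfl, f₁.n 17 rfl, hx]
      have g4 : s₂.rvar 4 = δ := by rw [f₂.r 4 rfl, f₁.r 4 rfl, e7]
      have k4 : s₂.rarr 4 = s'.rarr 4 := by rw [f₂.ra 4 rfl, f₁.ra 4 rfl]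
      have k5 : s₂.rarr 5 = s'.rarr 5 := by rw [f₂.ra 5 rfl, f₁.ra 5 rfl]
      have hR := rounds_of hε0 h3 h4
      set x := s₂.rvar 7 with hxx
      have hG : OnGrid ε A δ (if δ < x then x else 0) := by
        split_ifs with h5
        · exact Or.inr ⟨h5, h2⟩
        · exact Or.inl rfl
      by_cases hjk : j = k
      · subst hjk
        have h00 : OnGrid ε A δ 0 := Or.inl rfl
        by_cases c1 : h j = q
        · have hv1 : v j = len j := by simp [hv, c1]
          rw [hv1] at hR
          by_cases c2 : δ < x
          · rw [if_pos c2] at hR hG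
            simpa [Rounded, Prog.run, NExp.eval, RExp.eval, gx, g0, g3, g4, c1, ← hxx, c2, h00]
              using ⟨hG, hR⟩
          · rw [if_neg c2] at hR
            simpa [Rounded, Prog.run, NExp.eval, RExp.eval, gx, g0, g3, g4, c1, ← hxx, c2, h00]
              using hR
        · by_cases c2 : δ < x
          · have c3 : h j = q + 1 := by
              by_contra c3
              have : v j = 0 := by simp [hv, c1, c3]
              rw [this] at h4
              rcases h4 with h4 | h4 <;> linarith
            have hv1 : v j = ε * (len j - p₁ j) := by simp [hv, c3]
            rw [hv1] at hR
            rw [if_pos c2] at hR hG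
            simpa [Rounded, Prog.run, NExp.eval, RExp.eval, gx, g0, g3, g4, c3, ← hxx, c2, h00]
              using ⟨hG, hR⟩
          · rw [if_neg c2] at hR
            simp [Rounded, Prog.run, NExp.eval, RExp.eval, gx, g4, c1, ← hxx, c2, h00]
            intro c3
            simpa [hv, c3] using hR
      · have h5 := hP j (by omega)
        by_cases c1 : h k = q <;> by_cases c2 : δ < x <;>
          simpa [Rounded, Prog.run, NExp.eval, RExp.eval, gx, g0, g3, g4, c1, ← hxx, c2, hjk, k4, k5]
            using h5
  · have h1 : n ≤ n * (M + 1) := Nat.le_mul_of_pos_right _ (by omega)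
    have e1 : n * (40 + (20 * (M + 1) + 60) + 9) = 109 * n + 20 * (n * (M + 1)) := by ring
    have e2 : 200 * ((n + 1) * (M + 1)) = 200 * (n * (M + 1)) + 200 * (M + 1) := by ring
    rw [e1, e2]
    omega

theorem bestRow_runs {N : ℕ} (hN : s.nvar 4 = N) (hN0 : 0 < N) :
    Runs bestRow s (60 * (N + 1)) fun s' => s'.nvar 18 < N ∧
      ∀ r < N, s.rarr 7 (s'.nvar 18) ≤ s.rarr 7 r := by
  unfold bestRow
  refine (Runs.seq (B₁ := 2) (B₂ := N * (30 + 9) + 7)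
    (Q₁ := fun s' => s' = s.setn 18 0) (Runs.of_run rfl (Nat.le_of_ble_eq_true rfl)
      (by simp [Prog.run, NExp.eval])) fun s₁ f₁ h₁ =>
    forVar_runs (x := 7) (y := 4) (N := N) (B := 30) (fun k s' => s'.nvar 18 < N ∧
      ∀ r < k, s.rarr 7 (s'.nvar 18) ≤ s.rarr 7 r) rfl rfl
    (by simp [h₁, hN]) (by simp [h₁, hN0])
    fun k s' hk hf hx hP => ?_).le (by omega)
  have e7 : s'.rarr 7 = s.rarr 7 := by rw [hf.ra 7 rfl, f₁.ra 7 rfl]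
  refine Runs.of_run rfl (Nat.le_of_ble_eq_true rfl) ?_
  simp only [Prog.run, BExp.eval_ltR, NExp.eval, RExp.eval, hx, e7]
  split_ifs with h2
  · simp only [State.setn_nvar, if_true, Nat.reduceEqDiff, if_false]
    refine ⟨hk, fun r hr => ?_⟩
    rcases Nat.lt_succ_iff_lt_or_eq.1 hr with h3 | rfl
    · exact h2.le.trans (hP.2 r h3)
    · exact le_rfl
  · simp only [State.setn_nvar, Nat.reduceEqDiff, if_false]
    refine ⟨hP.1, fun r hr => ?_⟩
    rcases Nat.lt_succ_iff_lt_or_eq.1 hr with h3 | rfl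
    · exact hP.2 r h3
    · exact not_lt.1 h2

end

end MatchUp


/-! ### From an assignment to start times. -/

namespace MatchUp

open Finset RealRAM

/-- The jobs in `S` run within `[lo, hi]` and do not collide, where `len j` is the full length of
job `j` and `w j k` is its length in the highest layer that it shares with job `k`. -/
def Packed (w : ℕ → ℕ → ℝ) (len σ : ℕ → ℝ) (S : Finset ℕ) (lo hi : ℝ) : Prop :=
  (∀ j ∈ S, lo ≤ σ j ∧ σ j + len j ≤ hi) ∧
  ∀ j ∈ S, ∀ k ∈ S, j ≠ k → σ j + w j k ≤ σ k ∨ σ k + w k j ≤ σ j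

section

variable {w : ℕ → ℕ → ℝ} {len σ σ' : ℕ → ℝ} {S S' : Finset ℕ} {lo mid hi : ℝ}

theorem Packed.empty : Packed w len σ ∅ lo hi := ⟨by simp, by simp⟩

theorem Packed.congr (h : Packed w len σ S lo hi) (he : ∀ j ∈ S, σ' j = σ j) :
    Packed w len σ' S lo hi :=
  ⟨fun j hj => by rw [he j hj]; exact h.1 j hj,
   fun j hj k hk => by rw [he j hj, he k hk]; exact h.2 j hj k hk⟩

theorem Packed.append (h : Packed w len σ S lo mid) (h' : Packed w len σ S' mid hi)
    (h1 : lo ≤ mid) (h2 : mid ≤ hi) (hw : ∀ j ∈ S ∪ S', ∀ k, w j k ≤ len j) :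
    Packed w len σ (S ∪ S') lo hi := by
  refine ⟨fun j hj => ?_, fun j hj k hk hjk => ?_⟩
  · rcases mem_union.1 hj with hj | hj
    · exact ⟨(h.1 j hj).1, (h.1 j hj).2.trans h2⟩
    · exact ⟨h1.trans (h'.1 j hj).1, (h'.1 j hj).2⟩
  · have hj' := hw j hj k
    have hk' := hw k hk j
    rcases mem_union.1 hj with hj | hj <;> rcases mem_union.1 hk with hk | hk
    · exact h.2 j hj k hk hjk
    · left; linarith [(h.1 j hj).2, (h'.1 k hk).1]
    · right; linarith [(h'.1 j hj).1, (h.1 k hk).2]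
    · exact h'.2 j hj k hk hjk

theorem Packed.singleton {j : ℕ} (h1 : lo ≤ σ j) (h2 : σ j + len j ≤ hi) :
    Packed w len σ {j} lo hi :=
  ⟨fun k hk => by rw [mem_singleton.1 hk]; exact ⟨h1, h2⟩,
   fun k hk m hm hkm => absurd ((mem_singleton.1 hk).trans (mem_singleton.1 hm).symm) hkm⟩

/-- The bin collides with its items only in the layers they share, where it has length at most `p`.
So the items may start at `T + p`, while the top of the bin is still running. -/
theorem Packed.insert_bin {i : ℕ} {T p : ℝ} (h : Packed w len σ S (T + p) hi) (hi0 : σ i = T)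
    (hp : 0 ≤ p) (hw : ∀ j ∈ S, w i j ≤ p) :
    Packed w len σ (insert i S) T (max (T + len i) hi) := by
  refine ⟨fun j hj => ?_, fun j hj k hk hjk => ?_⟩
  · rcases mem_insert.1 hj with rfl | hj
    · rw [hi0]; exact ⟨le_rfl, le_max_left _ _⟩
    · exact ⟨by linarith [(h.1 j hj).1], (h.1 j hj).2.trans (le_max_right _ _)⟩
  · rcases mem_insert.1 hj with rfl | hj' <;> rcases mem_insert.1 hk with rfl | hk'
    · exact absurd rfl hjk
    · left; linarith [(h.1 k hk').1, hw k hk']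
    · right; linarith [(h.1 j hj').1, hw j hj']
    · exact h.2 j hj' k hk' hjk

end

theorem level_succ (h : ℕ → ℕ) (n q : ℕ) :
    level h (n + 1) q = if h n = q then insert n (level h n q) else level h n q := by
  rw [level, Finset.range_add_one, Finset.filter_insert]; rfl

theorem mem_level {h : ℕ → ℕ} {n q j : ℕ} : j ∈ level h n q ↔ j < n ∧ h j = q := by
  simp [level]

/-- The items that are assigned to bin `i`. -/
def itemsOf (h : ℕ → ℕ) (n q : ℕ) (A : ℕ → ℕ) (i : ℕ) : Finset ℕ := {j ∈ level h n q | A j = i + 1}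

theorem mem_itemsOf {h A : ℕ → ℕ} {n q i j : ℕ} :
    j ∈ itemsOf h n q A i ↔ (j < n ∧ h j = q) ∧ A j = i + 1 := by
  rw [itemsOf, mem_filter, mem_level]

section

variable {n q : ℕ} {s : State} {h : ℕ → ℕ} {len p₁ σ : ℕ → ℝ} {w : ℕ → ℕ → ℝ} {A : ℕ → ℕ} {T : ℝ}

theorem placeItems_runs {i r : ℕ} {t : ℝ} (hn : s.nvar 0 = n) (hq : s.nvar 3 = q)
    (hh : s.narr 0 = h) (hlen : s.rarr 2 = len) (hi : s.nvar 19 = i)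
    (hr : s.nvar 18 = r) (hb : s.narr 2 r = r * (n + 1)) (hA : (rowOf n s r).A = A)
    (ht : s.rvar 9 = t) (hl : ∀ j < n, 0 ≤ len j) (hw : ∀ j < n, ∀ k, w j k ≤ len j) :
    Runs (forP 20 (.var 0)
      (.cond (.and (.eqN (.cell 0 (.var 20)) (.var 3))
          (.eqN (cellA 18 20) (.add (.var 19) (.const 1))))
        (.storeR 1 (.var 20) (.var 9) ;; .setR 9 (.add (.var 9) (.cell 2 (.var 20)))) .skip))
      s (n * (60 + 9) + 7) fun s' =>
      s'.rvar 9 = t + load (level h n q) A len i ∧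
      Packed w len (s'.rarr 1) (itemsOf h n q A i) t (s'.rvar 9) ∧
      ∀ j, j ∉ itemsOf h n q A i → s'.rarr 1 j = s.rarr 1 j := by
  refine forVar_runs (x := 20) (y := 0) (N := n) (B := 60) (fun k s' =>
    s'.rvar 9 = t + load (level h k q) A len i ∧
      Packed w len (s'.rarr 1) (itemsOf h k q A i) t (s'.rvar 9) ∧
      ∀ j, j ∉ itemsOf h k q A i → s'.rarr 1 j = s.rarr 1 j) rfl rfl hn ?_ ?_
  · refine ⟨by simp [ht, load, level], ?_, by simp⟩
    rw [show itemsOf h 0 q A i = ∅ by simp [itemsOf, level]]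
    exact Packed.empty
  · intro k s' hk hf hx ⟨h1, h2, h3⟩
    have e0 : s'.narr 0 = h := by rw [hf.na 0 rfl, hh]
    have e2 : s'.rarr 2 = len := by rw [hf.ra 2 rfl, hlen]
    have e3 : s'.nvar 3 = q := by rw [hf.n 3 rfl, hq]
    have e19 : s'.nvar 19 = i := by rw [hf.n 19 rfl, hi]
    have eA : (cellA 18 20).eval s' = A k := by
      rw [eval_cellA (r' := r) (n := n) (by rw [hf.n 18 rfl, hr, hf.na 2 rfl, hb]) hx (by omega), ← hA]
      simp only [rowOf, hf.na 1 rfl]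
    refine Runs.of_run rfl (Nat.le_of_ble_eq_true rfl) ?_
    have hle : ∀ j, j ∈ itemsOf h k q A i → j ≠ k := fun j hj => by
      rw [mem_itemsOf] at hj; omega
    by_cases hc : h k = q ∧ A k = i + 1
    · have hk' : k ∉ itemsOf h k q A i := fun hc => hle k hc rfl
      have hS : itemsOf h (k + 1) q A i = itemsOf h k q A i ∪ {k} := by
        rw [itemsOf, level_succ, if_pos hc.1, Finset.filter_insert, if_pos hc.2,
          Finset.insert_eq, Finset.union_comm]; rfl
      have hL : load (level h (k + 1) q) A len i = load (level h k q) A len i + len k := by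
        change ∑ j ∈ itemsOf h (k + 1) q A i, len j = _
        rw [hS, Finset.sum_union (by simpa using hk'), Finset.sum_singleton]; rfl
      have hl0 := load_nonneg (I := level h k q) (X := A) (s := len)
        (fun j hj => hl j ((mem_level.1 hj).1.trans hk)) i
      simp only [Prog.run, BExp.eval, BExp.eval_eqN, NExp.eval, RExp.eval, hx, e0, e2, e3, e19, eA, hc,
        and_self, if_true, State.setr_rvar, State.setn_rvar, State.putr_rvar, State.setr_rarr, State.setn_rarr, State.putr_rarr,
        State.putr_nvar, h1, hL]
      refine ⟨by simp [add_assoc], ?_, fun j hj => ?_⟩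
      · rw [hS]
        refine Packed.append (mid := t + load (level h k q) A len i) ?_ ?_ (by linarith)
          (by simp; linarith [hl k hk]) fun j hj m => ?_
        · rw [← h1]
          exact h2.congr fun j hj => by simp [hle j hj]
        · exact Packed.singleton (by simp) (by simp)
        · refine hw j ?_ m
          rw [mem_union, mem_itemsOf, mem_singleton] at hj
          omega
      · rw [hS, mem_union, mem_singleton, not_or] at hj
        simp [hj.2, h3 j hj.1]
    · have hS : itemsOf h (k + 1) q A i = itemsOf h k q A i := by
        ext j
        simp only [mem_itemsOf]
        refine ⟨fun hj => ⟨⟨?_, hj.1.2⟩, hj.2⟩, fun hj => ⟨⟨by omega, hj.1.2⟩, hj.2⟩⟩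
        rcases Nat.lt_succ_iff_lt_or_eq.1 hj.1.1 with h' | rfl
        · exact h'
        · exact absurd ⟨hj.1.2, hj.2⟩ hc
      have hL : load (level h (k + 1) q) A len i = load (level h k q) A len i := by
        change ∑ j ∈ itemsOf h (k + 1) q A i, len j = _
        rw [hS]; rfl
      simp only [Prog.run, BExp.eval, BExp.eval_eqN, NExp.eval, RExp.eval, hx, e0, e3, e19, eA, hc,
        if_false, State.setn_rvar, State.setn_rarr, hS, hL]
      exact ⟨h1, h2, h3⟩

theorem placeBin_runs {i r : ℕ} (hn : s.nvar 0 = n) (hq : s.nvar 3 = q)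
    (hh : s.narr 0 = h) (hlen : s.rarr 2 = len) (hp₁ : s.rarr 3 = p₁) (hi : s.nvar 19 = i)
    (hr : s.nvar 18 = r) (hb : s.narr 2 r = r * (n + 1)) (hA : (rowOf n s r).A = A)
    (hT : s.rvar 2 = T) (hl : ∀ j < n, 0 ≤ len j) (hw : ∀ j < n, ∀ k, w j k ≤ len j)
    (hq0 : 0 ≤ p₁ i) (hiq : h i = q + 1) (hwi : ∀ j < n, h j = q → w i j ≤ p₁ i) :
    Runs placeBin s (200 * (n + 1)) fun s' =>
      s'.rvar 2 = T + max (len i) (p₁ i + load (level h n q) A len i) ∧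
      Packed w len (s'.rarr 1) (insert i (itemsOf h n q A i)) T (s'.rvar 2) ∧
      ∀ j, j ∉ insert i (itemsOf h n q A i) → s'.rarr 1 j = s.rarr 1 j := by
  unfold placeBin
  refine (Runs.seq (B₁ := 3) (Q₁ := fun s' => s' = s.putr 1 i T)
    (B₂ := 6 + ((n * (60 + 9) + 7) + 30)) (Runs.of_run rfl (Nat.le_of_ble_eq_true rfl)
      (by simp [Prog.run, NExp.eval, RExp.eval, hi, hT])) fun s₁ f₁ h₁ =>
    Runs.seq (Q₁ := fun s' => s' = s₁.setr 9 (T + p₁ i)) (B₁ := 6)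
      (Runs.of_run rfl (Nat.le_of_ble_eq_true rfl)
      (by simp [Prog.run, NExp.eval, RExp.eval, f₁.ra 3 rfl, f₁.n 19 rfl, f₁.r 2 rfl, hi, hT, hp₁]))
      fun s₂ f₂ h₂ =>
    Runs.seq (placeItems_runs (h := h) (q := q) (i := i) (r := r) (t := T + p₁ i) (A := A) (w := w)
      (by rw [f₂.n 0 rfl, f₁.n 0 rfl, hn]) (by rw [f₂.n 3 rfl, f₁.n 3 rfl, hq])
      (by rw [f₂.na 0 rfl, f₁.na 0 rfl, hh]) (by rw [f₂.ra 2 rfl, f₁.ra 2 rfl, hlen])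
      (by rw [f₂.n 19 rfl, f₁.n 19 rfl, hi])
      (by rw [f₂.n 18 rfl, f₁.n 18 rfl, hr]) (by rw [f₂.na 2 rfl, f₁.na 2 rfl, hb])
      (by rw [← hA]; simp only [rowOf, f₂.na 1 rfl, f₁.na 1 rfl])
      (by simp [h₂]) hl hw) fun s₃ f₃ ⟨h3, h4, h5⟩ =>
    Runs.of_run rfl (Nat.le_of_ble_eq_true rfl) ?_).le (by omega)
  have e2 : s₃.rarr 2 = len := by rw [f₃.ra 2 rfl, f₂.ra 2 rfl, f₁.ra 2 rfl, hlen]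
  have e19 : s₃.nvar 19 = i := by rw [f₃.n 19 rfl, f₂.n 19 rfl, f₁.n 19 rfl, hi]
  have eT : s₃.rvar 2 = T := by rw [f₃.r 2 rfl, f₂.r 2 rfl, f₁.r 2 rfl, hT]
  have hi' : i ∉ itemsOf h n q A i := fun hc => by rw [mem_itemsOf] at hc; omega
  have e1 : s₃.rarr 1 i = T := by rw [h5 i hi', h₂, h₁]; simp
  have h6 := h4.insert_bin (i := i) e1 hq0 fun j hj => hwi j (mem_itemsOf.1 hj).1.1 (mem_itemsOf.1 hj).1.2
  have h7 : max (T + len i) (s₃.rvar 9) = T + max (len i) (p₁ i + load (level h n q) A len i) := by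
    rw [h3, add_assoc, max_add_add_left]
  have h8 : ∀ j, j ∉ insert i (itemsOf h n q A i) → s₃.rarr 1 j = s.rarr 1 j := fun j hj => by
    rw [mem_insert, not_or] at hj
    rw [h5 j hj.2, h₂, h₁]; simp [hj.1]
  rw [← h7]
  by_cases hc : s₃.rvar 9 ≤ T + len i
  · rw [max_eq_left hc] at h6 ⊢
    simpa [Prog.run, BExp.eval, NExp.eval, RExp.eval, e2, e19, eT, hc] using
      (⟨h6, fun j h1 h2 => h8 j (by simp [h1, h2])⟩ : _ ∧ _)
  · rw [max_eq_right (not_le.1 hc).le] at h6 ⊢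
    simpa [Prog.run, BExp.eval, NExp.eval, RExp.eval, e2, e19, eT, hc] using
      (⟨h6, fun j h1 h2 => h8 j (by simp [h1, h2])⟩ : _ ∧ _)

theorem placeBins_runs {r : ℕ} (hn : s.nvar 0 = n) (hq : s.nvar 3 = q)
    (hh : s.narr 0 = h) (hlen : s.rarr 2 = len) (hp₁ : s.rarr 3 = p₁)
    (hr : s.nvar 18 = r) (hb : s.narr 2 r = r * (n + 1)) (hA : (rowOf n s r).A = A)
    (hT : s.rvar 2 = T) (hl : ∀ j < n, 0 ≤ len j) (hw : ∀ j < n, ∀ k, w j k ≤ len j)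
    (hq0 : ∀ i < n, h i = q + 1 → 0 ≤ p₁ i)
    (hwi : ∀ i < n, h i = q + 1 → ∀ j < n, h j = q → w i j ≤ p₁ i) :
    Runs (forP 19 (.var 0)
      (.cond (.eqN (.cell 0 (.var 19)) (.add (.var 3) (.const 1))) placeBin .skip)) s
      (n * ((20 + 200 * (n + 1)) + 9) + 7) fun s' =>
      s'.rvar 2 = T + ∑ i ∈ level h n (q + 1), max (len i) (p₁ i + load (level h n q) A len i) ∧
      Packed w len (s'.rarr 1)
        ((level h n (q + 1)).biUnion fun i => insert i (itemsOf h n q A i)) T (s'.rvar 2) ∧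
      ∀ j, j ∉ (level h n (q + 1)).biUnion (fun i => insert i (itemsOf h n q A i)) →
        s'.rarr 1 j = s.rarr 1 j := by
  set f : ℕ → ℝ := fun i => max (len i) (p₁ i + load (level h n q) A len i) with hf0
  have hf1 : ∀ i < n, 0 ≤ f i := fun i hi => (hl i hi).trans (le_max_left _ _)
  set U : ℕ → Finset ℕ := fun i => insert i (itemsOf h n q A i) with hU
  refine forVar_runs (x := 19) (y := 0) (N := n) (B := 20 + 200 * (n + 1)) (fun k s' =>
    s'.rvar 2 = T + ∑ i ∈ level h k (q + 1), f i ∧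
      Packed w len (s'.rarr 1) ((level h k (q + 1)).biUnion U) T (s'.rvar 2) ∧
      ∀ j, j ∉ (level h k (q + 1)).biUnion U → s'.rarr 1 j = s.rarr 1 j) rfl rfl hn ?_ ?_
  · simp [hT, level, Packed.empty]
  · intro k s' hk hf hx ⟨h1, h2, h3⟩
    have e0 : s'.narr 0 = h := by rw [hf.na 0 rfl, hh]
    have e3 : s'.nvar 3 = q := by rw [hf.n 3 rfl, hq]
    refine (Runs.cond (B := 200 * (n + 1)) (fun hc => ?_) (fun hc =>
      Runs.of_run rfl (B := 200 * (n + 1)) (by simp only [Prog.time]; omega) ?_)).le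
        (by simp only [BExp.cost, BExp.eqN, NExp.cost]; omega)
    · have hkq : h k = q + 1 := by simpa [NExp.eval, hx, e0, e3] using hc
      refine (placeBin_runs (i := k) (r := r) (A := A) (w := w) (h := h) (q := q)
        (by rw [hf.n 0 rfl, hn]) e3 e0 (by rw [hf.ra 2 rfl, hlen]) (by rw [hf.ra 3 rfl, hp₁]) hx
        (by rw [hf.n 18 rfl, hr]) (by rw [hf.na 2 rfl, hb])
        (by rw [← hA]; simp only [rowOf, hf.na 1 rfl]) h1 hl hw (hq0 k hk hkq) hkq
        (hwi k hk hkq)).mono le_rfl fun s'' f'' ⟨h4, h5, h6⟩ => ?_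
      have hB : (level h (k + 1) (q + 1)).biUnion U = (level h k (q + 1)).biUnion U ∪ U k := by
        rw [level_succ, if_pos hkq, biUnion_insert, union_comm]
      have hdis : ∀ j ∈ (level h k (q + 1)).biUnion U, j ∉ U k := fun j hj hj' => by
        simp only [hU, mem_biUnion, mem_insert, mem_level, mem_itemsOf] at hj hj'
        obtain ⟨i, hi, hj⟩ := hj
        rcases hj with rfl | hj <;> rcases hj' with rfl | hj' <;> omega
      have h0 : 0 ≤ ∑ i ∈ level h k (q + 1), f i :=
        Finset.sum_nonneg fun i hi => hf1 i ((mem_level.1 hi).1.trans hk)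
      refine ⟨?_, ?_, fun j hj => ?_⟩
      · rw [State.setn_rvar, h4, sum_level_succ, if_pos hkq]; ring
      · rw [hB]
        refine Packed.append (mid := s'.rvar 2) ?_ ?_ (by rw [h1]; linarith) ?_ fun j hj m => hw j ?_ m
        · exact h2.congr fun j hj => h6 j (hdis j hj)
        · rw [h1]; exact h5
        · rw [State.setn_rvar, h4, h1]
          have := hf1 k hk
          simp only [hf0] at this
          linarith
        · simp only [hU, mem_union, mem_biUnion, mem_insert, mem_level, mem_itemsOf] at hj
          rcases hj with ⟨i, hi, rfl | hj⟩ | rfl | hj <;> omega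
      · rw [hB, mem_union, not_or] at hj
        exact (h6 j hj.2).trans (h3 j hj.1)
    · have hkq : h k ≠ q + 1 := by simpa [NExp.eval, hx, e0, e3] using hc
      simp only [Prog.run, State.setn_rvar, State.setn_rarr, level_succ, if_neg hkq]
      exact ⟨h1, h2, h3⟩

theorem placeRest_runs {r : ℕ} {D S : Finset ℕ} {T₀ : ℝ} (hn : s.nvar 0 = n) (hq : s.nvar 3 = q)
    (hh : s.narr 0 = h) (hlen : s.rarr 2 = len)
    (hr : s.nvar 18 = r) (hb : s.narr 2 r = r * (n + 1)) (hA : (rowOf n s r).A = A)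
    (hT : s.rvar 2 = T) (hl : ∀ j < n, 0 ≤ len j) (hw : ∀ j < n, ∀ k, w j k ≤ len j)
    (hD : ∀ j < n, (∀ i ∈ D, A j ≠ i + 1) ↔ ¬ (1 ≤ A j ∧ A j ≤ n))
    (hS : Packed w len (s.rarr 1) S T₀ T) (hST : T₀ ≤ T) (hSn : ∀ j ∈ S, j < n)
    (hSd : ∀ j ∈ S, j ∉ unplaced (level h n q) D A) :
    Runs (forP 20 (.var 0)
      (.cond (.and (.eqN (.cell 0 (.var 20)) (.var 3))
          (.not (.and (.leN (.const 1) (cellA 18 20)) (.leN (cellA 18 20) (.var 0)))))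
        (.storeR 1 (.var 20) (.var 2) ;; .setR 2 (.add (.var 2) (.cell 2 (.var 20)))) .skip)) s
      (n * (60 + 9) + 7) fun s' =>
      s'.rvar 2 = T + ∑ j ∈ unplaced (level h n q) D A, len j ∧
      Packed w len (s'.rarr 1) (S ∪ unplaced (level h n q) D A) T₀ (s'.rvar 2) ∧
      ∀ j, j ∉ unplaced (level h n q) D A → s'.rarr 1 j = s.rarr 1 j := by
  have hU : ∀ k, unplaced (level h (k + 1) q) D A = if h k = q ∧ ∀ i ∈ D, A k ≠ i + 1 then
      unplaced (level h k q) D A ∪ {k} else unplaced (level h k q) D A := fun k => by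
    ext j
    split_ifs with hc <;> simp only [unplaced, mem_union, mem_filter, mem_level, mem_singleton]
    · by_cases hjk : j = k
      · subst hjk; simpa [hc.1] using hc.2
      · simp [hjk, show j < k + 1 ↔ j < k by omega]
    · by_cases hjk : j = k
      · subst hjk; simpa using hc
      · simp [show j < k + 1 ↔ j < k by omega]
  refine forVar_runs (x := 20) (y := 0) (N := n) (B := 60) (fun k s' =>
    s'.rvar 2 = T + ∑ j ∈ unplaced (level h k q) D A, len j ∧
      Packed w len (s'.rarr 1) (S ∪ unplaced (level h k q) D A) T₀ (s'.rvar 2) ∧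
      ∀ j, j ∉ unplaced (level h k q) D A → s'.rarr 1 j = s.rarr 1 j) rfl rfl hn ?_ ?_
  · simpa [hT, level, unplaced] using hS
  · intro k s' hk hf hx ⟨h1, h2, h3⟩
    have e0 : s'.narr 0 = h := by rw [hf.na 0 rfl, hh]
    have en : s'.nvar 0 = n := by rw [hf.n 0 rfl, hn]
    have e2 : s'.rarr 2 = len := by rw [hf.ra 2 rfl, hlen]
    have e3 : s'.nvar 3 = q := by rw [hf.n 3 rfl, hq]
    have eA : (cellA 18 20).eval s' = A k := by
      rw [eval_cellA (r' := r) (n := n) (by rw [hf.n 18 rfl, hr, hf.na 2 rfl, hb]) hx (by omega), ← hA]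
      simp only [rowOf, hf.na 1 rfl]
    refine Runs.of_run rfl (Nat.le_of_ble_eq_true rfl) ?_
    have hlt : ∀ j ∈ unplaced (level h k q) D A, j < k := fun j hj => by
      simp only [unplaced, mem_filter, mem_level] at hj; exact hj.1.1
    have h0 : 0 ≤ ∑ j ∈ unplaced (level h k q) D A, len j :=
      Finset.sum_nonneg fun j hj => hl j ((hlt j hj).trans hk)
    by_cases hc : h k = q ∧ ∀ i ∈ D, A k ≠ i + 1
    · have hc' := (hD k hk).1 hc.2
      have hkU : k ∈ unplaced (level h n q) D A := by
        simp only [unplaced, mem_filter, mem_level]; exact ⟨⟨hk, hc.1⟩, hc.2⟩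
      have hne : ∀ j ∈ S ∪ unplaced (level h k q) D A, j ≠ k := fun j hj hjk => by
        rcases mem_union.1 hj with hj | hj
        · exact hSd j hj (hjk ▸ hkU)
        · exact (hlt j hj).ne hjk
      have hsum : ∑ j ∈ unplaced (level h (k + 1) q) D A, len j
          = ∑ j ∈ unplaced (level h k q) D A, len j + len k := by
        rw [hU, if_pos hc, Finset.sum_union (by simpa using fun hj => (hlt k hj).false),
          Finset.sum_singleton]
      simp only [Prog.run, BExp.eval, BExp.eval_eqN, NExp.eval, RExp.eval, hx, en, e0, e3, eA, hc.1,
        hc', not_false_eq_true, and_self, if_true, State.setr_rvar, State.setn_rvar,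
        State.putr_rvar, State.setr_rarr, State.setn_rarr, State.putr_nvar, h1, hsum]
      rw [hU, if_pos hc]
      refine ⟨by simp [e2, add_assoc], ?_, fun j hj => ?_⟩
      · rw [← union_assoc]
        refine Packed.append (mid := T + ∑ j ∈ unplaced (level h k q) D A, len j) ?_
          (Packed.singleton (by simp) (by simp [e2])) (by linarith) (by simp [e2]; linarith [hl k hk])
          fun j hj m => hw j ?_ m
        · rw [← h1]
          exact h2.congr fun j hj => by simp [hne j hj]
        · simp only [mem_union, mem_singleton] at hj
          rcases hj with (hj | hj) | rfl
          exacts [hSn j hj, (hlt j hj).trans hk, hk]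
      · rw [mem_union, mem_singleton, not_or] at hj
        simp [hj.2, h3 j hj.1]
    · have hc' : ¬ (h k = q ∧ ¬ (1 ≤ A k ∧ A k ≤ n)) := fun h' => hc ⟨h'.1, (hD k hk).2 h'.2⟩
      simp only [Prog.run, BExp.eval, BExp.eval_eqN, NExp.eval, hx, en, e0, e3, eA, hc', if_false,
        State.setn_rvar, State.setn_rarr]
      rw [hU, if_neg hc]
      exact ⟨h1, h2, h3⟩

theorem placeClass_runs {r : ℕ} (hn : s.nvar 0 = n) (hq : s.nvar 3 = q)
    (hh : s.narr 0 = h) (hlen : s.rarr 2 = len) (hp₁ : s.rarr 3 = p₁)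
    (hr : s.nvar 18 = r) (hb : s.narr 2 r = r * (n + 1)) (hA : (rowOf n s r).A = A)
    (hT : s.rvar 2 = T) (hl : ∀ j < n, 0 ≤ len j) (hw : ∀ j < n, ∀ k, w j k ≤ len j)
    (hq0 : ∀ i < n, h i = q + 1 → 0 ≤ p₁ i)
    (hwi : ∀ i < n, h i = q + 1 → ∀ j < n, h j = q → w i j ≤ p₁ i)
    (hAD : ∀ j < n, ∀ i < n, A j = i + 1 → h i = q + 1) :
    Runs placeClass s (300 * (n + 1) ^ 2) fun s' =>
      s'.rvar 2 = T + classCost (level h n q) (level h n (q + 1)) len p₁ A ∧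
      Packed w len (s'.rarr 1) (level h n q ∪ level h n (q + 1)) T (s'.rvar 2) ∧
      ∀ j, j ∉ level h n q ∪ level h n (q + 1) → s'.rarr 1 j = s.rarr 1 j := by
  unfold placeClass
  set I := level h n q with hI
  set D := level h n (q + 1) with hD
  -- Two entries mean that an item is in no bin: 0 for an item never moved and `n + 1` for one
  -- poured when all bins were full. Every value in between is a bin of the class by `hAD`.
  have hun : ∀ j < n, (∀ i ∈ D, A j ≠ i + 1) ↔ ¬ (1 ≤ A j ∧ A j ≤ n) := fun j hj => by
    constructor
    · rintro h1 ⟨h2, h3⟩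
      refine h1 (A j - 1) (mem_level.2 ⟨by omega, hAD j hj _ (by omega) ?_⟩) ?_ <;> omega
    · intro h1 i hi h2
      have := (mem_level.1 hi).1
      omega
  have hset : D.biUnion (fun i => insert i (itemsOf h n q A i)) ∪ unplaced I D A = I ∪ D := by
    ext j
    simp only [mem_union, mem_biUnion, mem_insert, unplaced, mem_filter, itemsOf, ← hI]
    constructor
    · rintro (⟨i, hi, rfl | hj⟩ | hj)
      exacts [Or.inr hi, Or.inl hj.1, Or.inl hj.1]
    · rintro (hj | hj)
      · by_cases hc : ∀ i ∈ D, A j ≠ i + 1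
        · exact Or.inr ⟨hj, hc⟩
        · push Not at hc
          obtain ⟨i, hi, h1⟩ := hc
          exact Or.inl ⟨i, hi, Or.inr ⟨hj, h1⟩⟩
      · exact Or.inl ⟨j, hj, Or.inl rfl⟩
  refine (Runs.seq (placeBins_runs hn hq hh hlen hp₁ hr hb hA hT hl hw hq0 hwi)
    fun s₁ f₁ ⟨h1, h2, h3⟩ => (placeRest_runs (h := h) (q := q) (D := D) (T₀ := T) (by rw [f₁.n 0 rfl, hn])
      (by rw [f₁.n 3 rfl, hq]) (by rw [f₁.na 0 rfl, hh]) (by rw [f₁.ra 2 rfl, hlen])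
      (by rw [f₁.n 18 rfl, hr]) (by rw [f₁.na 2 rfl, hb])
      (by rw [← hA]; simp only [rowOf, f₁.na 1 rfl]) rfl hl hw hun h2 ?_ ?_ ?_).mono le_rfl
      fun s₂ f₂ h' => ?_).le ?_
  · rw [h1]
    have : 0 ≤ ∑ i ∈ D, max (len i) (p₁ i + load I A len i) :=
      Finset.sum_nonneg fun i hi => (hl i (mem_level.1 hi).1).trans (le_max_left _ _)
    linarith
  · intro j hj
    simp only [mem_biUnion, mem_insert, mem_level, mem_itemsOf] at hj
    obtain ⟨i, hi, rfl | hj⟩ := hj <;> omega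
  · intro j hj hj'
    simp only [mem_biUnion, mem_insert, mem_itemsOf, unplaced, mem_filter] at hj hj'
    obtain ⟨i, hi, rfl | hj⟩ := hj
    · have h7 := (mem_level.1 hi).2
      have h8 := (mem_level.1 hj'.1).2
      omega
    · exact hj'.2 i hi hj.2
  · obtain ⟨h4, h5, h6⟩ := h'
    refine ⟨by rw [h4, h1, classCost]; ring, by rwa [hset] at h5, fun j hj => ?_⟩
    rw [← hset, mem_union, not_or] at hj
    exact (h6 j hj.2).trans (h3 j hj.1)
  · have e1 : n * (20 + 200 * (n + 1) + 9) + 7 + (n * (60 + 9) + 7) = 200 * (n * n) + 298 * n + 14 := by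
      ring
    have e2 : 300 * (n + 1) ^ 2 = 300 * (n * n) + 600 * n + 300 := by ring
    rw [e1, e2]
    omega

end

end MatchUp


/-! ### Approximation guarantee for one class. -/

namespace MatchUp

open Finset RealRAM

section

variable {n q : ℕ} {s : State} {h : ℕ → ℕ} {len p₁ : ℕ → ℝ} {w : ℕ → ℕ → ℝ} {ε T : ℝ}

/-- Even if every bin used its allowance, the excess over `F` would be at most `ε` times the sum of
the gaps. This is the term that `classCost_le_of_unused_le` tolerates. -/
theorem Valid.unused_le {rep g : ℕ → ℝ} {a : ℝ} {Q D : Finset ℕ} {y : Row}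
    (hy : Valid n rep g ε a Q Q y) (hQ : Q ⊆ D) (hε : 0 ≤ ε) (hg : ∀ i ∈ D, 0 ≤ g i) :
    unused Q (range n) rep g y.A ≤ y.F + ε * ∑ i ∈ D, g i := by
  have h1 : unused Q (range n) rep g y.A = ∑ i ∈ Q, max 0 (y.R i) :=
    Finset.sum_congr rfl fun i hi => by rw [hy.cap i hi]
  have h2 := hy.sum
  rw [Finset.sum_sub_distrib] at h2
  have h3 : ∑ i ∈ Q, (if y.R i ≤ 0 then ε * g i else 0) ≤ ∑ i ∈ Q, ε * g i :=
    Finset.sum_le_sum fun i hi => by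
      split_ifs
      · exact le_rfl
      · exact mul_nonneg hε (hg i (hQ hi))
  have h4 : ∑ i ∈ Q, ε * g i ≤ ∑ i ∈ D, ε * g i :=
    Finset.sum_le_sum_of_subset_of_nonneg hQ fun i hi _ => mul_nonneg hε (hg i hi)
  rw [Finset.mul_sum, h1]
  linarith

/-- The selected row has least `F`, hence `F` at most the unused gap of the relevant part of each
`X`. The comparison is with all assignments at once, so no optimal one has to be named. -/
theorem solveClass_runs {K M Nm : ℕ} (hn : s.nvar 0 = n) (hq : s.nvar 3 = q)
    (hh : s.narr 0 = h) (hlen : s.rarr 2 = len) (hp₁ : s.rarr 3 = p₁) (hε : s.rvar 0 = ε)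
    (hr : s.rvar 1 = n) (hT : s.rvar 2 = T) (hn0 : 0 < n) (hε0 : 0 < ε) (hε1 : ε ≤ 1 / 2)
    (hl : ∀ j < n, 0 ≤ len j) (hw : ∀ j < n, ∀ k, w j k ≤ len j)
    (hq0 : ∀ i < n, h i = q + 1 → 0 ≤ p₁ i) (hqs : ∀ i < n, h i = q + 1 → p₁ i ≤ len i)
    (hwi : ∀ i < n, h i = q + 1 → ∀ j < n, h j = q → w i j ≤ p₁ i)
    (hK : 1 / (ε * ε) < (1 + ε) ^ K) (hM : 1 / (1 + ε) ^ M ≤ ε * ε / n)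
    (hNm : 1 + M * ((n + 1) * (n + 1) ^ (2 * K)) ≤ Nm) :
    Runs solveClass s (5000 * ((M + 1) * ((n + 1) ^ 4 * (Nm + 1) ^ 2))) fun s' =>
      T ≤ s'.rvar 2 ∧ (∀ X, s'.rvar 2 ≤
        T + (1 + 12 * ε) * classCost (level h n q) (level h n (q + 1)) len p₁ X) ∧
      Packed w len (s'.rarr 1) (level h n q ∪ level h n (q + 1)) T (s'.rvar 2) ∧
      ∀ j, j ∉ level h n q ∪ level h n (q + 1) → s'.rarr 1 j = s.rarr 1 j := by
  unfold solveClass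
  set I := level h n q with hI
  set D := level h n (q + 1) with hD
  set A := ∑ i ∈ D, len i + ∑ j ∈ I, len j with hA
  set δ := ε * ε * A / n with hδ
  have hlI : ∀ j ∈ I, 0 ≤ len j := fun j hj => hl j (mem_level.1 hj).1
  have hlD : ∀ j ∈ D, 0 ≤ len j := fun j hj => hl j (mem_level.1 hj).1
  have hSI : 0 ≤ ∑ j ∈ I, len j := Finset.sum_nonneg hlI
  have hSD : 0 ≤ ∑ i ∈ D, len i := Finset.sum_nonneg hlD
  have hA0 : 0 ≤ A := by positivity
  have hδ0 : 0 ≤ δ := by positivity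
  have hAM : A / (1 + ε) ^ M ≤ δ := by
    have := mul_le_mul_of_nonneg_left hM hA0
    rw [hδ, div_eq_mul_one_div A]
    exact this.trans (le_of_eq (by ring))
  have hI' : ∀ j < n, h j = q → len j ≤ A := fun j hj hjq => by
    have := Finset.single_le_sum hlI (mem_level.2 ⟨hj, hjq⟩)
    linarith
  have hD' : ∀ j < n, h j = q + 1 → ε * (len j - p₁ j) ≤ A := fun j hj hjq => by
    have h1 := Finset.single_le_sum hlD (mem_level.2 ⟨hj, hjq⟩)
    have h2 := hq0 j hj hjq
    have h3 : ε * (len j - p₁ j) ≤ 1 * (len j - p₁ j) :=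
      mul_le_mul_of_nonneg_right (by linarith) (by linarith [hqs j hj hjq])
    linarith
  set U := (n + 1) ^ 4 * (Nm + 1) ^ 2 with hU
  refine (Runs.seq (B₁ := 60 * (n + 1))
    (B₂ := 200 * ((n + 1) * (M + 1)) + (4000 * ((M + 1) * U) + (60 * (Nm + 1) + 300 * (n + 1) ^ 2)))
    (totals_runs hn hq hh hlen hε hr) fun s₁ f₁ ⟨h1, h1'⟩ => Runs.seq
    (rounding_runs (A := A) (δ := δ) (p₁ := p₁) (len := len) (h := h) (q := q) (M := M) (n := n)
      (by rw [f₁.n 0 rfl, hn]) (by rw [f₁.n 3 rfl, hq])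
      (by rw [f₁.na 0 rfl, hh]) (by rw [f₁.ra 2 rfl, hlen]) (by rw [f₁.ra 3 rfl, hp₁])
      (by rw [f₁.r 0 rfl, hε]) h1 h1' hε0 hA0 hδ0 hAM hI' hD')
    fun s₂ f₂ h2 => Runs.seq
    (dynamicProg_runs (g := fun i => len i - p₁ i) (n := n) (ε := ε) (A := A) (δ := δ) (K := K)
      (M := M) (Nm := Nm)
      (by rw [f₂.n 0 rfl, f₁.n 0 rfl, hn]) rfl rfl (by rw [f₂.r 0 rfl, f₁.r 0 rfl, hε])
      ((f₂.r 3 rfl).trans h1) ((f₂.r 4 rfl).trans h1') hε0 (by linarith) hA0 hδ0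
      (fun i _ => by rw [f₂.ra 2 rfl, f₁.ra 2 rfl, hlen, f₂.ra 3 rfl, f₁.ra 3 rfl, hp₁])
      (fun i hi h0 => ?_) (fun j hj => (h2 j hj).1) (fun j hj => (h2 j hj).2.1) hK hAM hNm)
    fun s₃ f₃ h3 => ?_).le ?_
  · have h4 := (h2 i hi).2.2.2.2
    have h5 := h4.1 (by_contra fun hc => h0 (h4.2 hc))
    rcases h5 with h5 | h5
    · exact h5.2.1
    · exact absurd h5.1 h0
  · obtain ⟨hb, hN, hV, hX⟩ := h3
    obtain ⟨N, hN'⟩ : ∃ N, s₃.nvar 4 = N := ⟨_, rfl⟩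
    rw [hN'] at hb hN hV hX
    set rep := s₂.rarr 4 with hrep
    set lev := s₂.rarr 5 with hlev
    have hN0 : 0 < N := by obtain ⟨r, hr, -⟩ := hX fun _ => 0; omega
    have hQD : opened n lev δ ⊆ D := fun i hi => by
      obtain ⟨h5, h6⟩ := mem_filter.1 hi
      have h7 := mem_range.1 h5
      refine mem_level.2 ⟨h7, by_contra fun hc => ?_⟩
      have := (h2 i h7).2.2.2.2.2 hc
      linarith
    refine Runs.seq (B₁ := 60 * (Nm + 1)) ((bestRow_runs hN' hN0).le (by omega))
      fun s₄ f₄ ⟨h5, h6⟩ => ?_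
    obtain ⟨r, hr'⟩ : ∃ r, s₄.nvar 18 = r := ⟨_, rfl⟩
    rw [hr'] at h5 h6
    set y := rowOf n s₃ r with hy
    have hVy := hV r h5
    have hy4 : (rowOf n s₄ r).A = y.A := by simp only [hy, rowOf, f₄.na 1 rfl]
    refine (placeClass_runs (h := h) (q := q) (T := T) (A := y.A) (len := len) (p₁ := p₁) (w := w)
      (r := r) (n := n)
      (by rw [f₄.n 0 rfl, f₃.n 0 rfl, f₂.n 0 rfl, f₁.n 0 rfl, hn])
      (by rw [f₄.n 3 rfl, f₃.n 3 rfl, f₂.n 3 rfl, f₁.n 3 rfl, hq])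
      (by rw [f₄.na 0 rfl, f₃.na 0 rfl, f₂.na 0 rfl, f₁.na 0 rfl, hh])
      (by rw [f₄.ra 2 rfl, f₃.ra 2 rfl, f₂.ra 2 rfl, f₁.ra 2 rfl, hlen])
      (by rw [f₄.ra 3 rfl, f₃.ra 3 rfl, f₂.ra 3 rfl, f₁.ra 3 rfl, hp₁])
      hr' (by rw [f₄.na 2 rfl, hb r h5.le]) hy4
      (by rw [f₄.r 2 rfl, f₃.r 2 rfl, f₂.r 2 rfl, f₁.r 2 rfl, hT]) hl hw hq0 hwi
      (fun j hj i hi hji => ?_)).mono le_rfl fun s₅ f₅ h7 => ?_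
    · by_contra hc
      refine hVy.none i hi (fun hi' => hc (mem_level.1 (hQD hi')).2) j hj hji
    · obtain ⟨h7, h8, h9⟩ := h7
      have e1 : s₄.rarr 1 = s.rarr 1 := by rw [f₄.ra 1 rfl, f₃.ra 1 rfl, f₂.ra 1 rfl, f₁.ra 1 rfl]
      have hc0 : 0 ≤ classCost I D len p₁ y.A := by
        refine add_nonneg (Finset.sum_nonneg fun i hi => (hlD i hi).trans (le_max_left _ _))
          (Finset.sum_nonneg fun j hj => hlI j (mem_filter.1 hj).1)
      refine ⟨by rw [h7]; linarith, fun X => ?_, h8, fun j hj => by rw [h9 j hj, e1]⟩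
      rw [h7]
      gcongr
      obtain ⟨r', hr1, hr2⟩ := hX X
      refine classCost_le_of_unused_le (F := y.F) hn0 hε0 hε1
        (fun j hj => mem_range.2 (mem_level.1 hj).1) (fun j hj => mem_range.2 (mem_level.1 hj).1)
        hlI (fun i hi => hq0 i (mem_level.1 hi).1 (mem_level.1 hi).2)
        (fun i hi => hqs i (mem_level.1 hi).1 (mem_level.1 hi).2) hA hδ
        (fun j hj => (h2 j (mem_level.1 hj).1).2.2.1 (mem_level.1 hj).2)
        (fun j hj hjI => (h2 j hj).2.2.2.1 fun hc => hjI (mem_level.2 ⟨hj, hc⟩))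
        (fun j hj => (h2 j (mem_level.1 hj).1).2.2.2.2.1 (mem_level.1 hj).2)
        (fun j hj hjI => (h2 j hj).2.2.2.2.2 fun hc => hjI (mem_level.2 ⟨hj, hc⟩))
        (hVy.unused_le hQD hε0.le fun i hi =>
          sub_nonneg.2 (hqs i (mem_level.1 hi).1 (mem_level.1 hi).2)) ((h6 r' hr1).trans hr2)
  · have e1 : (n + 1) ^ 2 ≤ U :=
      (Nat.pow_le_pow_right (by omega) (by omega)).trans (Nat.le_mul_of_pos_right _ (by positivity))
    have e2 : n + 1 ≤ (n + 1) ^ 2 := Nat.le_self_pow (by omega) _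
    have e3 : Nm + 1 ≤ U :=
      (Nat.le_self_pow (by omega) _).trans (Nat.le_mul_of_pos_left _ (by positivity))
    have e4 : U ≤ (M + 1) * U := Nat.le_mul_of_pos_left _ (by omega)
    have e5 : (n + 1) * (M + 1) ≤ (M + 1) * U := by
      rw [mul_comm]; exact Nat.mul_le_mul_left _ (e2.trans e1)
    omega

end

end MatchUp


/-! ### Reading the input; every makespan bounds the cost of each class. -/

theorem List.getD_flatten_of_lt {α : Type*} (d : α) : ∀ (L : List (List α)) (B i : ℕ)
    (hB : B < L.length), i < L[B].length →
    L.flatten.getD (((L.map List.length).take B).sum + i) d = L[B].getD i d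
  | l :: L, 0, i, _, hi => by
    simp only [List.getElem_cons_zero] at hi
    simp [List.getElem?_append_left hi]
  | l :: L, B + 1, i, hB, hi => by
    have ih := List.getD_flatten_of_lt d L B i (by simpa using hB) (by simpa using hi)
    simp only [List.flatten_cons, List.map_cons, List.take_succ_cons, List.sum_cons,
      List.getElem_cons_succ]
    rw [List.getD_append_right _ _ _ _ (by omega), ← ih]
    congr 1
    omega

namespace MatchUp

open Finset RealRAM

namespace Instance

variable (Ψ : Instance)

/-- The height of job `k`. -/
def ht (k : ℕ) : ℕ := if hk : k < Ψ.n then Ψ.h ⟨k, hk⟩ else 0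

/-- The processing time of job `k` in layer `i`. -/
noncomputable def proc (k i : ℕ) : ℝ := if hk : k < Ψ.n then Ψ.p ⟨k, hk⟩ i else 0

/-- The processing time of job `j` in the highest layer that it shares with job `k`. -/
noncomputable def common (j k : ℕ) : ℝ := Ψ.proc j (max 1 (min (Ψ.ht j) (Ψ.ht k)))

variable {Ψ} {j k i : ℕ}

theorem ht_pos (hj : j < Ψ.n) : 1 ≤ Ψ.ht j := by
  rw [ht, dif_pos hj]; exact Ψ.one_le_h _

theorem ht_le (hj : j < Ψ.n) : Ψ.ht j ≤ Ψ.L := by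
  rw [ht, dif_pos hj]; exact Finset.le_sup (f := Ψ.h) (mem_univ _)

theorem proc_nonneg (hj : j < Ψ.n) (h1 : 1 ≤ i) (h2 : i ≤ Ψ.ht j) : 0 ≤ Ψ.proc j i := by
  rw [proc, dif_pos hj]
  rw [ht, dif_pos hj] at h2
  exact Ψ.p_nonneg _ _ h1 h2

theorem proc_mono (hj : j < Ψ.n) {i' : ℕ} (h1 : 1 ≤ i) (h : i ≤ i') (h2 : i' ≤ Ψ.ht j) :
    Ψ.proc j i ≤ Ψ.proc j i' := by
  rw [proc, proc, dif_pos hj, dif_pos hj]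
  rw [ht, dif_pos hj] at h2
  exact Ψ.p_mono _ _ _ h1 h h2

/-- The `max 1` in `common` covers a `k` out of range, whose height is 0; the bound thus needs no
hypothesis on `k`. -/
theorem common_le (hj : j < Ψ.n) (k : ℕ) : Ψ.common j k ≤ Ψ.proc j (Ψ.ht j) :=
  proc_mono hj (le_max_left _ _) (max_le (ht_pos hj) (min_le_left _ _)) le_rfl

theorem sup_ht : (range Ψ.n).sup Ψ.ht = Ψ.L := by
  refine le_antisymm (Finset.sup_le fun j hj => ht_le (mem_range.1 hj)) (Finset.sup_le fun B _ => ?_)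
  have := Finset.le_sup (f := Ψ.ht) (mem_range.2 B.2)
  rwa [ht, dif_pos B.2] at this

theorem layerList_getD (hj : j < Ψ.n) (hi : i < Ψ.ht j) :
    Ψ.layerList.getD (∑ k ∈ range j, Ψ.ht k + i) 0 = Ψ.proc j (i + 1) := by
  rw [ht, dif_pos hj] at hi
  set f : Fin Ψ.n → List ℝ := fun B => (List.range (Ψ.h B)).map fun i => Ψ.p B (i + 1) with hf
  have h1 := List.getD_flatten_of_lt (0 : ℝ) (List.ofFn f) j i (by simpa using hj) (by simpa [hf] using hi)
  have h2 : ∀ m ≤ Ψ.n, (((List.ofFn f).map List.length).take m).sum = ∑ k ∈ range m, Ψ.ht k := by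
    intro m hm
    induction m with
    | zero => simp
    | succ m ih =>
      rw [List.sum_take_succ _ _ (by simpa using hm), ih (by omega), Finset.sum_range_succ]
      simp [hf, ht, show m < Ψ.n by omega]
  rw [h2 j hj.le] at h1
  rw [layerList, h1]
  simp [hf, proc, hj, hi]

end Instance

variable {Ψ : Instance} {ε : ℝ}

theorem input_narr : (Ψ.input ε).narr 0 = Ψ.ht := rfl

theorem setup_runs : Runs setup (Ψ.input ε) (Ψ.n * (60 + 9) + 7) fun s =>
    s.nvar 1 = Ψ.L ∧ s.rvar 1 = Ψ.n ∧ ∀ j < Ψ.n, s.rarr 2 j = Ψ.proc j (Ψ.ht j) ∧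
      (2 ≤ Ψ.ht j → s.rarr 3 j = Ψ.proc j (Ψ.ht j - 1)) := by
  refine (forVar_runs (x := 17) (y := 0) (N := Ψ.n) (B := 60) (fun k s =>
    s.nvar 1 = (range k).sup Ψ.ht ∧ s.rvar 1 = k ∧ s.nvar 2 = ∑ j ∈ range k, Ψ.ht j ∧
      ∀ j < k, s.rarr 2 j = Ψ.proc j (Ψ.ht j) ∧
      (2 ≤ Ψ.ht j → s.rarr 3 j = Ψ.proc j (Ψ.ht j - 1))) rfl rfl (by simp [Instance.input])
      ?_ ?_).mono le_rfl fun s _ h => ⟨h.1.trans Instance.sup_ht, h.2.1, h.2.2.2⟩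
  · simp [Instance.input]
  · intro k s hk hf hx ⟨h1, h2, h3, h4⟩
    have e0 : s.narr 0 = Ψ.ht := (hf.na 0 rfl).trans input_narr
    have e1 : ∀ m, s.rarr 0 m = Ψ.layerList.getD m 0 := fun m => by
      rw [hf.ra 0 rfl]; rfl
    have hp := Instance.ht_pos hk
    have g1 : s.rarr 0 (∑ j ∈ range k, Ψ.ht j + Ψ.ht k - 1) = Ψ.proc k (Ψ.ht k) := by
      rw [e1, Nat.add_sub_assoc hp, Instance.layerList_getD hk (by omega), Nat.sub_add_cancel hp]
    -- For a job of height 1 the program reads a cell that does not belong to it. The value is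
    -- harmless, since bins have height at least 2.
    have g2 : 2 ≤ Ψ.ht k → s.rarr 0 (∑ j ∈ range k, Ψ.ht j + Ψ.ht k - 2) = Ψ.proc k (Ψ.ht k - 1) :=
      fun h => by
        rw [e1, Nat.add_sub_assoc h, Instance.layerList_getD hk (by omega)]
        congr 1
        omega
    have hmem : ∀ j < k + 1, (if j = k then s.rarr 0 (∑ j ∈ range k, Ψ.ht j + Ψ.ht k - 1)
        else s.rarr 2 j) = Ψ.proc j (Ψ.ht j) ∧ (2 ≤ Ψ.ht j →
        (if j = k then s.rarr 0 (∑ j ∈ range k, Ψ.ht j + Ψ.ht k - 2) else s.rarr 3 j)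
          = Ψ.proc j (Ψ.ht j - 1)) := fun j hj => by
      by_cases hjk : j = k
      · subst hjk; simpa [g1] using g2
      · simpa [hjk] using h4 j (by omega)
    refine Runs.of_run rfl (Nat.le_of_ble_eq_true rfl) ?_
    have hs : (range (k + 1)).sup Ψ.ht = max ((range k).sup Ψ.ht) (Ψ.ht k) := by
      rw [Finset.range_add_one, Finset.sup_insert, max_comm]
    rw [Finset.sum_range_succ, hs]
    by_cases hc : (range k).sup Ψ.ht < Ψ.ht k
    · rw [max_eq_right hc.le]
      simpa [Prog.run, NExp.eval, RExp.eval, hx, e0, h1, h2, h3, hc] using hmem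
    · rw [max_eq_left (not_lt.1 hc)]
      simpa [Prog.run, NExp.eval, RExp.eval, hx, e0, h1, h2, h3, hc] using hmem

theorem makespan_nonneg {τ : Fin Ψ.n → ℝ} (hτ : Ψ.Feasible τ) : 0 ≤ Ψ.makespan τ :=
  (add_nonneg (hτ.1 ⟨0, Ψ.n_pos⟩) (Ψ.p_nonneg _ _ (Ψ.one_le_h _) le_rfl)).trans
    (Finset.le_sup' (fun B => τ B + Ψ.p B (Ψ.h B)) (mem_univ ⟨0, Ψ.n_pos⟩))

/-- Layer `q` keeps items apart from each other and from the lower parts of bins; layer `q + 1`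
keeps the bins apart. No other layer and no other job is needed for the lower bound. -/
theorem exists_classCost_le_makespan {τ : Fin Ψ.n → ℝ} (hτ : Ψ.Feasible τ) {q : ℕ} (hq : 1 ≤ q)
    {len p₁ : ℕ → ℝ} (hlen : ∀ j < Ψ.n, len j = Ψ.proc j (Ψ.ht j))
    (hp₁ : ∀ j < Ψ.n, 2 ≤ Ψ.ht j → p₁ j = Ψ.proc j (Ψ.ht j - 1)) :
    ∃ X, classCost (level Ψ.ht Ψ.n q) (level Ψ.ht Ψ.n (q + 1)) len p₁ X ≤ Ψ.makespan τ := by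
  set t : ℕ → ℝ := fun j => if hj : j < Ψ.n then τ ⟨j, hj⟩ else 0 with ht
  have hM : ∀ j < Ψ.n, t j + len j ≤ Ψ.makespan τ := fun j hj => by
    rw [hlen j hj, Instance.proc, dif_pos hj, Instance.ht, dif_pos hj, ht]
    simp only [dif_pos hj]
    exact Finset.le_sup' (fun B => τ B + Ψ.p B (Ψ.h B)) (mem_univ (⟨j, hj⟩ : Fin Ψ.n))
  have hlp : ∀ j < Ψ.n, ∀ i, 1 ≤ i → i ≤ Ψ.ht j → ∀ k < Ψ.n, i ≤ Ψ.ht k → j ≠ k →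
      t j + Ψ.proc j i ≤ t k ∨ t k + Ψ.proc k i ≤ t j := by
    intro j hj i hi hij k hk hik hjk
    have h1 := hij.trans (Instance.ht_le hj)
    rw [Instance.ht, dif_pos hj] at hij
    rw [Instance.ht, dif_pos hk] at hik
    have := hτ.2 i hi h1 ⟨k, hk⟩ ⟨j, hj⟩ (by simpa using hjk.symm) (le_min hik hij)
    simpa [ht, hj, hk, Instance.proc] using this
  have hs : ∀ j < Ψ.n, 0 ≤ len j := fun j hj => by
    rw [hlen j hj]; exact Instance.proc_nonneg hj (Instance.ht_pos hj) le_rfl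
  have hD : ∀ i ∈ level Ψ.ht Ψ.n (q + 1), i < Ψ.n ∧ Ψ.ht i = q + 1 ∧ p₁ i = Ψ.proc i q :=
    fun i hi => by
      obtain ⟨h1, h2⟩ := mem_level.1 hi
      exact ⟨h1, h2, by rw [hp₁ i h1 (by omega), h2, Nat.add_sub_cancel]⟩
  refine exists_classCost_le (τ := t) ?_ (makespan_nonneg hτ)
    (fun j hj => hs j (mem_level.1 hj).1)
    (fun i hi => ?_) (fun i hi => ?_) (fun j => ?_) (fun j hj => hM j (mem_level.1 hj).1)
    (fun j hj => hM j (mem_level.1 hj).1) (fun j hj k hk hjk => ?_) (fun j hj k hk hjk => ?_)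
    (fun j hj i hi => ?_)
  · rw [Finset.disjoint_left]
    intro j hj hj'
    have := (mem_level.1 hj).2
    have := (mem_level.1 hj').2
    omega
  · obtain ⟨h1, h2, h3⟩ := hD i hi
    rw [h3]; exact Instance.proc_nonneg h1 hq (by omega)
  · obtain ⟨h1, h2, h3⟩ := hD i hi
    rw [h3, hlen i h1]; exact Instance.proc_mono h1 hq (by omega) le_rfl
  · simp only [ht]
    split_ifs with hj
    · exact hτ.1 _
    · exact le_rfl
  · obtain ⟨h1, h2⟩ := mem_level.1 hj
    obtain ⟨h3, h4⟩ := mem_level.1 hk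
    rw [hlen j h1, hlen k h3, h2, h4]
    exact hlp j h1 q hq h2.ge k h3 h4.ge hjk
  · obtain ⟨h1, h2⟩ := mem_level.1 hj
    obtain ⟨h3, h4⟩ := mem_level.1 hk
    rw [hlen j h1, hlen k h3, h2, h4]
    exact hlp j h1 (q + 1) (by omega) h2.ge k h3 h4.ge hjk
  · obtain ⟨h1, h2⟩ := mem_level.1 hj
    obtain ⟨h3, h4, h5⟩ := hD i hi
    rw [hlen j h1, h2, h5]
    exact hlp j h1 q hq h2.ge i h3 (by omega) (fun hc => by subst hc; omega)

end MatchUp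


/-! ### All classes together and the step count. -/

namespace MatchUp

open Finset RealRAM

variable {Ψ : Instance} {ε : ℝ}

/-- Processing times increase with the layer, so jobs that are disjoint in their highest common
layer are disjoint in all common layers. -/
theorem isApprox_of_packed {σ : ℕ → ℝ} {T α : ℝ}
    (h : Packed Ψ.common (fun j => Ψ.proc j (Ψ.ht j)) σ (range Ψ.n) 0 T)
    (hT : ∀ τ, Ψ.Feasible τ → T ≤ α * Ψ.makespan τ) : Ψ.IsApprox α fun B => σ B := by
  refine ⟨⟨fun B => (h.1 B (mem_range.2 B.2)).1, fun i hi hiL B B' hne hm => ?_⟩, fun τ hτ =>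
    (Finset.sup'_le _ _ fun B _ => ?_).trans (hT τ hτ)⟩
  · have key : ∀ B B' : Fin Ψ.n, i ≤ min (Ψ.h B) (Ψ.h B') → Ψ.p B i ≤ Ψ.common B B' :=
      fun B B' hm => by
        have h1 : Ψ.p B i = Ψ.proc B i := by simp [Instance.proc]
        have h2 : Ψ.ht B = Ψ.h B := by simp [Instance.ht]
        have h3 : Ψ.ht B' = Ψ.h B' := by simp [Instance.ht]
        rw [h1, Instance.common, h2, h3]
        exact Instance.proc_mono B.2 hi (hm.trans (le_max_right _ _))
          (by rw [h2]; exact max_le (Ψ.one_le_h _) (min_le_left _ _))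
    have h1 := key B B' hm
    have h2 := key B' B (by rwa [min_comm])
    rcases h.2 B (mem_range.2 B.2) B' (mem_range.2 B'.2) (fun hc => hne (Fin.ext hc)) with h3 | h3
    · right; linarith
    · left; linarith
  · have := (h.1 B (mem_range.2 B.2)).2
    simpa [Instance.proc, Instance.ht] using this

/-- Each class adds at most `1 + 12ε` times the makespan of any feasible schedule, and ⌈L/2⌉ odd
values of `q` exhaust all heights up to `L`. -/
theorem matchUp_runs {K M Nm : ℕ} (hn : 2 ≤ Ψ.n) (hε0 : 0 < ε) (hε1 : ε ≤ 1 / 2)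
    (hK : 1 / (ε * ε) < (1 + ε) ^ K) (hM : 1 / (1 + ε) ^ M ≤ ε * ε / Ψ.n)
    (hNm : 1 + M * ((Ψ.n + 1) * (Ψ.n + 1) ^ (2 * K)) ≤ Nm) :
    Runs matchUp (Ψ.input ε)
      (6000 * (Ψ.L * ((M + 1) * ((Ψ.n + 1) ^ 4 * (Nm + 1) ^ 2)))) fun s =>
      Ψ.IsApprox ((⌈(Ψ.L : ℝ) / 2⌉₊ : ℝ) * (1 + 12 * ε)) (Ψ.output s) := by
  set n := Ψ.n with hn'
  set U := (M + 1) * ((n + 1) ^ 4 * (Nm + 1) ^ 2) with hU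
  set len : ℕ → ℝ := fun j => Ψ.proc j (Ψ.ht j) with hlen
  have hL1 : 1 ≤ Ψ.L := (Instance.ht_pos Ψ.n_pos).trans (Instance.ht_le Ψ.n_pos)
  -- The number of odd values up to `L`.
  set Q := (Ψ.L + 1) / 2 with hQ
  have hceil : ⌈(Ψ.L : ℝ) / 2⌉₊ = Q := by
    refine le_antisymm (Nat.ceil_le.2 ?_) ?_
    · rw [div_le_iff₀ two_pos]
      have : Ψ.L ≤ Q * 2 := by omega
      exact_mod_cast this
    · have h1 := Nat.le_ceil ((Ψ.L : ℝ) / 2)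
      rw [div_le_iff₀ two_pos] at h1
      have : Ψ.L ≤ ⌈(Ψ.L : ℝ) / 2⌉₊ * 2 := by exact_mod_cast h1
      omega
  unfold matchUp
  refine (Runs.cond (B := n * (60 + 9) + 7 + (2 + (Q * (5000 * U + 4 + 3 + 1) + 3 + 1)))
    (fun hc => absurd hc ?_) fun _ => Runs.seq setup_runs fun s₁ f₁ ⟨h1, h2, h3⟩ => Runs.seq
    (B₁ := 2) (Q₁ := fun s' => s' = s₁.setn 3 1) (Runs.of_run rfl (Nat.le_of_ble_eq_true rfl)
      (by simp [Prog.run, NExp.eval])) fun s₂ f₂ h₂ =>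
    (Runs.loop (M := Q) (B := 5000 * U + 4) (fun k s' => s'.nvar 3 = 2 * k + 1 ∧ 0 ≤ s'.rvar 2 ∧
      (∀ τ, Ψ.Feasible τ → s'.rvar 2 ≤ k * (1 + 12 * ε) * Ψ.makespan τ) ∧
      Packed Ψ.common len (s'.rarr 1) {j ∈ range n | Ψ.ht j ≤ 2 * k} 0 (s'.rvar 2))
      ?_ ?_ ?_).mono le_rfl ?_).le ?_
  · simp only [BExp.eval, NExp.eval, Instance.input, if_true]
    omega
  · have e2 : s₂.rvar 2 = 0 := by
      rw [h₂, State.setn_rvar, f₁.r 2 rfl]; simp [Instance.input]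
    rw [e2]
    refine ⟨by simp [h₂], le_rfl, by simp, ?_⟩
    rw [show ({j ∈ range n | Ψ.ht j ≤ 2 * 0} : Finset ℕ) = ∅ from
      filter_false_of_mem fun j hj h => by have := Instance.ht_pos (mem_range.1 hj); omega]
    exact Packed.empty
  · intro k s' hk hb hf ⟨h4, h5, h6, h7⟩
    have e2 : s'.rarr 2 = s₁.rarr 2 := by rw [hf.ra 2 rfl, f₂.ra 2 rfl]
    have e3 : s'.rarr 3 = s₁.rarr 3 := by rw [hf.ra 3 rfl, f₂.ra 3 rfl]
    have h3a : ∀ j < n, s₁.rarr 2 j = len j := fun j hj => (h3 j hj).1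
    have h3b : ∀ j < n, 2 ≤ Ψ.ht j → s₁.rarr 3 j = Ψ.proc j (Ψ.ht j - 1) := fun j hj => (h3 j hj).2
    have h3c : ∀ j < n, Ψ.ht j = 2 * k + 1 + 1 → s₁.rarr 3 j = Ψ.proc j (2 * k + 1) :=
      fun j hj hjk => by rw [h3b j hj (by omega), hjk, Nat.add_sub_cancel]
    refine Runs.seq (solveClass_runs (T := s'.rvar 2) (w := Ψ.common) (n := n) (q := 2 * k + 1)
      (h := Ψ.ht) (ε := ε) (K := K) (M := M) (Nm := Nm) (len := s₁.rarr 2) (p₁ := s₁.rarr 3)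
      (by rw [hf.n 0 rfl, f₂.n 0 rfl, f₁.n 0 rfl]; simp [Instance.input, hn']) h4
      (by rw [hf.na 0 rfl, f₂.na 0 rfl, f₁.na 0 rfl]; exact input_narr) e2 e3
      (by rw [hf.r 0 rfl, f₂.r 0 rfl, f₁.r 0 rfl]; simp [Instance.input])
      (by rw [hf.r 1 rfl, f₂.r 1 rfl, h2]) rfl (by omega) hε0 hε1
      (fun j hj => by
        rw [h3a j hj]; exact Instance.proc_nonneg hj (Instance.ht_pos hj) le_rfl)
      (fun j hj m => by rw [h3a j hj]; exact Instance.common_le hj m)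
      (fun j hj hjk => by rw [h3c j hj hjk]; exact Instance.proc_nonneg hj (by omega) (by omega))
      (fun j hj hjk => by
        rw [h3c j hj hjk, h3a j hj]; exact Instance.proc_mono hj (by omega) (by omega) le_rfl)
      (fun i hi hik j hj hjk => by
        rw [h3c i hi hik, Instance.common, hik, hjk, min_eq_right (by omega),
          max_eq_right (by omega)])
      hK hM hNm) fun s'' f'' ⟨g1, g2, g3, g4⟩ => Runs.of_run rfl (Nat.le_of_ble_eq_true rfl) ?_
    have e3' : s''.nvar 3 = 2 * k + 1 := by rw [f''.n 3 rfl, h4]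
    simp only [Prog.run, NExp.eval, e3', State.setn_nvar, State.setn_rvar, State.setn_rarr, if_true]
    refine ⟨by ring, h5.trans g1, fun τ hτ => ?_, ?_⟩
    · obtain ⟨X, hX⟩ := exists_classCost_le_makespan hτ (q := 2 * k + 1) (by omega) h3a h3b
      have h8 := g2 X
      have h9 := mul_le_mul_of_nonneg_left hX (show 0 ≤ 1 + 12 * ε by linarith)
      have h10 := h6 τ hτ
      push_cast
      linarith
    · have hS : ({j ∈ range n | Ψ.ht j ≤ 2 * (k + 1)} : Finset ℕ) =
          {j ∈ range n | Ψ.ht j ≤ 2 * k} ∪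
            (level Ψ.ht n (2 * k + 1) ∪ level Ψ.ht n (2 * k + 1 + 1)) := by
        ext j
        simp only [mem_union, mem_filter, mem_level, mem_range]
        omega
      rw [hS]
      refine Packed.append (h7.congr fun j hj => g4 j fun hc => ?_) ?_ h5 g1
        fun j hj m => Instance.common_le ?_ m
      · simp only [mem_union, mem_filter, mem_level, mem_range] at hj hc
        omega
      · refine ⟨fun j hj => ?_, g3.2⟩
        have := g3.1 j hj
        rwa [h3a j (by simp only [mem_union, mem_level] at hj; omega)] at this
      · simp only [mem_union, mem_filter, mem_level, mem_range] at hj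
        omega
  · intro s' hf ⟨h4, _⟩ hb
    have e1 : s'.nvar 1 = Ψ.L := by rw [hf.n 1 rfl, f₂.n 1 rfl, h1]
    simp only [BExp.eval, NExp.eval, h4, e1] at hb
    omega
  · intro s' hf ⟨hb, k, hk, h4, h5, h6, h7⟩
    have e1 : s'.nvar 1 = Ψ.L := by rw [hf.n 1 rfl, f₂.n 1 rfl, h1]
    simp only [BExp.eval, NExp.eval, h4, e1] at hb
    rw [show ({j ∈ range n | Ψ.ht j ≤ 2 * k} : Finset ℕ) = range n from
      filter_true_of_mem fun j hj => by have := Instance.ht_le (mem_range.1 hj); omega] at h7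
    refine isApprox_of_packed h7 fun τ hτ => (h6 τ hτ).trans ?_
    have := makespan_nonneg hτ
    rw [hceil]
    gcongr
  · have e1 : n + 1 ≤ U := (Nat.le_self_pow (n := 4) (by omega) _).trans
      ((Nat.le_mul_of_pos_right _ (by positivity)).trans (Nat.le_mul_of_pos_left _ (by omega)))
    have e2 : Q * (5000 * U + 4 + 3 + 1) = 5000 * (Q * U) + 8 * Q := by ring
    have e3 : Q * U ≤ Ψ.L * U := Nat.mul_le_mul_right _ (by omega)
    have e4 : U ≤ Ψ.L * U := Nat.le_mul_of_pos_left _ (by omega)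
    have e5 : Q ≤ Q * U := Nat.le_mul_of_pos_right _ (by omega)
    rw [e2]
    simp only [BExp.cost, NExp.cost]
    omega

/-- All quantities are bounded by powers of `x = n ^ e`, where `e` is the exponent of the theorem up
to its constant. Since `e ≥ 2` and `n ≥ 2`, additive and multiplicative constants are absorbed by
one more factor `x`. -/
theorem pow_bounds {n : ℕ} (hn : 2 ≤ n) (hε0 : 0 < ε) (hε1 : ε ≤ 1 / 2) :
    ∃ K M Nm : ℕ, 1 / (ε * ε) < (1 + ε) ^ K ∧ 1 / (1 + ε) ^ M ≤ ε * ε / n ∧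
      1 + M * ((n + 1) * (n + 1) ^ (2 * K)) ≤ Nm ∧
      (((M + 1) * ((n + 1) ^ 4 * (Nm + 1) ^ 2) : ℕ) : ℝ) ≤
        ((n : ℝ) ^ ((1 / ε) * Real.logb (1 + ε) (1 / ε))) ^ 35 := by
  set l := Real.logb (1 + ε) (1 / ε) with hl
  set e := 1 / ε * l with he
  set x := (n : ℝ) ^ e with hx
  have hε2 : 2 ≤ 1 / ε := by rw [le_div_iff₀ hε0]; linarith
  have hb : 1 < 1 + ε := by linarith
  have hl1 : 1 ≤ l := by
    rw [hl, Real.le_logb_iff_rpow_le hb (by positivity), Real.rpow_one]; linarith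
  have he2 : 2 * l ≤ e := mul_le_mul_of_nonneg_right hε2 (by linarith)
  have heε : 1 / ε ≤ e := le_mul_of_one_le_right (by positivity) hl1
  have hn1 : (1 : ℝ) ≤ n := by exact_mod_cast (by omega : 1 ≤ n)
  have hn2 : (2 : ℝ) ≤ n := by exact_mod_cast hn
  have hpow : ∀ a : ℕ, (a : ℝ) ≤ e → (n : ℝ) ^ a ≤ x := fun a ha => by
    rw [hx, ← Real.rpow_natCast]; exact Real.rpow_le_rpow_of_exponent_le hn1 ha
  have hnx : (n : ℝ) ^ 2 ≤ x := hpow 2 (by push_cast; linarith)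
  have hn1x : (n : ℝ) + 1 ≤ x := by nlinarith
  have h4x : 4 ≤ x := by nlinarith
  -- `1 / ε ≤ 2 ^ (1 / ε) ≤ n ^ e`. This is where `n ≥ 2` is indispensable: factors polynomial in `1
  -- / ε` become powers of `n`.
  have hεx : 1 / ε ≤ x := by
    have h1 : (1 / ε : ℝ) ≤ 2 ^ (1 / ε) := by
      have h2 := one_add_mul_self_le_rpow_one_add (s := 1) (by norm_num) (p := 1 / ε) (by linarith)
      norm_num at h2 ⊢
      linarith
    refine h1.trans ((Real.rpow_le_rpow_of_exponent_le one_le_two heε).trans ?_)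
    exact Real.rpow_le_rpow zero_le_two hn2 (by linarith)
  -- `K` is the least integer above `2 * l`, because `(1 + ε) ^ (2 * l) = 1 / ε²`. The number of
  -- levels `M` is chosen generously, so that Bernoulli's inequality suffices.
  refine ⟨⌊2 * l⌋₊ + 1, ⌈n * (1 / ε) ^ 3⌉₊, 1 + ⌈n * (1 / ε) ^ 3⌉₊ *
    ((n + 1) * (n + 1) ^ (2 * (⌊2 * l⌋₊ + 1))), ?_, ?_, le_rfl, ?_⟩
  · have h1 := Nat.lt_floor_add_one (2 * l)
    have h2 : (1 + ε) ^ (2 * l) = 1 / (ε * ε) := by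
      rw [two_mul, Real.rpow_add (by linarith), hl,
        Real.rpow_logb (by linarith) (by linarith) (by positivity)]
      field_simp
    rw [← h2, ← Real.rpow_natCast]
    exact Real.rpow_lt_rpow_of_exponent_lt hb (by push_cast; exact h1)
  -- Bernoulli: `(1 + ε) ^ M ≥ 1 + M * ε ≥ n / ε²`.
  · set M := ⌈n * (1 / ε) ^ 3⌉₊ with hM
    have h1 : n * (1 / ε) ^ 3 ≤ (M : ℝ) := Nat.le_ceil _
    have h2 := one_add_mul_le_pow (show -2 ≤ ε by linarith) M
    have h3 : n / (ε * ε) ≤ (1 + ε) ^ M := by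
      have h4 : n / (ε * ε) = n * (1 / ε) ^ 3 * ε := by field_simp
      rw [h4]
      have := mul_le_mul_of_nonneg_right h1 hε0.le
      linarith
    have h5 : ε * ε / n = 1 / (n / (ε * ε)) := by rw [one_div_div]
    rw [h5]
    exact one_div_le_one_div_of_le (by positivity) h3
  · set M := ⌈n * (1 / ε) ^ 3⌉₊ with hM
    set K := ⌊2 * l⌋₊ + 1 with hK
    have hx0 : 0 < x := by linarith
    have hMx : (M : ℝ) + 1 ≤ x ^ 5 := by
      have h1 := (Nat.ceil_lt_add_one (show 0 ≤ n * (1 / ε) ^ 3 by positivity)).le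
      have h2 : n * (1 / ε) ^ 3 ≤ x * x ^ 3 := by gcongr; linarith
      have h3 : x * x ^ 3 + 2 ≤ x ^ 5 := by
        have : 1 ≤ x ^ 4 := one_le_pow₀ (by linarith)
        have h5 : x ^ 5 = x ^ 4 * x := by ring
        have h6 : x * x ^ 3 = x ^ 4 := by ring
        nlinarith
      linarith
    have hKx : ((n : ℝ) + 1) * ((n : ℝ) + 1) ^ (2 * K) ≤ x ^ 7 := by
      have h1 : (n : ℝ) + 1 ≤ (n : ℝ) ^ 2 := by nlinarith
      -- `4K + 2 ≤ 8l + 6 ≤ 4e + 3e`, by `2l ≤ e` and `2 ≤ e`.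
      have h2 : ((4 * K + 2 : ℕ) : ℝ) ≤ 7 * e := by
        have := Nat.floor_le (show 0 ≤ 2 * l by linarith)
        push_cast [hK]
        linarith
      rw [← pow_succ']
      refine (pow_le_pow_left₀ (by positivity) h1 _).trans ?_
      rw [← pow_mul, show 2 * (2 * K + 1) = 4 * K + 2 by ring, ← Real.rpow_natCast]
      refine (Real.rpow_le_rpow_of_exponent_le hn1 h2).trans (le_of_eq ?_)
      rw [hx, ← Real.rpow_natCast, ← Real.rpow_mul (by positivity)]
      congr 1
      push_cast
      ring
    have hNx : (1 : ℝ) + M * (((n : ℝ) + 1) * ((n : ℝ) + 1) ^ (2 * K)) + 1 ≤ x ^ 13 := by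
      have h1 : M * (((n : ℝ) + 1) * ((n : ℝ) + 1) ^ (2 * K)) ≤ x ^ 5 * x ^ 7 := by
        gcongr; linarith
      have h3 : x ^ 5 * x ^ 7 + 2 ≤ x ^ 13 := by
        have : 1 ≤ x ^ 12 := one_le_pow₀ (by linarith)
        have h5 : x ^ 13 = x ^ 12 * x := by ring
        have h6 : x ^ 5 * x ^ 7 = x ^ 12 := by ring
        nlinarith
      linarith
    push_cast
    calc ((M : ℝ) + 1) * (((n : ℝ) + 1) ^ 4 * (1 + M * (((n : ℝ) + 1) * ((n : ℝ) + 1) ^ (2 * K)) + 1) ^ 2)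
        ≤ x ^ 5 * (x ^ 4 * (x ^ 13) ^ 2) := by gcongr
      _ = x ^ 35 := by ring

/-- A single job started at 0 is optimal. -/
theorem isApprox_zero {α : ℝ} (hn : Ψ.n ≤ 1) (hα : 1 ≤ α) : Ψ.IsApprox α fun _ => 0 := by
  refine ⟨⟨fun _ => le_rfl, fun i _ _ B B' hne => absurd (Fin.ext ?_) hne⟩, fun τ hτ => ?_⟩
  · have := B.2
    have := B'.2
    omega
  · refine (Finset.sup'_le _ _ fun B _ => ?_).trans
      (le_mul_of_one_le_left (makespan_nonneg hτ) hα)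
    refine le_trans ?_ (Finset.le_sup' (fun B => τ B + Ψ.p B (Ψ.h B)) (mem_univ B))
    have := hτ.1 B
    simp only
    linarith

end MatchUp

theorem mainTheorem3 :
    ∃ (prog : RealRAM.Prog) (c C : ℝ), ∀ (Ψ : MatchUp.Instance) (ε : ℝ), 0 < ε → ε ≤ 1 / 2 →
      ∃ (t : ℕ) (s : RealRAM.State),
        RealRAM.Exec prog (Ψ.input ε) t s ∧
        (t : ℝ) ≤ C * ((Ψ.L : ℝ) *
          (Ψ.n : ℝ) ^ (C * ((1 / ε) * Real.logb (1 + ε) (1 / ε)))) ∧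
        Ψ.IsApprox ((⌈(Ψ.L : ℝ) / 2⌉₊ : ℝ) * (1 + c * ε)) (Ψ.output s) := by
  -- 12 is the loss per class. 6000 is the constant factor of the step bound and also exceeds the
  -- exponent 35 of `pow_bounds`.
  refine ⟨MatchUp.matchUp, 12, 6000, fun Ψ ε hε0 hε1 => ?_⟩
  have hL1 : 1 ≤ Ψ.L :=
    (MatchUp.Instance.ht_pos Ψ.n_pos).trans (MatchUp.Instance.ht_le Ψ.n_pos)
  have hL : (1 : ℝ) ≤ Ψ.L := by exact_mod_cast hL1
  have hn1 : (1 : ℝ) ≤ Ψ.n := by exact_mod_cast Ψ.n_pos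
  have he : 0 ≤ (1 / ε) * Real.logb (1 + ε) (1 / ε) :=
    mul_nonneg (by positivity) (Real.logb_nonneg (by linarith) (by rw [le_div_iff₀ hε0]; linarith))
  -- For `n = 1` the power of `n` is 1 and the time allowed no longer depends on `ε`, so the dynamic
  -- program cannot be run. The program skips everything, and the output array holds its initial
  -- zeros.
  rcases Nat.lt_or_ge Ψ.n 2 with hn | hn
  · have hb : RealRAM.BExp.eval (Ψ.input ε) (.leN (.var 0) (.const 1)) := by
      simpa [RealRAM.BExp.eval, RealRAM.NExp.eval, MatchUp.Instance.input] using
        Nat.le_of_lt_succ hn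
    refine ⟨_, _, .cond_true hb (.skip _), ?_, ?_⟩
    · have h1 : (1 : ℝ) ≤ (Ψ.n : ℝ) ^ (6000 * ((1 / ε) * Real.logb (1 + ε) (1 / ε))) :=
        Real.one_le_rpow hn1 (by positivity)
      have h2 := one_le_mul_of_one_le_of_one_le hL h1
      simp only [RealRAM.BExp.cost, RealRAM.NExp.cost]
      push_cast
      linarith
    · have h1 : (1 : ℝ) ≤ ⌈(Ψ.L : ℝ) / 2⌉₊ := by
        exact_mod_cast Nat.one_le_ceil_iff.2 (by positivity)
      have h2 := MatchUp.isApprox_zero (Ψ := Ψ) (Nat.le_of_lt_succ hn)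
        (one_le_mul_of_one_le_of_one_le h1 (show 1 ≤ 1 + 12 * ε by linarith))
      convert h2 using 2
      simp [MatchUp.Instance.output, MatchUp.Instance.input]
  · obtain ⟨K, M, Nm, hK, hM, hNm, hb⟩ := MatchUp.pow_bounds hn hε0 hε1
    obtain ⟨t, s, h1, h2, h3⟩ := MatchUp.matchUp_runs hn hε0 hε1 hK hM hNm
    refine ⟨t, s, h1, ?_, h3⟩
    have h4 : (t : ℝ) ≤ (6000 * (Ψ.L * ((M + 1) * ((Ψ.n + 1) ^ 4 * (Nm + 1) ^ 2))) : ℕ) := by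
      exact_mod_cast h2
    refine h4.trans ?_
    rw [Nat.cast_mul, Nat.cast_mul, Nat.cast_ofNat]
    gcongr
    refine hb.trans ?_
    rw [← Real.rpow_natCast, ← Real.rpow_mul (by positivity)]
    refine Real.rpow_le_rpow_of_exponent_le hn1 ?_
    rw [mul_comm]
    exact mul_le_mul_of_nonneg_right (by norm_num) he
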